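/- Let $T$ be the 2-monad on $\mathbb N$-indexed families of categories that is induced by the polynomial monad of ordered rooted trees (rooted trees with a linear order on the inputs of each vertex and on the set of leaves, up to isomorphism): $(TX)_n=\coprod_{a}\prod_{b}X_{s(b)}$, where $a$ runs over the ordered rooted trees with $n$ leaves, $b$ over the vertices of $a$, and $s(b)$ is the number of inputs of $b$; the multiplication substitutes trees into vertices. Let $T_{nu}$ and $T_{ns}$ be its submonads given by all trees except the free living edge $|$, and by the planar trees (the order of the leaves is the planar one) except $|$. A unital categorical operad is a pseudo-$T$-algebra $\mathscr O=(\mathscr O(n))_{n\ge 0}$. Write $\odot_i\colon \mathscr O(m)\times\mathscr O(k)\to\mathscr O(m+k-1)$ for its structure functor given by the planar tree with two vertices in which a $k$-ary vertex is grafted onto the $i$-th input of an $m$-ary vertex, $\pi(-)\colon\mathscr O(n)\to\mathscr O(n)$ for the one given by the $n$-corolla with leaves permuted by $\pi\in\Sigma_n$, and $E\in\mathscr O(1)$ for the unit, given by $|$. Internal collections, non-symmetric (non-unital) operads, (symmetric, non-unital) operads, and unital operads in $\mathscr O$ are, respectively, families of objects $A_n\in\mathscr O(n)$, and lax morphisms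 to $\mathscr O$ from the terminal pseudo-algebra of $T_{ns}$, $T_{nu}$ and $T$. There are forgetful functors $$\mathit{IColl}(\mathscr O)\xleftarrow{U_1}\mathit{IOp}_{ns}(\mathscr O)\xleftarrow{U_2}\mathit{IOp}(\mathscr O)\xleftarrow{U_3}\mathit{IOp}_u(\mathscr O),\qquad U=U_1U_2U_3 .$$ A leveled planar tree $\mathscr T$ with $n$ leaves is a sequence of $k\ge1$ order preserving maps $\underline n=\underline n_1\xrightarrow{(\tau_1,i_1)}\underline n_2\to\cdots\to\underline n_k\xrightarrow{(\tau_k,i_k)}\underline 1$ between finite ordinals, each with a marked point $i_j$ of its target, such that the fibre of $\tau_j$ over every point other than $i_j$ has exactly one element; let $t_j$ be the cardinality of the marked fibre $\tau_j^{-1}(i_j)$. Let $\mathtt{lT}(n)$ be the groupoid of these trees in which two trees are uniquely isomorphic if they are connected by interchanges of adjacent levels, i.e. by replacing adjacent maps $(\psi',p),(\phi',q)$ with $(\psi'',r),(\phi'',s)$ where $\phi'\psi'=\phi''\psi''$, $\phi'(p)=s$, $\phi''(r)=q$ and $q\ne s$. For an internal collection $X$ let $\hat X\colon\mathtt{lT}(n)\to\mathscr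 O(n)$ be the functor $$\hat X(\mathscr T)=(\cdots(X_{t_k}\odot_{i_{k-1}}X_{t_{k-1}})\odot_{i_{k-2}}\cdots)\odot_{i_1}X_{t_1},$$ on which the isomorphisms of trees act by the structure isomorphisms of $\mathscr O$. **Proposition.** Let $\mathscr O$ be a unital categorical operad such that every $\mathscr O(n)$ is cocomplete and all $\odot_i$ preserve colimits in each variable separately. Then $U_1,U_2,U_3$ have left adjoints $F_1,F_2,F_3$, with units $\eta$, which are computed as follows, for all $n$: * $F_1(X)_n=\operatorname{colim}_{\mathtt{lT}(n)}\hat X$, with colimit cocone the maps $\hat X(\mathscr T)\to\widehat{F_1(X)}(\mathscr T)\to F_1(X)_n$ given by $\eta$ at every vertex and the composition of $F_1(X)$ along $\mathscr T$; * $F_2(A)_n=\bigoplus_{\pi\in\Sigma_n}\pi(A_n)$, with inclusions $\pi(A_n)\to\pi(F_2(A)_n)\to F_2(A)_n$ given by $\eta$ and the internal action of $\pi$; * $F_3(A)_n=A_n\oplus I_n$, with inclusions given by $\eta$ and by the internal unit of $F_3(A)$, where $I_1=E$ and $I_n=\emptyset$ (the initial object) for $n\ne1$. The composite $F=F_3\circ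 F_2\circ F_1$ is left adjoint to $U\colon\mathit{IOp}_u(\mathscr O)\to\mathit{IColl}(\mathscr O)$. -/

import Mathlib

open CategoryTheory CategoryTheory.Limits
universe v u w u₁ u₂ u₃
namespace FreeOp

/-- Planar rooted trees whose vertices of arity `k` are decorated by elements of `X k` and whose
leaves are labelled by elements of `L`.  The tree `leaf l` is the free living edge `|`. -/
inductive Tr (X : ℕ → Type u) (L : Type) : Type u
  | leaf (l : L) : Tr X L
  | node (k : ℕ) (x : X k) (ts : Fin k → Tr X L) : Tr X L

namespace Tr
variable {X : ℕ → Type u₁} {Y : ℕ → Type u₂} {Z : ℕ → Type u₃} {L M N : Type}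

/-- Apply `f` to all vertex decorations. -/
def map (f : ∀ k, X k → Y k) : Tr X L → Tr Y L
  | leaf l => leaf l
  | node k x ts => node k (f k x) fun i => (ts i).map f

/-- Graft the tree `g l` onto every leaf labelled `l`. -/
def bind : Tr X L → (L → Tr X M) → Tr X M
  | leaf l, g => g l
  | node k x ts, g => node k x fun i => (ts i).bind g

/-- The labels of the leaves, in planar order. -/
def leaves : Tr X L → List L
  | leaf l => [l]
  | node _ _ ts => (List.finRange _).flatMap fun i => (ts i).leaves

theorem map_map (f : ∀ k, X k → Y k) (g : ∀ k, Y k → Z k) (t : Tr X L) :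
    (t.map f).map g = t.map fun k x => g k (f k x) := by
  induction t with
  | leaf l => rfl
  | node k x ts ih => simp only [map, ih]

theorem map_id (t : Tr X L) : t.map (fun _ x => x) = t := by
  induction t with
  | leaf l => rfl
  | node k x ts ih => simp only [map, ih]

theorem bind_leaf (t : Tr X L) : t.bind leaf = t := by
  induction t with
  | leaf l => rfl
  | node k x ts ih => simp only [bind, ih]

theorem bind_bind (t : Tr X L) (g : L → Tr X M) (h : M → Tr X N) :
    (t.bind g).bind h = t.bind fun l => (g l).bind h := by
  induction t with
  | leaf l => rfl
  | node k x ts ih => simp only [bind, ih]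

theorem map_bind (f : ∀ k, X k → Y k) (t : Tr X L) (g : L → Tr X M) :
    (t.bind g).map f = (t.map f).bind fun l => (g l).map f := by
  induction t with
  | leaf l => rfl
  | node k x ts ih => simp only [map, bind, ih]

theorem leaves_map (f : ∀ k, X k → Y k) (t : Tr X L) : (t.map f).leaves = t.leaves := by
  induction t with
  | leaf l => rfl
  | node k x ts ih => simp only [map, leaves, ih]

theorem leaves_bind (t : Tr X L) (g : L → Tr X M) :
    (t.bind g).leaves = t.leaves.flatMap fun l => (g l).leaves := by
  induction t with
  | leaf l => simp [bind, leaves]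
  | node k x ts ih =>
    simp only [bind, leaves, ih]
    rw [List.flatMap_assoc]

end Tr

/-- Ordered rooted trees with `n` leaves and vertices of arity `k` decorated by `X k`: planar
trees whose leaves are labelled bijectively by `Fin n`.  The linear orders on the inputs of the vertices
are the planar structure and the labelling is the linear order on the leaves; since a planar tree has no
nontrivial automorphism, an isomorphism class of such trees is the same thing as an element of this type.
So `OTree X n` is `∑ a, ∏ b, X (s b)`, over the ordered rooted trees `a` with `n` leaves and the vertices
`b` of `a`, i.e. `(T X) n` for the polynomial monad `T` whose algebras are symmetric operads. -/
structure OTree (X : ℕ → Type u) (n : ℕ) : Type u where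
  tree : Tr X (Fin n)
  linear : tree.leaves.Perm (List.finRange n)

namespace Tr
variable {X : ℕ → Type u₁} {Y : ℕ → Type u₂} {Z : ℕ → Type u₃} {L M N : Type}

/-- Replace every vertex `x` of arity `k` by the ordered tree `r k x` with `k` leaves, the `i`-th
leaf of which is identified with the `i`-th input of the vertex. -/
def subst (r : ∀ k, X k → OTree Y k) : Tr X L → Tr Y L
  | leaf l => leaf l
  | node k x ts => (r k x).tree.bind fun i => (ts i).subst r

theorem leaves_subst_perm (r : ∀ k, X k → OTree Y k) (t : Tr X L) :
    (t.subst r).leaves.Perm t.leaves := by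
  induction t with
  | leaf l => exact List.Perm.refl _
  | node k x ts ih =>
    simp only [subst, leaves, leaves_bind]
    refine ((r k x).linear.flatMap_right _).trans ?_
    exact List.Perm.flatMap_left _ fun i _ => ih i

theorem leaves_subst_eq (r : ∀ k, X k → OTree Y k)
    (hr : ∀ k x, (r k x).tree.leaves = List.finRange k) (t : Tr X L) :
    (t.subst r).leaves = t.leaves := by
  induction t with
  | leaf l => rfl
  | node k x ts ih =>
    simp only [subst, leaves, leaves_bind, hr, ih]

theorem subst_map (f : ∀ k, X k → Y k) (r : ∀ k, Y k → OTree Z k) (t : Tr X L) :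
    (t.map f).subst r = t.subst fun k x => r k (f k x) := by
  induction t with
  | leaf l => rfl
  | node k x ts ih => simp only [map, subst, ih]

theorem subst_bind (r : ∀ k, X k → OTree Y k) (t : Tr X L) (g : L → Tr X M) :
    (t.bind g).subst r = (t.subst r).bind fun l => (g l).subst r := by
  induction t with
  | leaf l => rfl
  | node k x ts ih => simp only [bind, subst, ih, bind_bind]

end Tr

namespace OTree
variable {X : ℕ → Type u₁} {Y : ℕ → Type u₂} {Z : ℕ → Type u₃} {n : ℕ}

@[ext] theorem ext {s t : OTree X n} (h : s.tree = t.tree) : s = t := by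
  cases s; cases t; cases h; rfl

def map (f : ∀ k, X k → Y k) (t : OTree X n) : OTree Y n :=
  ⟨t.tree.map f, by rw [Tr.leaves_map]; exact t.linear⟩

def subst (r : ∀ k, X k → OTree Y k) (t : OTree X n) : OTree Y n :=
  ⟨t.tree.subst r, (Tr.leaves_subst_perm r t.tree).trans t.linear⟩

/-- The corolla whose `i`-th input is the leaf labelled `π i`. -/
def corollaPerm (π : Equiv.Perm (Fin n)) (x : X n) : OTree X n :=
  ⟨.node n x fun i => .leaf (π i), by
    simp only [Tr.leaves, ← List.map_eq_flatMap]
    exact π.map_finRange_perm⟩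

/-- The corolla with inputs labelled in the planar order. -/
def corolla (x : X n) : OTree X n :=
  ⟨.node n x fun i => .leaf i, by
    simp only [Tr.leaves, List.flatMap_singleton']
    exact List.Perm.refl _⟩

theorem map_map (f : ∀ k, X k → Y k) (g : ∀ k, Y k → Z k) (t : OTree X n) :
    (t.map f).map g = t.map fun k x => g k (f k x) :=
  ext (Tr.map_map f g t.tree)

theorem map_id (t : OTree X n) : t.map (fun _ x => x) = t := ext (Tr.map_id t.tree)

theorem subst_map (f : ∀ k, X k → Y k) (r : ∀ k, Y k → OTree Z k) (t : OTree X n) :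
    (t.map f).subst r = t.subst fun k x => r k (f k x) := ext (Tr.subst_map f r t.tree)

end OTree

namespace Tr
variable {X : ℕ → Type u₁} {Y : ℕ → Type u₂} {Z : ℕ → Type u₃} {L M N : Type}

theorem map_subst (r : ∀ k, X k → OTree Y k) (f : ∀ k, Y k → Z k) (t : Tr X L) :
    (t.subst r).map f = t.subst fun k x => (r k x).map f := by
  induction t with
  | leaf l => rfl
  | node k x ts ih => simp only [subst, map_bind, ih, OTree.map]

theorem subst_subst (r : ∀ k, X k → OTree Y k) (q : ∀ k, Y k → OTree Z k) (t : Tr X L) :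
    (t.subst r).subst q = t.subst fun k x => (r k x).subst q := by
  induction t with
  | leaf l => rfl
  | node k x ts ih => simp only [subst, subst_bind, ih, OTree.subst]

theorem subst_corolla (f : ∀ k, X k → Y k) (t : Tr X L) :
    (t.subst fun k x => OTree.corolla (f k x)) = t.map f := by
  induction t with
  | leaf l => rfl
  | node k x ts ih => exact congrArg (node k (f k x)) (funext ih)
end Tr

/-- Morphisms of decorated trees: they exist only between decorations of the same tree, and consist
of one morphism for each vertex. -/
inductive TrHom {C : ℕ → Type u} [∀ k, Category.{v} (C k)] {L : Type} :
    Tr C L → Tr C L → Type (max u v)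
  | leaf (l : L) : TrHom (.leaf l) (.leaf l)
  | node {k : ℕ} {x y : C k} {ts ss : Fin k → Tr C L} (f : x ⟶ y)
      (g : ∀ i, TrHom (ts i) (ss i)) : TrHom (.node k x ts) (.node k y ss)

namespace TrHom
variable {C : ℕ → Type u} [∀ k, Category.{v} (C k)] {L M : Type}

def id : ∀ t : Tr C L, TrHom t t
  | .leaf l => .leaf l
  | .node _ x ts => .node (𝟙 x) fun i => id (ts i)

def comp : ∀ {r s t : Tr C L}, TrHom r s → TrHom s t → TrHom r t
  | _, _, _, .leaf l, .leaf _ => .leaf l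
  | _, _, _, .node f g, .node f' g' => .node (f ≫ f') fun i => (g i).comp (g' i)

theorem id_comp {s t : Tr C L} (f : TrHom s t) : (id s).comp f = f := by
  induction f with
  | leaf l => simp only [id, comp]
  | node f g ih => simp only [id, comp, ih, Category.id_comp]

theorem comp_id {s t : Tr C L} (f : TrHom s t) : f.comp (id t) = f := by
  induction f with
  | leaf l => simp only [id, comp]
  | node f g ih => simp only [id, comp, ih, Category.comp_id]

theorem assoc {q r s t : Tr C L} (f : TrHom q r) (g : TrHom r s) (h : TrHom s t) :
    (f.comp g).comp h = f.comp (g.comp h) := by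
  induction f generalizing s t with
  | leaf l => cases g; cases h; simp only [comp]
  | node f fs ih => cases g; cases h; simp only [comp, ih, Category.assoc]
end TrHom

/-- The category `(T C) n`, for a family of categories `C`. -/
instance OTree.category {C : ℕ → Type u} [∀ k, Category.{v} (C k)] (n : ℕ) :
    Category.{max u v} (OTree C n) where
  Hom s t := TrHom s.tree t.tree
  id t := TrHom.id t.tree
  comp f g := f.comp g
  id_comp f := f.id_comp
  comp_id f := f.comp_id
  assoc f g h := f.assoc g h

namespace TrHom
variable {C : ℕ → Type u} [∀ k, Category.{v} (C k)] {D : ℕ → Type w} [∀ k, Category.{u₁} (D k)]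
  {X : ℕ → Type u₃} {L M : Type}

/-- The morphism of decorated trees that is given at a vertex tagged `x` by `θ k x`. -/
def dec {A B : ∀ k, X k → C k} (θ : ∀ k x, A k x ⟶ B k x) :
    ∀ t : Tr X L, TrHom (t.map A) (t.map B)
  | .leaf l => .leaf l
  | .node k x ts => .node (θ k x) fun i => dec θ (ts i)

theorem dec_id (A : ∀ k, X k → C k) (t : Tr X L) : dec (fun k x => 𝟙 (A k x)) t = id _ := by
  induction t with
  | leaf l => rfl
  | node k x ts ih => simp only [dec, Tr.map, id, ih]

theorem dec_comp {A B E : ∀ k, X k → C k} (θ : ∀ k x, A k x ⟶ B k x)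
    (ζ : ∀ k x, B k x ⟶ E k x) (t : Tr X L) :
    dec (fun k x => θ k x ≫ ζ k x) t = (dec θ t).comp (dec ζ t) := by
  induction t with
  | leaf l => rfl
  | node k x ts ih => exact congrArg (TrHom.node (θ k x ≫ ζ k x)) (funext ih)

def map (F : ∀ k, C k ⥤ D k) : ∀ {s t : Tr C L}, TrHom s t →
    TrHom (s.map fun k => (F k).obj) (t.map fun k => (F k).obj)
  | _, _, .leaf l => .leaf l
  | _, _, .node f g => .node ((F _).map f) fun i => (g i).map F

theorem map_id (F : ∀ k, C k ⥤ D k) (t : Tr C L) : (id t).map F = id _ := by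
  induction t with
  | leaf l => rfl
  | node k x ts ih => simp only [id, map, Tr.map, ih, CategoryTheory.Functor.map_id]

theorem map_comp (F : ∀ k, C k ⥤ D k) {r s t : Tr C L} (f : TrHom r s) (g : TrHom s t) :
    (f.comp g).map F = (f.map F).comp (g.map F) := by
  induction f generalizing t with
  | leaf l => cases g; rfl
  | node f fs ih =>
    cases g
    simp only [comp, map, ih, CategoryTheory.Functor.map_comp]
    rfl

def bind : ∀ {s t : Tr C L}, TrHom s t → ∀ {f g : L → Tr C M}, (∀ l, TrHom (f l) (g l)) →
    TrHom (s.bind f) (t.bind g)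
  | _, _, .leaf l, _, _, h => h l
  | _, _, .node f g, _, _, h => .node f fun i => (g i).bind h

theorem bind_id (t : Tr C L) (f : L → Tr C M) : (id t).bind (fun l => id (f l)) = id _ := by
  induction t with
  | leaf l => rfl
  | node k x ts ih => simp only [id, bind, Tr.bind, ih]

theorem bind_comp {r s t : Tr C L} (p : TrHom r s) (q : TrHom s t) {f g h : L → Tr C M}
    (p' : ∀ l, TrHom (f l) (g l)) (q' : ∀ l, TrHom (g l) (h l)) :
    (p.comp q).bind (fun l => (p' l).comp (q' l)) = (p.bind p').comp (q.bind q') := by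
  induction p generalizing t with
  | leaf l => cases q; rfl
  | node f fs ih =>
    cases q
    simp only [comp, bind, ih]
    rfl

def flatten : ∀ {s t : Tr (OTree C) L}, TrHom s t →
    TrHom (s.subst fun _ x => x) (t.subst fun _ x => x)
  | _, _, .leaf l => .leaf l
  | _, _, .node f g => bind f fun i => (g i).flatten

theorem flatten_id (t : Tr (OTree C) L) : (id t).flatten = id _ := by
  induction t with
  | leaf l => rfl
  | node k x ts ih =>
    simp only [id, flatten, ih]
    exact bind_id _ _

theorem flatten_comp {r s t : Tr (OTree C) L} (f : TrHom r s) (g : TrHom s t) :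
    (f.comp g).flatten = f.flatten.comp g.flatten := by
  induction f generalizing t with
  | leaf l => cases g; rfl
  | node f fs ih =>
    cases g
    simp only [comp, flatten, ih]
    exact bind_comp (C := C) _ _ _ _

end TrHom

namespace OTree
variable {C : ℕ → Type u} [∀ k, Category.{v} (C k)] {D : ℕ → Type w} [∀ k, Category.{u₁} (D k)]

/-- The functor `T F`. -/
def mapFunctor (F : ∀ k, C k ⥤ D k) (n : ℕ) : OTree C n ⥤ OTree D n where
  obj t := t.map fun k => (F k).obj
  map f := TrHom.map F f
  map_id t := TrHom.map_id F t.tree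
  map_comp f g := TrHom.map_comp F f g

/-- The multiplication of the 2-monad `T`. -/
def mu (C : ℕ → Type u) [∀ k, Category.{v} (C k)] (n : ℕ) : OTree (OTree C) n ⥤ OTree C n where
  obj t := t.subst fun _ x => x
  map f := TrHom.flatten f
  map_id t := TrHom.flatten_id t.tree
  map_comp f g := TrHom.flatten_comp f g

/-- The unit of the 2-monad `T`. -/
def eta (C : ℕ → Type u) [∀ k, Category.{v} (C k)] (n : ℕ) : C n ⥤ OTree C n where
  obj x := corolla x
  map f := TrHom.node f fun i => TrHom.leaf i
  map_id _ := rfl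
  map_comp _ _ := rfl

/-- Decorating the corolla with leaves permuted by `π`. -/
def perm (C : ℕ → Type u) [∀ k, Category.{v} (C k)] {n : ℕ} (π : Equiv.Perm (Fin n)) :
    C n ⥤ OTree C n where
  obj x := corollaPerm π x
  map f := TrHom.node f fun i => TrHom.leaf (π i)
  map_id _ := rfl
  map_comp _ _ := rfl

/-- For a fixed tree, with vertices tagged by `X`, all ways of decorating the tags by objects and
morphisms of `C`. -/
def decFunctor {X : ℕ → Type u₃} {n : ℕ} (t : OTree X n) : (∀ k, X k → C k) ⥤ OTree C n where
  obj A := t.map A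
  map θ := TrHom.dec (fun k x => θ k x) t.tree
  map_id A := TrHom.dec_id A t.tree
  map_comp θ ζ := TrHom.dec_comp (fun k x => θ k x) (fun k x => ζ k x) t.tree
end OTree

namespace OTree
variable {X : ℕ → Type u₁} {Y : ℕ → Type u₂} {Z : ℕ → Type u₃} {n : ℕ}

theorem map_subst (r : ∀ k, X k → OTree Y k) (f : ∀ k, Y k → Z k) (t : OTree X n) :
    (t.subst r).map f = t.subst fun k x => (r k x).map f := ext (Tr.map_subst r f t.tree)

theorem subst_subst (r : ∀ k, X k → OTree Y k) (q : ∀ k, Y k → OTree Z k) (t : OTree X n) :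
    (t.subst r).subst q = t.subst fun k x => (r k x).subst q := ext (Tr.subst_subst r q t.tree)

theorem subst_corolla (t : OTree X n) : (t.subst fun _ x => corolla x) = t :=
  ext ((Tr.subst_corolla (fun _ x => x) t.tree).trans (Tr.map_id t.tree))

theorem corolla_subst (x : X n) (r : ∀ k, X k → OTree Y k) : (corolla x).subst r = r n x :=
  ext (Tr.bind_leaf _)

variable {C : ℕ → Type u} [∀ k, Category.{v} (C k)]

abbrev decHom {A B : ∀ k, X k → C k} (θ : ∀ k x, A k x ⟶ B k x) (t : OTree X n) :
    t.map A ⟶ t.map B := TrHom.dec θ t.tree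

variable {D : ℕ → Type w} [∀ k, Category.{u₁} (D k)]

theorem mapFunctor_obj_map (F : ∀ k, C k ⥤ D k) (A : ∀ k, X k → C k) (t : OTree X n) :
    (mapFunctor F n).obj (t.map A) = t.map fun k x => (F k).obj (A k x) := map_map _ _ t

theorem mu_obj_map (F : ∀ k, C k ⥤ D k) (Q : OTree (OTree C) n) :
    (mu D n).obj (Q.map fun k => (mapFunctor F k).obj) = (mapFunctor F n).obj ((mu C n).obj Q) :=
  (subst_map _ _ Q).trans (map_subst _ _ Q).symm

theorem mu_obj_mu (Q : OTree (OTree (OTree C)) n) :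
    (mu C n).obj (Q.map fun k => (mu C k).obj) = (mu C n).obj ((mu (OTree C) n).obj Q) :=
  (subst_map _ _ Q).trans (subst_subst _ _ Q).symm

theorem mu_obj_map_eta (t : OTree C n) : (mu C n).obj (t.map fun k => (eta C k).obj) = t :=
  (subst_map _ _ t).trans t.subst_corolla

theorem mu_obj_eta (t : OTree C n) : (mu C n).obj ((eta (OTree C) n).obj t) = t :=
  corolla_subst t _

end OTree

/-- The data of a pseudo-`T`-algebra with underlying family of categories `C`. -/
structure UnitalCatOperadData (C : ℕ → Type u) [∀ n, Category.{v} (C n)] where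
  act (n : ℕ) : OTree C n ⥤ C n
  assoc (n : ℕ) : OTree.mapFunctor act n ⋙ act n ≅ OTree.mu C n ⋙ act n
  unit (n : ℕ) : OTree.eta C n ⋙ act n ≅ 𝟭 (C n)

namespace UnitalCatOperadData
variable {C : ℕ → Type u} [∀ n, Category.{v} (C n)] (O : UnitalCatOperadData C) {n : ℕ}

abbrev assocHom (Q : OTree (OTree C) n) :
    (O.act n).obj ((OTree.mapFunctor O.act n).obj Q) ⟶ (O.act n).obj ((OTree.mu C n).obj Q) :=
  (O.assoc n).hom.app Q

abbrev unitHom (x : C n) : (O.act n).obj ((OTree.eta C n).obj x) ⟶ x := (O.unit n).hom.app x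

/-- The morphism `T(assoc)` at `Q`, from `T act (T T act Q)` to `T act (T μ Q)`. -/
def mapAssoc (Q : OTree (OTree (OTree C)) n) :
    (OTree.mapFunctor O.act n).obj
        ((OTree.mapFunctor (OTree.mapFunctor O.act) n).obj Q) ⟶
      (OTree.mapFunctor O.act n).obj ((OTree.mapFunctor (OTree.mu C) n).obj Q) :=
  eqToHom (OTree.map_map _ _ Q) ≫ OTree.decHom (fun _ t => O.assocHom t) Q ≫
    eqToHom (OTree.map_map _ _ Q).symm

/-- The morphism `T(unit)` at `t`, from `T act (T η t)` to `t`. -/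
def mapUnit (t : OTree C n) :
    (OTree.mapFunctor O.act n).obj ((OTree.mapFunctor (OTree.eta C) n).obj t) ⟶ t :=
  eqToHom (OTree.map_map _ _ t) ≫ OTree.decHom (fun _ x => O.unitHom x) t ≫ eqToHom t.map_id

end UnitalCatOperadData

/-- A unital categorical operad: a pseudo-algebra of the 2-monad `T`, i.e. functors
`act n : (T C) n ⥤ C n` with invertible 2-cells `act ∘ T act ≅ act ∘ μ` and `act ∘ η ≅ 1` that satisfy the
associativity and the two unit coherence conditions. -/
structure UnitalCatOperad (C : ℕ → Type u) [∀ n, Category.{v} (C n)] extends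
    UnitalCatOperadData C where
  assoc_coherence (n : ℕ) (Q : OTree (OTree (OTree C)) n) :
    toUnitalCatOperadData.assocHom ((OTree.mapFunctor (OTree.mapFunctor act) n).obj Q) ≫
      (act n).map (eqToHom (OTree.mu_obj_map act Q)) ≫
      toUnitalCatOperadData.assocHom ((OTree.mu (OTree C) n).obj Q) =
    (act n).map (toUnitalCatOperadData.mapAssoc Q) ≫
      toUnitalCatOperadData.assocHom ((OTree.mapFunctor (OTree.mu C) n).obj Q) ≫
      (act n).map (eqToHom (OTree.mu_obj_mu Q))
  unit_coherence_left (n : ℕ) (t : OTree C n) :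
    toUnitalCatOperadData.assocHom ((OTree.mapFunctor (OTree.eta C) n).obj t) ≫
      (act n).map (eqToHom (OTree.mu_obj_map_eta t)) =
    (act n).map (toUnitalCatOperadData.mapUnit t)
  unit_coherence_right (n : ℕ) (t : OTree C n) :
    toUnitalCatOperadData.assocHom ((OTree.eta (OTree C) n).obj t) ≫
      (act n).map (eqToHom (OTree.mu_obj_eta t)) =
    toUnitalCatOperadData.unitHom ((act n).obj t)

/-- The terminal family; `OTree Pt n` is the set of ordered rooted trees with `n` leaves. -/
abbrev Pt : ℕ → Type := fun _ => PUnit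

namespace OTree
/-- The underlying ordered tree of a decorated ordered tree. -/
def shape {X : ℕ → Type u} {n : ℕ} (t : OTree X n) : OTree Pt n := t.map fun _ _ => ⟨⟩
end OTree

/-- A class of ordered rooted trees that contains the corollas and is closed under substitution
of trees into vertices, i.e. a submonad of `T` given by a class of trees. -/
structure TreeClass where
  mem (n : ℕ) : OTree Pt n → Prop
  corolla_mem (n : ℕ) : mem n (OTree.corolla ⟨⟩)
  subst_mem {n : ℕ} {Y : ℕ → Type} (Q : OTree Y n) (r : ∀ k, Y k → OTree Pt k) :
    mem n Q.shape → (∀ k y, mem k (r k y)) → mem n (Q.subst r)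

namespace TreeClass

/-- The trees of the class `K` with `n` leaves. -/
def Trees (K : TreeClass) (n : ℕ) : Type := {t : OTree Pt n // K.mem n t}

/-- All ordered rooted trees (the monad `T` for unital symmetric operads). -/
def all : TreeClass where
  mem _ _ := True
  corolla_mem _ := trivial
  subst_mem _ _ _ _ := trivial

/-- The tree is not the free living edge. -/
def IsNode {X : ℕ → Type u} {L : Type} : Tr X L → Prop
  | .leaf _ => False
  | .node _ _ _ => True

theorem isNode_subst {Y : ℕ → Type u₁} {X : ℕ → Type u₂} {L : Type} (Q : Tr Y L)
    (r : ∀ k, Y k → OTree X k)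
    (hQ : IsNode (Q.map (Y := Pt) fun _ _ => ⟨⟩)) (hr : ∀ k y, IsNode (r k y).tree) :
    IsNode (Q.subst r) := by
  cases Q with
  | leaf l => exact hQ
  | node k x ts =>
    have := hr k x
    simp only [Tr.subst]
    revert this
    cases (r k x).tree with
    | leaf l => exact fun h => h.elim
    | node _ _ _ => exact fun _ => trivial

/-- All ordered rooted trees but `|` (the monad for non-unital symmetric operads). -/
def nonUnital : TreeClass where
  mem _ t := IsNode t.tree
  corolla_mem _ := trivial
  subst_mem Q r hQ hr := isNode_subst Q.tree r hQ hr

/-- The planar rooted trees but `|`: the order of the leaves is the planar one (the monad for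
non-unital non-symmetric operads). -/
def planar : TreeClass where
  mem n t := IsNode t.tree ∧ t.tree.leaves = List.finRange n
  corolla_mem n := ⟨trivial, by
    simp only [OTree.corolla, Tr.leaves, List.flatMap_singleton']⟩
  subst_mem Q r hQ hr := ⟨isNode_subst Q.tree r hQ.1 fun k y => (hr k y).1,
    (Tr.leaves_subst_eq r (fun k y => (hr k y).2) Q.tree).trans
      ((Tr.leaves_map _ Q.tree).symm.trans hQ.2)⟩

instance : LE TreeClass := ⟨fun K K' => ∀ n t, K.mem n t → K'.mem n t⟩

theorem planar_le : planar ≤ nonUnital := fun _ _ h => h.1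
theorem nonUnital_le : nonUnital ≤ all := fun _ _ _ => trivial

end TreeClass

/-- Internal collections `{A n ∈ C n}`, with the product category structure. -/
abbrev IColl (C : ℕ → Type u) : Type u := ∀ n, C n

theorem OTree.map_shape {X : ℕ → Type u₁} {C : ℕ → Type u} {n : ℕ} (t : OTree X n) (A : IColl C) :
    (t.shape.map fun k _ => A k) = t.map fun k _ => A k := OTree.map_map _ _ t

variable {C : ℕ → Type u} [∀ n, Category.{v} (C n)]

namespace UnitalCatOperad

/-- For a tree `Q` with vertices tagged by `Y` and trees `r k y`, decorated by `A`, to be put into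
these vertices: the structure isomorphism from the composite along `Q` of the composites along the `r k y`
to the composite along the tree that results from the substitution. -/
def compIso (O : UnitalCatOperad C) {Y : ℕ → Type u₁} {Z : ℕ → Type u₂} {n : ℕ} (Q : OTree Y n)
    (r : ∀ k, Y k → OTree Z k) (A : ∀ k, Z k → C k) :
    (O.act n).obj (Q.map fun k y => (O.act k).obj ((r k y).map A)) ≅
      (O.act n).obj ((Q.subst r).map A) :=
  (O.act n).mapIso (eqToIso (OTree.map_map _ _ Q).symm) ≪≫
    (O.assoc n).app (Q.map fun k y => (r k y).map A) ≪≫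
    (O.act n).mapIso (eqToIso ((OTree.subst_map _ _ Q).trans (OTree.map_subst r A Q).symm))

end UnitalCatOperad

namespace OTree
/-- The tree `t` with every vertex of arity `k` decorated by `A k`. -/
abbrev const {n : ℕ} (t : OTree Pt n) (A : IColl C) : OTree C n := t.map fun k _ => A k

/-- The morphism of decorated trees induced by a morphism of collections. -/
abbrev constHom {n : ℕ} (t : OTree Pt n) {A B : IColl C} (f : A ⟶ B) : t.const A ⟶ t.const B :=
  decHom (fun k _ => f k) t

end OTree

/-- Internal operads in `O`, for the class `K` of trees: lax morphisms from the terminal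
pseudo-algebra of the monad given by `K` to `O`, regarded as a pseudo-algebra of this monad.  Such a
morphism consists of objects `obj n` of `C n` (the underlying map from the terminal family) and of a
2-cell, which has a component `act (t.const obj) ⟶ obj n` for every tree `t` in `K` with `n` leaves;
`str_corolla` and `str_subst` are its unit and associativity axiom.  (In `str_subst`, the tree of trees is
given by a tree `Q` with tagged vertices and a tree `r k y` of `K` for each tag.) -/
structure IOp (K : TreeClass) (O : UnitalCatOperad C) where
  obj : IColl C
  str {n : ℕ} (t : K.Trees n) : (O.act n).obj (t.1.const obj) ⟶ obj n
  str_corolla (n : ℕ) : str ⟨OTree.corolla ⟨⟩, K.corolla_mem n⟩ = O.unitHom (obj n)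
  str_subst {n : ℕ} {Y : ℕ → Type} (Q : OTree Y n) (r : ∀ k, Y k → K.Trees k)
    (hQ : K.mem n Q.shape) :
    (O.act n).map (OTree.decHom (fun k y => str (r k y)) Q ≫
        eqToHom (OTree.map_shape Q obj).symm) ≫ str ⟨Q.shape, hQ⟩ =
      (O.compIso Q (fun k y => (r k y).1) fun k _ => obj k).hom ≫
        str ⟨Q.subst fun k y => (r k y).1, K.subst_mem Q _ hQ fun k y => (r k y).2⟩

namespace IOp
variable {K K' : TreeClass} {O : UnitalCatOperad C}

/-- Transformations of lax morphisms (`T`-natural transformations). -/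
@[ext] structure Hom (A B : IOp K O) where
  hom : A.obj ⟶ B.obj
  comm {n : ℕ} (t : K.Trees n) :
    A.str t ≫ hom n = (O.act n).map (t.1.constHom hom) ≫ B.str t

instance : Category (IOp K O) where
  Hom := Hom
  id A := ⟨𝟙 A.obj, fun {n} t => by
    have h : t.1.constHom (𝟙 A.obj) = 𝟙 _ := TrHom.dec_id _ _
    rw [h, CategoryTheory.Functor.map_id, Category.id_comp]
    exact Category.comp_id _⟩
  comp {A B D} f g := ⟨f.hom ≫ g.hom, fun {n} t => by
    have h : t.1.constHom (f.hom ≫ g.hom) = t.1.constHom f.hom ≫ t.1.constHom g.hom :=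
      TrHom.dec_comp _ _ _
    rw [h, CategoryTheory.Functor.map_comp, Category.assoc, ← g.comm, ← Category.assoc, ← f.comm,
      Category.assoc]
    rfl⟩
  id_comp f := Hom.ext (Category.id_comp f.hom)
  comp_id f := Hom.ext (Category.comp_id f.hom)
  assoc f g h := Hom.ext (Category.assoc f.hom g.hom h.hom)

/-- The underlying internal collection. -/
def forgetToIColl (K : TreeClass) (O : UnitalCatOperad C) : IOp K O ⥤ IColl C where
  obj A := A.obj
  map f := f.hom

/-- Restrict the structure to a smaller class of trees. -/
def restrict (h : K ≤ K') (O : UnitalCatOperad C) : IOp K' O ⥤ IOp K O where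
  obj A :=
    { obj := A.obj
      str := fun t => A.str ⟨t.1, h _ _ t.2⟩
      str_corolla := A.str_corolla
      str_subst := fun Q r hQ => A.str_subst Q (fun k y => ⟨(r k y).1, h _ _ (r k y).2⟩) (h _ _ hQ) }
  map f := ⟨f.hom, fun t => f.comm ⟨t.1, h _ _ t.2⟩⟩

end IOp

/-- Internal non-unital non-symmetric operads in `O`. -/
abbrev IOpNs (O : UnitalCatOperad C) := IOp TreeClass.planar O
/-- Internal non-unital (symmetric) operads in `O`. -/
abbrev IOpNu (O : UnitalCatOperad C) := IOp TreeClass.nonUnital O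
/-- Internal unital (symmetric) operads in `O`. -/
abbrev IOpU (O : UnitalCatOperad C) := IOp TreeClass.all O

/-- Forget the compositions of a non-symmetric operad. -/
def U₁ (O : UnitalCatOperad C) : IOpNs O ⥤ IColl C := IOp.forgetToIColl _ O
/-- Forget the internal symmetric group actions. -/
def U₂ (O : UnitalCatOperad C) : IOpNu O ⥤ IOpNs O := IOp.restrict TreeClass.planar_le O
/-- Forget the internal unit. -/
def U₃ (O : UnitalCatOperad C) : IOpU O ⥤ IOpNu O := IOp.restrict TreeClass.nonUnital_le O
/-- The forgetful functor from unital internal operads to internal collections. -/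
def U (O : UnitalCatOperad C) : IOpU O ⥤ IColl C := U₃ O ⋙ U₂ O ⋙ U₁ O

/-- The fibre of `f` over `j`. -/
def fibre {n m : ℕ} (f : Fin n →o Fin m) (j : Fin m) : Finset (Fin n) :=
  Finset.univ.filter fun x => f x = j

/-- Elementary morphisms `(φ, i)` of the category `Δ` of finite ordinals and order preserving
maps: all fibres off the marked point `i` have exactly one element.  (The marked fibre may have any
cardinality, including one.)  For given `m`, `i` and cardinality `k` of the marked fibre there is, up to the
identification of `n` with `m + k - 1`, exactly one such morphism. -/
structure Elem (n m : ℕ) where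
  map : Fin n →o Fin m
  idx : Fin m
  card_fibre : ∀ j, j ≠ idx → (fibre map j).card = 1

/-- Tags for the two vertices, of arity `m` and `k`, of a tree. -/
inductive Two (m k : ℕ) : ℕ → Type
  | bottom : Two m k m
  | top : Two m k k

namespace Two
/-- Decorate the two vertices by `x` and `y`. -/
def dec {m k : ℕ} {X : ℕ → Type u} (x : X m) (y : X k) : ∀ l, Two m k l → X l
  | _, bottom => x
  | _, top => y
end Two

namespace Tr
/-- The corolla whose leaves are labelled, in increasing order, by the elements of `s`. -/
def corollaOn {X : ℕ → Type u} {n : ℕ} (s : Finset (Fin n)) (x : X s.card) : Tr X (Fin n) :=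
  .node s.card x fun l => .leaf (s.orderEmbOfFin rfl l)

theorem leaves_corollaOn {X : ℕ → Type u} {n : ℕ} (s : Finset (Fin n)) (x : X s.card) :
    (corollaOn s x).leaves = s.sort (· ≤ ·) := by
  simp only [corollaOn, leaves, ← List.map_eq_flatMap]
  exact s.listMap_orderEmbOfFin_finRange rfl

theorem node_eq_corollaOn {n c : ℕ} (s : Finset (Fin n)) (g : Fin c → Fin n)
    (hg : StrictMono g) (hs : ∀ x, x ∈ s ↔ ∃ l, g l = x) :
    (.node c ⟨⟩ fun l => .leaf (g l) : Tr Pt (Fin n)) = corollaOn s ⟨⟩ := by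
  have h : s = Finset.univ.image g := by ext x; simp [hs]
  have hc : s.card = c := by rw [h, Finset.card_image_of_injective _ hg.injective]; simp
  subst hc
  rw [s.orderEmbOfFin_unique rfl (fun l => (hs _).2 ⟨l, rfl⟩) hg]
  rfl
end Tr

namespace Elem
variable {n m : ℕ} (φ : Elem n m)

/-- The cardinality of the marked fibre. -/
abbrev arity : ℕ := (fibre φ.map φ.idx).card

/-- The unique point over an unmarked point `j`. -/
def point (j : Fin m) (h : j ≠ φ.idx) : Fin n :=
  (fibre φ.map j).orderEmbOfFin (φ.card_fibre j h) 0

/-- What is grafted on the `j`-th input of the bottom vertex: at the marked point, the corolla on the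
marked fibre, decorated by `x`, elsewhere a leaf. -/
def branch {X : ℕ → Type u} (x : X φ.arity) (j : Fin m) : Tr X (Fin n) :=
  if h : j = φ.idx then Tr.corollaOn (fibre φ.map φ.idx) x else .leaf (φ.point j h)

theorem mem_fibre {f : Fin n →o Fin m} {j : Fin m} {x : Fin n} : x ∈ fibre f j ↔ f x = j := by
  simp [fibre]

theorem map_point (j : Fin m) (h : j ≠ φ.idx) : φ.map (φ.point j h) = j :=
  mem_fibre.1 (Finset.orderEmbOfFin_mem _ _ _)

theorem eq_point {x : Fin n} {j : Fin m} (hx : φ.map x = j) (h : j ≠ φ.idx) : x = φ.point j h := by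
  obtain ⟨y, hy⟩ := Finset.card_eq_one.1 (φ.card_fibre j h)
  have h1 : x ∈ fibre φ.map j := mem_fibre.2 hx
  have h2 : φ.point j h ∈ fibre φ.map j := mem_fibre.2 (φ.map_point j h)
  rw [hy, Finset.mem_singleton] at h1 h2
  rw [h1, h2]

theorem branch_idx {X : ℕ → Type u} (x : X φ.arity) :
    φ.branch x φ.idx = Tr.corollaOn (fibre φ.map φ.idx) x := dif_pos rfl

theorem branch_ne {X : ℕ → Type u} (x : X φ.arity) {j : Fin m} (h : j ≠ φ.idx) :
    φ.branch x j = .leaf (φ.point j h) := dif_neg h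

theorem leaves_branch {X : ℕ → Type u} (x : X φ.arity) (j : Fin m) :
    (φ.branch x j).leaves = (fibre φ.map j).sort (· ≤ ·) := by
  by_cases h : j = φ.idx
  · subst h
    rw [branch_idx, Tr.leaves_corollaOn]
  · rw [branch_ne _ _ h, ← Finset.listMap_orderEmbOfFin_finRange _ (φ.card_fibre j h)]
    rfl

theorem flatMap_fibre {n m : ℕ} (f : Fin n →o Fin m) :
    (List.finRange m).flatMap (fun j => (fibre f j).sort (· ≤ ·)) = List.finRange n := by
  refine List.SortedLT.eq_of_mem_iff ?_ (List.sortedLT_finRange n) ?_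
  · refine List.Pairwise.sortedLT (List.pairwise_flatMap.2 ⟨fun j _ =>
      (Finset.sortedLT_sort _).pairwise, ?_⟩)
    refine (List.sortedLT_finRange m).pairwise.imp ?_
    intro j j' hj x hx y hy
    rw [Finset.mem_sort, mem_fibre] at hx hy
    by_contra hxy
    have := f.monotone (not_lt.1 hxy)
    rw [hx, hy] at this
    exact absurd hj (not_lt.2 this)
  · intro x
    simp [mem_fibre]

/-- The planar tree with `n` leaves and two vertices, in which the vertex of arity `φ.arity` is
grafted onto the input `i = φ.idx` of the vertex of arity `m`. -/
def twoTree : OTree (Two m φ.arity) n :=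
  ⟨.node m .bottom (φ.branch .top), by
    simp only [Tr.leaves, leaves_branch, flatMap_fibre]
    exact List.Perm.refl _⟩

theorem planar_twoTree : TreeClass.planar.mem n φ.twoTree.shape :=
  ⟨trivial, by
    simp only [OTree.shape, OTree.map, Tr.leaves_map, twoTree, Tr.leaves, leaves_branch,
      flatMap_fibre]⟩

theorem branch_subst {X : ℕ → Type u₁} {Y : ℕ → Type u₂} (x : X φ.arity)
    (r : ∀ k, X k → OTree Y k) (y : Y φ.arity) (hr : r _ x = OTree.corolla y) (j : Fin m) :
    (φ.branch x j).subst r = φ.branch y j := by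
  by_cases h : j = φ.idx
  · subst h
    rw [branch_idx, branch_idx]
    simp only [Tr.corollaOn, Tr.subst, hr]
    rfl
  · rw [branch_ne _ _ h, branch_ne _ _ h]
    rfl

theorem branch_bind_aux {n m m' k : ℕ} (ψ : Elem n m) (φ : Elem m k) (ψ' : Elem n m')
    (φ' : Elem m' k) (comm : ∀ x, φ.map (ψ.map x) = φ'.map (ψ'.map x))
    (h₁ : φ.map ψ.idx = φ'.idx) (h₂ : φ'.map ψ'.idx = φ.idx) (hne : φ.idx ≠ φ'.idx) :
    (φ.branch (X := Pt) ⟨⟩ φ.idx).bind (ψ.branch (X := Pt) ⟨⟩) =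
      (φ'.branch (X := Pt) ⟨⟩ φ.idx).bind (ψ'.branch (X := Pt) ⟨⟩) := by
  have hp : φ'.point φ.idx hne = ψ'.idx := (φ'.eq_point h₂ hne).symm
  rw [branch_idx, branch_ne _ _ hne, hp]
  simp only [Tr.corollaOn, Tr.bind]
  have hl : ∀ l, (fibre φ.map φ.idx).orderEmbOfFin rfl l ≠ ψ.idx := by
    intro l hl
    have := mem_fibre.1 ((fibre φ.map φ.idx).orderEmbOfFin_mem rfl l)
    rw [hl, h₁] at this
    exact hne this.symm
  rw [branch_idx]
  simp only [fun l => ψ.branch_ne (X := Pt) ⟨⟩ (hl l)]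
  refine Tr.node_eq_corollaOn _ _ ?_ ?_
  · intro a b hab
    by_contra hc
    have := ψ.map.monotone (not_lt.1 hc)
    rw [map_point, map_point] at this
    exact absurd ((OrderEmbedding.lt_iff_lt _).2 hab) (not_lt.2 this)
  · intro x
    rw [mem_fibre]
    constructor
    · intro hx
      have h3 : ψ.map x ∈ fibre φ.map φ.idx := by rw [mem_fibre, comm, hx, h₂]
      rw [← Finset.mem_coe, ← Finset.range_orderEmbOfFin _ rfl] at h3
      obtain ⟨l, hl'⟩ := h3
      exact ⟨l, (ψ.eq_point hl'.symm (hl l)).symm⟩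
    · rintro ⟨l, rfl⟩
      have h3 := comm (ψ.point _ (hl l))
      rw [map_point, mem_fibre.1 ((fibre φ.map φ.idx).orderEmbOfFin_mem rfl l)] at h3
      rw [φ'.eq_point h3.symm hne, hp]

theorem branch_bind {n m m' k : ℕ} (ψ : Elem n m) (φ : Elem m k) (ψ' : Elem n m')
    (φ' : Elem m' k) (comm : ∀ x, φ.map (ψ.map x) = φ'.map (ψ'.map x))
    (h₁ : φ.map ψ.idx = φ'.idx) (h₂ : φ'.map ψ'.idx = φ.idx) (hne : φ.idx ≠ φ'.idx) (j : Fin k) :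
    (φ.branch (X := Pt) ⟨⟩ j).bind (ψ.branch (X := Pt) ⟨⟩) =
      (φ'.branch (X := Pt) ⟨⟩ j).bind (ψ'.branch (X := Pt) ⟨⟩) := by
  by_cases hj : j = φ.idx
  · subst hj
    exact branch_bind_aux ψ φ ψ' φ' comm h₁ h₂ hne
  by_cases hj' : j = φ'.idx
  · subst hj'
    exact (branch_bind_aux ψ' φ' ψ φ (fun x => (comm x).symm) h₂ h₁ hne.symm).symm
  have a : φ.point j hj ≠ ψ.idx := fun h => hj' (by rw [← h₁, ← h, map_point])
  have a' : φ'.point j hj' ≠ ψ'.idx := fun h => hj (by rw [← h₂, ← h, map_point])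
  rw [branch_ne _ _ hj, branch_ne _ _ hj']
  simp only [Tr.bind]
  rw [branch_ne _ _ a, branch_ne _ _ a']
  congr 1
  refine (ψ.eq_point (φ.eq_point ?_ hj) a).symm
  rw [comm, map_point, map_point]

end Elem

namespace Two
def decHom {m k : ℕ} {x x' : C m} {y y' : C k} (f : x ⟶ x') (g : y ⟶ y') :
    ∀ l (z : Two m k l), dec x y l z ⟶ dec x' y' l z
  | _, bottom => f
  | _, top => g

def decFunctor (C : ℕ → Type u) [∀ n, Category.{v} (C n)] (m k : ℕ) :
    C m × C k ⥤ ∀ l, Two m k l → C l where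
  obj p := dec p.1 p.2
  map f := decHom f.1 f.2
  map_id p := by
    funext l z
    cases z <;> rfl
  map_comp f g := by
    funext l z
    cases z <;> rfl
end Two

namespace UnitalCatOperad
variable (O : UnitalCatOperad C)

/-- The partial composition `⊙_i : C m × C k ⥤ C (m + k - 1)`, as a bifunctor, with `i = φ.idx`,
`k = φ.arity` and `n = m + k - 1`; it is the structure functor of the tree with two vertices. -/
def odot {n m : ℕ} (φ : Elem n m) : C m ⥤ C φ.arity ⥤ C n :=
  Functor.curry.obj (Two.decFunctor C m φ.arity ⋙ φ.twoTree.decFunctor ⋙ O.act n)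

/-- The functor `π(-) : C n ⥤ C n`, the structure functor of the permuted corolla. -/
def sym {n : ℕ} (π : Equiv.Perm (Fin n)) : C n ⥤ C n := OTree.perm C π ⋙ O.act n

/-- The unit of `O`, the value of the structure functor at the tree `|`. -/
def idObj : C 1 := (O.act 1).obj ⟨.leaf 0, List.Perm.refl _⟩

end UnitalCatOperad

/-- Leveled planar rooted trees with `n` leaves: sequences of elementary morphisms
`n = n₁ → n₂ → ⋯ → 1`, of length at least one, where the last one is `single`, the unique map to `1`. -/
inductive LTree : ℕ → Type
  | single (n : ℕ) : LTree n
  | cons {n m : ℕ} (φ : Elem n m) (T : LTree m) : LTree n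

namespace LTree

/-- Two sequences differ by one commutative square of elementary morphisms with disjoint fibres, in
which the marked fibres correspond to each other. -/
inductive Interchange : ∀ {n : ℕ}, LTree n → LTree n → Prop
  | square {n m m' k : ℕ} (ψ : Elem n m) (φ : Elem m k) (ψ' : Elem n m') (φ' : Elem m' k)
      (T : LTree k) (comm : ∀ x, φ.map (ψ.map x) = φ'.map (ψ'.map x))
      (h₁ : φ.map ψ.idx = φ'.idx) (h₂ : φ'.map ψ'.idx = φ.idx) (hne : φ.idx ≠ φ'.idx) :
      Interchange (cons ψ (cons φ T)) (cons ψ' (cons φ' T))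
  | cons {n m : ℕ} (φ : Elem n m) {T T' : LTree m} (h : Interchange T T') :
      Interchange (cons φ T) (cons φ T')

/-- The planar tree that underlies a leveled tree. -/
def tree : ∀ {n : ℕ}, LTree n → OTree Pt n
  | _, single n => OTree.corolla ⟨⟩
  | _, cons φ T => φ.twoTree.subst (Two.dec (X := OTree Pt) T.tree (OTree.corolla ⟨⟩))

theorem tree_cons {n m : ℕ} (φ : Elem n m) (T : LTree m) :
    (cons φ T).tree.tree = T.tree.tree.bind (φ.branch ⟨⟩) := by
  simp only [tree, OTree.subst, Elem.twoTree, Tr.subst, Two.dec]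
  congr 1
  funext j
  exact φ.branch_subst Two.top
    (Two.dec (X := OTree Pt) T.tree (OTree.corolla ⟨⟩)) _ rfl j

theorem tree_planar : ∀ {n : ℕ} (T : LTree n), TreeClass.planar.mem n T.tree
  | _, single n => TreeClass.planar.corolla_mem n
  | _, cons φ T => TreeClass.planar.subst_mem _ _ φ.planar_twoTree fun k y => by
      cases y with
      | bottom => exact T.tree_planar
      | top => exact TreeClass.planar.corolla_mem _

theorem Interchange.tree_eq {n : ℕ} {T T' : LTree n} (h : Interchange T T') : T.tree = T'.tree := by
  induction h with
  | square ψ φ ψ' φ' T comm h₁ h₂ hne =>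
    apply OTree.ext
    simp only [tree_cons, Tr.bind_bind]
    congr 1
    funext j
    exact Elem.branch_bind ψ φ ψ' φ' comm h₁ h₂ hne j
  | cons φ h ih =>
    apply OTree.ext
    simp only [tree_cons, ih]

/-- The groupoid of leveled trees with `n` leaves: two leveled trees are (uniquely) isomorphic iff
they are connected by interchanges of levels. -/
instance groupoid (n : ℕ) : Groupoid (LTree n) where
  Hom T T' := PLift (Relation.EqvGen Interchange T T')
  id T := ⟨.refl T⟩
  comp f g := ⟨.trans _ _ _ f.down g.down⟩
  inv f := ⟨.symm _ _ f.down⟩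

theorem tree_eq {n : ℕ} {T T' : LTree n} (f : T ⟶ T') : T.tree = T'.tree := by
  obtain ⟨h⟩ := f
  induction h with
  | rel _ _ h => exact h.tree_eq
  | refl _ => rfl
  | symm _ _ _ ih => exact ih.symm
  | trans _ _ _ _ _ ih ih' => exact ih.trans ih'

end LTree

/-- Isomorphic decorations of a tree. -/
def decIso {X : ℕ → Type u₁} {n : ℕ} {A B : ∀ k, X k → C k} (θ : ∀ k x, A k x ≅ B k x)
    (t : OTree X n) : t.map A ≅ t.map B where
  hom := OTree.decHom (fun k x => (θ k x).hom) t
  inv := OTree.decHom (fun k x => (θ k x).inv) t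
  hom_inv_id := by
    refine (TrHom.dec_comp _ _ t.tree).symm.trans ?_
    simp only [Iso.hom_inv_id]
    exact TrHom.dec_id A t.tree
  inv_hom_id := by
    refine (TrHom.dec_comp _ _ t.tree).symm.trans ?_
    simp only [Iso.inv_hom_id]
    exact TrHom.dec_id B t.tree

namespace UnitalCatOperad
variable (O : UnitalCatOperad C)

/-- The iterated composite `(⋯ (X_{t_k} ⊙ X_{t_{k-1}}) ⊙ ⋯ ) ⊙ X_{t_1}`, where `t_1, …, t_k` are the
fibres of the leveled tree. -/
def xhatObj (X : IColl C) : ∀ {n : ℕ}, LTree n → C n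
  | _, .single n => X n
  | _, .cons φ T => ((O.odot φ).obj (xhatObj X T)).obj (X φ.arity)

def xhatIsoAux (X : IColl C) {m : ℕ} (T : LTree m) (a : ℕ)
    (e : O.xhatObj X T ≅ (O.act m).obj (T.tree.const X)) :
    ∀ l (z : Two m a l), Two.dec (O.xhatObj X T) (X a) l z ≅
      (O.act l).obj ((Two.dec (X := OTree Pt) T.tree (OTree.corolla ⟨⟩) l z).const X)
  | _, .bottom => e
  | _, .top => ((O.unit a).app (X a)).symm

/-- The structure isomorphism of `O` from the iterated partial composite to the composite along the
underlying planar tree. -/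
def xhatIso (X : IColl C) : ∀ {n : ℕ} (T : LTree n),
    O.xhatObj X T ≅ (O.act n).obj (T.tree.const X)
  | _, .single n => ((O.unit n).app (X n)).symm
  | n, .cons φ T =>
    (O.act n).mapIso (decIso (O.xhatIsoAux X T φ.arity (xhatIso X T)) φ.twoTree) ≪≫
      O.compIso φ.twoTree (Two.dec (X := OTree Pt) T.tree (OTree.corolla ⟨⟩)) fun k _ => X k

/-- The functor from the groupoid of leveled trees, in which the interchanges of levels act by the
structure isomorphisms of `O` (the parallel associativity isomorphisms). -/
def xhat (X : IColl C) (n : ℕ) : LTree n ⥤ C n where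
  obj T := O.xhatObj X T
  map {T T'} f := (O.xhatIso X T).hom ≫
    (O.act n).map (eqToHom (congrArg (fun t => OTree.const t X) (LTree.tree_eq f))) ≫
    (O.xhatIso X T').inv
  map_id T := by simp
  map_comp f g := by
    simp only [Category.assoc, Iso.inv_hom_id_assoc, ← Functor.map_comp_assoc, eqToHom_trans]

variable {O}

theorem str_eqToHom {X : IColl C} {A : IOpNs O} (y : X ⟶ A.obj) {n : ℕ} {t t' : OTree Pt n}
    (h : t = t') (ht : TreeClass.planar.mem n t) (ht' : TreeClass.planar.mem n t') :
    (O.act n).map (eqToHom (congrArg (fun t => OTree.const t X) h)) ≫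
        (O.act n).map (t'.constHom y) ≫ A.str ⟨t', ht'⟩ =
      (O.act n).map (t.constHom y) ≫ A.str ⟨t, ht⟩ := by
  subst h
  rw [eqToHom_refl, CategoryTheory.Functor.map_id, Category.id_comp]

/-- For a morphism of collections `y` from `X` to a non-symmetric operad `A`, the cocone of the
composites of `y`, applied at all vertices of a leveled tree, with the composition of `A` along the tree. -/
def treeCocone {X : IColl C} {A : IOpNs O} (y : X ⟶ A.obj) (n : ℕ) : Cocone (O.xhat X n) where
  pt := A.obj n
  ι :=
    { app T := (O.xhatIso X T).hom ≫ (O.act n).map (T.tree.constHom y) ≫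
        A.str ⟨T.tree, T.tree_planar⟩
      naturality {T T'} f := by
        simp only [xhat, Category.assoc, Iso.inv_hom_id_assoc]
        rw [str_eqToHom y (LTree.tree_eq f) T.tree_planar T'.tree_planar]
        exact congrArg _ (congrArg _ (Category.comp_id _).symm) }

/-- The internal action `π (B n) ⟶ B n` of a permutation. -/
def symMap (B : IOpNu O) {n : ℕ} (π : Equiv.Perm (Fin n)) : (O.sym π).obj (B.obj n) ⟶ B.obj n :=
  B.str ⟨OTree.corollaPerm π ⟨⟩, trivial⟩

/-- For a morphism `y` from a non-symmetric operad `A` to a symmetric one `B`, the cofan of the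
composites `π (A n) ⟶ π (B n) ⟶ B n`. -/
def symCofan {A : IOpNs O} {B : IOpNu O} (y : A ⟶ (U₂ O).obj B) (n : ℕ) :
    Cofan fun π : Equiv.Perm (Fin n) => (O.sym π).obj (A.obj n) :=
  Cofan.mk (B.obj n) fun π => (O.sym π).map (y.hom n) ≫ symMap B π

/-- The internal unit. -/
def unitMap (B : IOpU O) : O.idObj ⟶ B.obj 1 := B.str ⟨⟨.leaf 0, List.Perm.refl _⟩, trivial⟩

/-- The collection `I`: the unit of `O` in arity one and the initial object in all other arities. -/
noncomputable def unitColl [∀ n, HasInitial (C n)] (O : UnitalCatOperad C) : IColl C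
  | 1 => O.idObj
  | 0 => ⊥_ C 0
  | n + 2 => ⊥_ C (n + 2)

/-- The map from `I` to a unital operad that is given by its internal unit. -/
noncomputable def unitCollMap [∀ n, HasInitial (C n)] (B : IOpU O) : ∀ n, unitColl O n ⟶ B.obj n
  | 1 => unitMap B
  | 0 => initial.to _
  | _ + 2 => initial.to _

/-- For a morphism `y` from a non-unital operad `A` to a unital one `B`, the cofan
`A n ⟶ B n ⟵ I n`. -/
noncomputable def unitCofan [∀ n, HasInitial (C n)] {A : IOpNu O} {B : IOpU O} (y : A ⟶ (U₃ O).obj B) (n : ℕ) :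
    BinaryCofan (A.obj n) (unitColl O n) :=
  BinaryCofan.mk (y.hom n) (unitCollMap B n)

end UnitalCatOperad

end FreeOp
open FreeOp FreeOp.UnitalCatOperad

/-! All three forgetful functors restrict a lax algebra structure from a class K' of trees to a
smaller class K, if collections are regarded as operads for the class of corollas. In each case
there is a family of generating trees (`Generators`) such that every tree of K' arises, in exactly
one way, by substituting trees of K into the vertices of exactly one generator. Over corollas, the
generators are all planar trees except |; over planar trees, the permuted corollas; over trees other
than |, the corolla and |. Given such a family, the free K'-operad on A is, in arity n, the
coproduct over the generators with n leaves of the composites of A along them.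

The composite of A along any tree of K' maps canonically to this coproduct (`lam`): factor the tree
through its generator and compose A along the pieces in K. If composition along trees distributes
over coproducts at the vertices, the composite of the free objects along t is a coproduct indexed by
the decorations of t by generators. The structure map substitutes the generators into t on each
summand and then applies `lam`. Associativity (`freeStr_subst`) is checked on summands, where both
sides become `lam` of the same total tree. This rests on `lam_subst`, `lam_freeStrT` and the fact
that decorations lift through substitution (`OTree.exists_subst_lift`), a trace of the cartesianness
of the polynomial monad. The coprojections turn out to be the unit at every vertex followed by
composition (`isCoprod_unit`), which is the form the theorem asks for.

Distributivity (`allDistributive`) holds for two-vertex trees by the hypothesis on the partial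
compositions, and for corollas, | and permuted corollas without any hypothesis, since a permutation
acts by an equivalence. It is stable under substitution, and these trees generate all others.

Finally, the colimit over leveled trees is a coproduct over planar trees: morphisms of leveled trees
are unique, and two leveled trees are isomorphic exactly when they have the same underlying planar
tree (`eqvGen_of_tree_eq`). The latter is a confluence argument on the order in which vertices are
split off a forest. -/

namespace FreeOp

/-! ### Morphisms of decorated trees under relabelling, grafting and substitution. -/

namespace TrHom
variable {C : ℕ → Type u} [∀ k, Category.{v} (C k)] {D : ℕ → Type w} [∀ k, Category.{u₁} (D k)]
  {X : ℕ → Type u₂} {Y : ℕ → Type u₃} {L M : Type}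

/-- Identities such as `Tr.map_map` hold only propositionally, so morphisms over them are compared
by heterogeneous equality. This is the induction step of such comparisons. -/
theorem node_heq {k : ℕ} {x y : C k} {ts ss ts' ss' : Fin k → Tr C L} (f : x ⟶ y)
    {g : ∀ i, TrHom (ts i) (ss i)} {g' : ∀ i, TrHom (ts' i) (ss' i)} (h : ts = ts') (h' : ss = ss')
    (hg : ∀ i, HEq (g i) (g' i)) : HEq (node f g) (node f g') := by
  subst h h'
  have : g = g' := funext fun i => eq_of_heq (hg i)
  rw [this]

theorem dec_map_heq {A B : ∀ k, Y k → C k} (θ : ∀ k y, A k y ⟶ B k y) (f : ∀ k, X k → Y k)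
    (t : Tr X L) : HEq (dec (fun k x => θ k (f k x)) t) (dec θ (t.map f)) := by
  induction t with
  | leaf l => rfl
  | node k x ts ih =>
    exact node_heq _ (funext fun i => (Tr.map_map f A (ts i)).symm)
      (funext fun i => (Tr.map_map f B (ts i)).symm) ih

theorem map_dec_heq (F : ∀ k, C k ⥤ D k) {A B : ∀ k, Y k → C k} (θ : ∀ k y, A k y ⟶ B k y)
    (t : Tr Y L) : HEq (map F (dec θ t)) (dec (fun k y => (F k).map (θ k y)) t) := by
  induction t with
  | leaf l => rfl
  | node k x ts ih =>
    exact node_heq _ (funext fun i => Tr.map_map _ _ (ts i))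
      (funext fun i => Tr.map_map _ _ (ts i)) ih

theorem bind_heq {s t s' t' : Tr C L} (hs : s = s') (ht : t = t') {p : TrHom s t}
    {p' : TrHom s' t'} (hp : HEq p p') {f g f' g' : L → Tr C M} (hf : f = f') (hg : g = g')
    {q : ∀ l, TrHom (f l) (g l)} {q' : ∀ l, TrHom (f' l) (g' l)} (hq : ∀ l, HEq (q l) (q' l)) :
    HEq (p.bind q) (p'.bind q') := by
  subst hs ht hf hg
  obtain rfl : q = q' := funext fun l => eq_of_heq (hq l)
  rw [eq_of_heq hp]

theorem dec_bind_heq {A B : ∀ k, Y k → C k} (θ : ∀ k y, A k y ⟶ B k y)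
    (t : Tr Y L) (g : L → Tr Y M) :
    HEq (bind (dec θ t) fun l => dec θ (g l)) (dec θ (t.bind g)) := by
  induction t with
  | leaf l => rfl
  | node k x ts ih =>
    exact node_heq _ (funext fun i => (Tr.map_bind _ (ts i) g).symm)
      (funext fun i => (Tr.map_bind _ (ts i) g).symm) ih

/-- Computes the multiplication of the monad on a tree of decorations; it is what turns naturality
of the associativity isomorphism into `cmp_natural`. -/
theorem flatten_dec_heq {A B : ∀ k, Y k → C k} (θ : ∀ k y, A k y ⟶ B k y)
    (r : ∀ k, X k → OTree Y k) (t : Tr X L) :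
    HEq (flatten (dec (C := OTree C) (A := fun k x => (r k x).map A)
      (B := fun k x => (r k x).map B) (fun k x => OTree.decHom θ (r k x)) t))
      (dec θ (t.subst r)) := by
  induction t with
  | leaf l => rfl
  | node k x ts ih =>
    have e : ∀ (A : ∀ k, Y k → C k) (i : Fin k),
        ((ts i).map fun k x => (r k x).map A).subst (fun _ x => x) = ((ts i).subst r).map A :=
      fun A i => (Tr.subst_map _ _ (ts i)).trans (Tr.map_subst r A (ts i)).symm
    refine HEq.trans (bind_heq rfl rfl HEq.rfl (funext (e A)) (funext (e B)) ih) ?_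
    exact dec_bind_heq θ _ _

theorem dec_heq {A B A' B' : ∀ k, X k → C k} (hA : A = A') (hB : B = B')
    {θ : ∀ k x, A k x ⟶ B k x} {θ' : ∀ k x, A' k x ⟶ B' k x} (h : ∀ k x, HEq (θ k x) (θ' k x))
    (t : Tr X L) : HEq (dec θ t) (dec θ' t) := by
  subst hA hB
  obtain rfl : θ = θ' := funext fun k => funext fun x => eq_of_heq (h k x)
  rfl

end TrHom

theorem comp_eqToHom_of_heq {D : Type u} [Category.{v} D] {X Y X' Y' : D} {f : X ⟶ Y}
    {g : X' ⟶ Y'} (hX : X = X') (hY : Y = Y') (h : HEq f g) :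
    f ≫ eqToHom hY = eqToHom hX ≫ g := by
  subst hX hY
  rw [eq_of_heq h, eqToHom_refl, eqToHom_refl, Category.comp_id, Category.id_comp]

namespace OTree
variable {C : ℕ → Type u} [∀ k, Category.{v} (C k)] {X : ℕ → Type u₁} {n : ℕ}

theorem decHom_eqToHom {A B : ∀ k, X k → C k} (h : A = B) (t : OTree X n) :
    decHom (fun k x => eqToHom (congrFun (congrFun h k) x)) t =
      eqToHom (congrArg t.map h) := by
  subst h
  exact TrHom.dec_id _ _

theorem decHom_comp {A B E : ∀ k, X k → C k} (θ : ∀ k x, A k x ⟶ B k x)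
    (ζ : ∀ k x, B k x ⟶ E k x) (t : OTree X n) :
    decHom (fun k x => θ k x ≫ ζ k x) t = decHom θ t ≫ decHom ζ t :=
  TrHom.dec_comp θ ζ t.tree
end OTree

/-! ### Coherence calculus for composites along tagged trees. -/

namespace UnitalCatOperad
variable {C : ℕ → Type u} [∀ n, Category.{v} (C n)] (O : UnitalCatOperad C)
  {X Y Z W : ℕ → Type} {n : ℕ}

section Raw
variable {S T S' T' : OTree C n}

/-- The associativity isomorphism at `Q`, with source and target given up to equality. -/
def cmpAux (Q : OTree (OTree C) n) (hS : S = (OTree.mapFunctor O.act n).obj Q)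
    (hT : (OTree.mu C n).obj Q = T) : (O.act n).obj S ⟶ (O.act n).obj T :=
  (O.act n).map (eqToHom hS) ≫ O.assocHom Q ≫ (O.act n).map (eqToHom hT)

variable {Q Q' : OTree (OTree C) n} (hS : S = (OTree.mapFunctor O.act n).obj Q)
    (hT : (OTree.mu C n).obj Q = T) (hS' : S' = (OTree.mapFunctor O.act n).obj Q')
    (hT' : (OTree.mu C n).obj Q' = T')

/-- Source and target are variables constrained by equations, so the equations can be substituted
away and only the plain associativity isomorphism remains. The other lemmas on `cmpAux` use the same
device. -/
theorem isIso_cmpAux : IsIso (O.cmpAux Q hS hT) := by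
  subst hS hT
  simp only [cmpAux, eqToHom_refl, CategoryTheory.Functor.map_id, Category.id_comp,
    Category.comp_id]
  infer_instance

theorem cmpAux_natural (f : Q ⟶ Q') (a : S ⟶ S') (b : T ⟶ T')
    (ha : HEq a ((OTree.mapFunctor O.act n).map f)) (hb : HEq b ((OTree.mu C n).map f)) :
    (O.act n).map a ≫ O.cmpAux Q' hS' hT' = O.cmpAux Q hS hT ≫ (O.act n).map b := by
  subst hS hT hS' hT'
  obtain rfl := eq_of_heq ha
  obtain rfl := eq_of_heq hb
  simp only [cmpAux, eqToHom_refl, CategoryTheory.Functor.map_id, Category.id_comp,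
    Category.comp_id]
  exact (O.assoc n).hom.naturality f

theorem cmpAux_congr (h : Q = Q') (hS : S = (OTree.mapFunctor O.act n).obj Q)
    (hT : (OTree.mu C n).obj Q = T) (hS' : S' = (OTree.mapFunctor O.act n).obj Q')
    (hT' : (OTree.mu C n).obj Q' = T') (e : S = S') (e' : T = T') :
    (O.act n).map (eqToHom e) ≫ O.cmpAux Q' hS' hT' =
      O.cmpAux Q hS hT ≫ (O.act n).map (eqToHom e') := by
  subst h e e'
  simp only [eqToHom_refl, CategoryTheory.Functor.map_id, Category.id_comp, Category.comp_id]

/-- This is the associativity coherence at the triple tree `P`, with all intermediate objects given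
only up to equality. -/
theorem cmpAux_cmpAux (P : OTree (OTree (OTree C)) n) {S T R R' : OTree C n} {Q₁ Q₂ Q₃ : OTree (OTree C) n}
    (h₁ : Q₁ = (OTree.mapFunctor (OTree.mapFunctor O.act) n).obj P)
    (h₂ : Q₂ = (OTree.mu (OTree C) n).obj P)
    (h₃ : Q₃ = (OTree.mapFunctor (OTree.mu C) n).obj P)
    (e₁ : S = (OTree.mapFunctor O.act n).obj Q₁) (e₂ : (OTree.mu C n).obj Q₁ = R)
    (e₃ : R = (OTree.mapFunctor O.act n).obj Q₂) (e₄ : (OTree.mu C n).obj Q₂ = T)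
    (e₅ : R' = (OTree.mapFunctor O.act n).obj Q₃) (e₆ : (OTree.mu C n).obj Q₃ = T)
    (a : S ⟶ R') (ha : HEq a (O.mapAssoc P)) :
    O.cmpAux Q₁ e₁ e₂ ≫ O.cmpAux Q₂ e₃ e₄ = (O.act n).map a ≫ O.cmpAux Q₃ e₅ e₆ := by
  subst h₁ h₂ h₃ e₁ e₂ e₅ e₄
  obtain rfl := eq_of_heq ha
  have H := O.assoc_coherence n P
  simp only [cmpAux, eqToHom_refl, CategoryTheory.Functor.map_id, Category.id_comp,
    Category.comp_id]
  exact (Category.assoc _ _ _).symm.trans ((Category.assoc _ _ _).trans H)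

theorem mapAssoc_heq (P : OTree (OTree (OTree C)) n) :
    HEq (O.mapAssoc P) (OTree.decHom (fun _ t => O.assocHom t) P) := by
  rw [UnitalCatOperadData.mapAssoc]
  exact (eqToHom_comp_heq _ _).trans (comp_eqToHom_heq _ _)

theorem mapUnit_heq (t : OTree C n) :
    HEq (O.mapUnit t) (OTree.decHom (fun _ x => O.unitHom x) t) := by
  rw [UnitalCatOperadData.mapUnit]
  exact (eqToHom_comp_heq _ _).trans (comp_eqToHom_heq _ _)

theorem cmpAux_heq : HEq (O.cmpAux Q hS hT) (O.assocHom Q) := by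
  subst hS hT
  simp only [cmpAux, eqToHom_refl, CategoryTheory.Functor.map_id, Category.id_comp,
    Category.comp_id]
  rfl

theorem cmpAux_eta (t : OTree C n) (h : Q = (OTree.mapFunctor (OTree.eta C) n).obj t)
    (hS : S = (OTree.mapFunctor O.act n).obj Q) (hT : (OTree.mu C n).obj Q = T)
    (a : S ⟶ T) (ha : HEq a (O.mapUnit t)) : O.cmpAux Q hS hT = (O.act n).map a := by
  subst h hS
  obtain rfl : t = T := (OTree.mu_obj_map_eta t).symm.trans hT
  obtain rfl := eq_of_heq ha
  refine Eq.trans ?_ (O.unit_coherence_left n t)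
  exact (congrArg (· ≫ _) ((O.act n).map_id _)).trans (Category.id_comp _)

end Raw

/-- The composite along `Q` of the objects `A k y`. -/
def ev (Q : OTree Y n) (A : ∀ k, Y k → C k) : C n := (O.act n).obj (Q.map A)

def evMap (Q : OTree Y n) {A B : ∀ k, Y k → C k} (θ : ∀ k y, A k y ⟶ B k y) :
    O.ev Q A ⟶ O.ev Q B := (O.act n).map (OTree.decHom θ Q)

theorem evMap_id (Q : OTree Y n) (A : ∀ k, Y k → C k) :
    O.evMap Q (fun k y => 𝟙 (A k y)) = 𝟙 _ :=
  (congrArg (O.act n).map (TrHom.dec_id A Q.tree)).trans ((O.act n).map_id _)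

theorem evMap_comp (Q : OTree Y n) {A B E : ∀ k, Y k → C k} (θ : ∀ k y, A k y ⟶ B k y)
    (ζ : ∀ k y, B k y ⟶ E k y) :
    O.evMap Q θ ≫ O.evMap Q ζ = O.evMap Q fun k y => θ k y ≫ ζ k y :=
  ((O.act n).map_comp _ _).symm.trans (congrArg _ (OTree.decHom_comp θ ζ Q).symm)

theorem evMap_comp_assoc (Q : OTree Y n) {A B E : ∀ k, Y k → C k} (θ : ∀ k y, A k y ⟶ B k y)
    (ζ : ∀ k y, B k y ⟶ E k y) {T : C n} (f : O.ev Q E ⟶ T) :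
    O.evMap Q θ ≫ O.evMap Q ζ ≫ f = O.evMap Q (fun k y => θ k y ≫ ζ k y) ≫ f := by
  rw [← evMap_comp, Category.assoc]

instance isIso_evMap (Q : OTree Y n) {A B : ∀ k, Y k → C k} (θ : ∀ k y, A k y ⟶ B k y)
    [∀ k y, IsIso (θ k y)] : IsIso (O.evMap Q θ) :=
  ⟨O.evMap Q (fun k y => inv (θ k y)), by
    rw [evMap_comp]; simp only [IsIso.hom_inv_id, evMap_id], by
    rw [evMap_comp]; simp only [IsIso.inv_hom_id, evMap_id]⟩

/-- The isomorphism between the composites along `Q` and along `Q` with its tags renamed. -/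
def retag (f : ∀ k, X k → Y k) {Q : OTree X n} {Q' : OTree Y n} (h : Q.map f = Q')
    (A : ∀ k, Y k → C k) : O.ev Q (fun k x => A k (f k x)) ⟶ O.ev Q' A :=
  (O.act n).map (eqToHom ((OTree.map_map f A Q).symm.trans (congrArg (OTree.map A) h)))

instance isIso_retag (f : ∀ k, X k → Y k) {Q : OTree X n} {Q' : OTree Y n} (h : Q.map f = Q')
    (A : ∀ k, Y k → C k) : IsIso (O.retag f h A) :=
  inferInstanceAs (IsIso ((O.act n).map _))

theorem cmp_source (Q : OTree Y n) (r : ∀ k, Y k → OTree Z k) (A : ∀ k, Z k → C k) :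
    (Q.map fun k y => (O.act k).obj ((r k y).map A)) =
      (OTree.mapFunctor O.act n).obj (Q.map fun k y => (r k y).map A) :=
  (OTree.map_map _ _ Q).symm

theorem cmp_target (Q : OTree Y n) (r : ∀ k, Y k → OTree Z k) (A : ∀ k, Z k → C k)
    {t : OTree Z n} (h : Q.subst r = t) :
    (OTree.mu C n).obj (Q.map fun k y => (r k y).map A) = t.map A :=
  ((OTree.subst_map (fun k y => (r k y).map A) (fun _ x => x) Q).trans
    (OTree.map_subst r A Q).symm).trans (congrArg (OTree.map A) h)

/-- The composition isomorphism, from the composite along `Q` of the composites along the `r k y` to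
the composite along the result `t` of the substitution. -/
def cmp (Q : OTree Y n) (r : ∀ k, Y k → OTree Z k) {t : OTree Z n} (h : Q.subst r = t)
    (A : ∀ k, Z k → C k) : O.ev Q (fun k y => O.ev (r k y) A) ⟶ O.ev t A :=
  O.cmpAux (Q.map fun k y => (r k y).map A) (O.cmp_source Q r A) (cmp_target Q r A h)

instance isIso_cmp (Q : OTree Y n) (r : ∀ k, Y k → OTree Z k) {t : OTree Z n} (h : Q.subst r = t)
    (A : ∀ k, Z k → C k) : IsIso (O.cmp Q r h A) :=
  O.isIso_cmpAux _ _

theorem evMap_retag (f : ∀ k, X k → Y k) {Q : OTree X n} {Q' : OTree Y n} (h : Q.map f = Q')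
    {A B : ∀ k, Y k → C k} (θ : ∀ k y, A k y ⟶ B k y) :
    O.evMap Q (fun k x => θ k (f k x)) ≫ O.retag f h B = O.retag f h A ≫ O.evMap Q' θ := by
  subst h
  refine ((O.act n).map_comp _ _).symm.trans (Eq.trans ?_ ((O.act n).map_comp _ _))
  exact congrArg _ (comp_eqToHom_of_heq (OTree.map_map f A Q).symm (OTree.map_map f B Q).symm
    (TrHom.dec_map_heq θ f Q.tree))

theorem retag_retag (f : ∀ k, X k → Y k) (g : ∀ k, Y k → Z k) {Q : OTree X n} {Q' : OTree Y n}
    {Q'' : OTree Z n} (h : Q.map f = Q') (h' : Q'.map g = Q'')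
    (h'' : Q.map (fun k x => g k (f k x)) = Q'') (A : ∀ k, Z k → C k) :
    O.retag f h (fun k y => A k (g k y)) ≫ O.retag g h' A =
      O.retag (fun k x => g k (f k x)) h'' A :=
  ((O.act n).map_comp _ _).symm.trans (congrArg _ (eqToHom_trans _ _))

theorem retag_id {Q : OTree X n} (h : Q.map (fun _ x => x) = Q) (A : ∀ k, X k → C k) :
    O.retag (fun _ x => x) h A = 𝟙 _ :=
  (O.act n).map_id _

/-- Naturality of the associativity isomorphism at the morphism of trees of trees whose component at
a vertex `y` of `Q` is `θ` along `r k y`. -/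
theorem cmp_natural (Q : OTree Y n) (r : ∀ k, Y k → OTree Z k) {t : OTree Z n}
    (h : Q.subst r = t) {A B : ∀ k, Z k → C k} (θ : ∀ k z, A k z ⟶ B k z) :
    O.evMap Q (fun k y => O.evMap (r k y) θ) ≫ O.cmp Q r h B =
      O.cmp Q r h A ≫ O.evMap t θ := by
  subst h
  exact O.cmpAux_natural _ _ _ _ (OTree.decHom (C := OTree C)
    (A := fun k y => (r k y).map A) (B := fun k y => (r k y).map B)
    (fun k y => OTree.decHom θ (r k y)) Q) _ _
    (TrHom.map_dec_heq O.act (C := OTree C) (A := fun k y => (r k y).map A)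
      (B := fun k y => (r k y).map B) (fun k y => OTree.decHom θ (r k y)) Q.tree).symm
    (TrHom.flatten_dec_heq θ r Q.tree).symm

theorem cmp_natural_assoc (Q : OTree Y n) (r : ∀ k, Y k → OTree Z k) {t : OTree Z n}
    (h : Q.subst r = t) {A B : ∀ k, Z k → C k} (θ : ∀ k z, A k z ⟶ B k z) {T : C n}
    (f : O.ev t B ⟶ T) :
    O.evMap Q (fun k y => O.evMap (r k y) θ) ≫ O.cmp Q r h B ≫ f =
      O.cmp Q r h A ≫ O.evMap t θ ≫ f := by
  rw [← Category.assoc, cmp_natural, Category.assoc]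

/-- The tree `Q` with `r` and then `q` put into it is a tree of trees of trees; the associativity
coherence there says that substituting from the outside or from the inside gives the same
isomorphism. -/
theorem cmp_cmp (Q : OTree Y n) (r : ∀ k, Y k → OTree Z k) {t : OTree Z n}
    (h : Q.subst r = t) (q : ∀ k, Z k → OTree W k) {s : OTree W n} (h' : t.subst q = s)
    (p : ∀ k, Y k → OTree W k) (h'' : ∀ k y, (r k y).subst q = p k y) (hs : Q.subst p = s)
    (A : ∀ k, W k → C k) :
    O.cmp Q r h (fun k z => O.ev (q k z) A) ≫ O.cmp t q h' A =
      O.evMap Q (fun k y => O.cmp (r k y) q (h'' k y) A) ≫ O.cmp Q p hs A := by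
  subst h h'
  obtain rfl : (fun k y => (r k y).subst q) = p := funext fun k => funext fun y => h'' k y
  refine O.cmpAux_cmpAux (Q.map fun k y => (r k y).map fun k z => (q k z).map A) ?_ ?_ ?_
    _ _ _ _ _ _ _ ?_
  · refine Eq.trans ?_ (OTree.map_map _ _ Q).symm
    exact congrArg Q.map (funext fun k => funext fun y => (OTree.map_map _ _ (r k y)).symm)
  · exact (OTree.map_subst r _ Q).trans (OTree.subst_map
      (fun k y => (r k y).map fun k z => (q k z).map A) (fun _ x => x) Q).symm
  · refine Eq.trans ?_ (OTree.map_map _ _ Q).symm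
    exact congrArg Q.map (funext fun k => funext fun y =>
      (OTree.map_subst q A (r k y)).trans (OTree.subst_map
        (fun k z => (q k z).map A) (fun _ x => x) (r k y)).symm)
  · refine HEq.trans ?_ (O.mapAssoc_heq _).symm
    refine HEq.trans ?_ (TrHom.dec_map_heq (fun _ t => O.assocHom t) _ Q.tree)
    refine TrHom.dec_heq ?_ ?_ (fun k y => O.cmpAux_heq (O.cmp_source (r k y) q A)
        (cmp_target (r k y) q A rfl)) Q.tree
    · funext k y
      exact congrArg (O.act k).obj (O.cmp_source _ _ _)
    · funext k y
      exact congrArg (O.act k).obj (cmp_target _ _ _ rfl).symm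

theorem cmp_cmp_assoc (Q : OTree Y n) (r : ∀ k, Y k → OTree Z k) {t : OTree Z n}
    (h : Q.subst r = t) (q : ∀ k, Z k → OTree W k) {s : OTree W n} (h' : t.subst q = s)
    (p : ∀ k, Y k → OTree W k) (h'' : ∀ k y, (r k y).subst q = p k y) (hs : Q.subst p = s)
    (A : ∀ k, W k → C k) {T : C n} (f : O.ev s A ⟶ T) :
    O.cmp Q r h (fun k z => O.ev (q k z) A) ≫ O.cmp t q h' A ≫ f =
      O.evMap Q (fun k y => O.cmp (r k y) q (h'' k y) A) ≫ O.cmp Q p hs A ≫ f := by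
  rw [← Category.assoc, O.cmp_cmp Q r h q h' p h'' hs, Category.assoc]

theorem retag_cmp (f : ∀ k, X k → Y k) {Q : OTree X n} {Q' : OTree Y n} (h : Q.map f = Q')
    (r : ∀ k, Y k → OTree Z k) {t : OTree Z n} (ht : Q'.subst r = t)
    (ht' : Q.subst (fun k x => r k (f k x)) = t) (A : ∀ k, Z k → C k) :
    O.retag f h (fun k y => O.ev (r k y) A) ≫ O.cmp Q' r ht A =
      O.cmp Q (fun k x => r k (f k x)) ht' A := by
  subst h ht
  refine (O.cmpAux_congr (OTree.map_map f (fun k y => (r k y).map A) Q).symm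
    (O.cmp_source _ _ _) (cmp_target _ _ _ ht') _ _ _ rfl).trans ?_
  rw [eqToHom_refl, CategoryTheory.Functor.map_id]
  exact Category.comp_id _

theorem cmp_retag (Q : OTree Y n) {r : ∀ k, Y k → OTree Z k} {r' : ∀ k, Y k → OTree W k}
    (f : ∀ k, Z k → W k) (h : ∀ k y, (r k y).map f = r' k y) {t : OTree Z n} {t' : OTree W n}
    (ht : Q.subst r = t) (ht' : Q.subst r' = t') (htt' : t.map f = t') (A : ∀ k, W k → C k) :
    O.evMap Q (fun k y => O.retag f (h k y) A) ≫ O.cmp Q r' ht' A =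
      O.cmp Q r ht (fun k z => A k (f k z)) ≫ O.retag f htt' A := by
  obtain rfl : (fun k y => (r k y).map f) = r' := funext fun k => funext fun y => h k y
  subst ht htt'
  have e : (fun k y => (r k y).map fun k z => A k (f k z)) =
      fun k y => ((r k y).map f).map A :=
    funext fun k => funext fun y => (OTree.map_map f A (r k y)).symm
  have e' : (fun k y => O.ev (r k y) fun k z => A k (f k z)) =
      fun k y => O.ev ((r k y).map f) A :=
    funext fun k => funext fun y => congrArg (O.act k).obj (congrFun (congrFun e k) y)
  refine Eq.trans ?_ (O.cmpAux_congr (congrArg Q.map e) (O.cmp_source _ _ _)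
    (cmp_target _ _ _ rfl) (O.cmp_source _ _ _) (cmp_target _ _ _ ht')
    (congrArg Q.map e') _)
  refine congrArg (· ≫ _) (congrArg (O.act n).map ?_)
  refine Eq.trans ?_ (OTree.decHom_eqToHom e' Q)
  exact congrArg (fun θ => OTree.decHom θ Q) (funext fun k => funext fun y => eqToHom_map _ _)

/-- The unit isomorphism, between the composite along a corolla and the object at its vertex. -/
def evCorolla (y : Y n) (A : ∀ k, Y k → C k) : O.ev (OTree.corolla y) A ⟶ A n y :=
  O.unitHom (A n y)

instance isIso_evCorolla (y : Y n) (A : ∀ k, Y k → C k) : IsIso (O.evCorolla y A) :=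
  inferInstanceAs (IsIso ((O.unit n).hom.app (A n y)))

theorem evCorolla_natural (y : Y n) {A B : ∀ k, Y k → C k} (θ : ∀ k y, A k y ⟶ B k y) :
    O.evMap (OTree.corolla y) θ ≫ O.evCorolla y B = O.evCorolla y A ≫ θ n y :=
  (O.unit n).hom.naturality (θ n y)

theorem evCorolla_natural_assoc (y : Y n) {A B : ∀ k, Y k → C k} (θ : ∀ k y, A k y ⟶ B k y)
    {T : C n} (f : B n y ⟶ T) :
    O.evMap (OTree.corolla y) θ ≫ O.evCorolla y B ≫ f = O.evCorolla y A ≫ θ n y ≫ f := by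
  rw [← Category.assoc, evCorolla_natural, Category.assoc]

/-- Substituting into a corolla is the multiplication after the unit at a tree, so this is
`unit_coherence_right`. -/
theorem cmp_corolla_left (y : Y n) (r : ∀ k, Y k → OTree Z k)
    (h : (OTree.corolla y).subst r = r n y) (A : ∀ k, Z k → C k) :
    O.cmp (OTree.corolla y) r h A = O.evCorolla y fun k y => O.ev (r k y) A := by
  refine Eq.trans ?_ (O.unit_coherence_right n ((r n y).map A))
  refine Eq.trans (congrArg (· ≫ _) ((O.act n).map_id _)) (Category.id_comp _)

/-- Substituting corollas is the multiplication after the unit inside a tree, so this is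
`unit_coherence_left`, up to the renaming of tags by `f`. -/
theorem cmp_corolla_right (Q : OTree Y n) (f : ∀ k, Y k → Z k) {t : OTree Z n}
    (h : Q.subst (fun k y => OTree.corolla (f k y)) = t) (ht : Q.map f = t) (A : ∀ k, Z k → C k) :
    O.cmp Q (fun k y => OTree.corolla (f k y)) h A =
      O.evMap Q (fun k y => O.evCorolla (f k y) A) ≫ O.retag f ht A := by
  subst ht
  refine Eq.trans (O.cmpAux_eta (Q.map fun k y => A k (f k y)) ?_ _ _ _ ?_) ((O.act n).map_comp _ _)
  · exact (OTree.map_map (fun k y => A k (f k y)) (fun k => (OTree.eta C k).obj) Q).symm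
  · refine HEq.trans (comp_eqToHom_heq _ _) (HEq.trans ?_ (O.mapUnit_heq _).symm)
    exact TrHom.dec_map_heq (fun _ x => O.unitHom x) _ Q.tree

end UnitalCatOperad
end FreeOp

/-! ### Lifting decorations through grafting and substitution. -/

namespace FreeOp

namespace Tr
variable {X : ℕ → Type u₁} {Y : ℕ → Type u₂} {Z : ℕ → Type u₃} {L M : Type}

theorem map_eq_leaf {f : ∀ k, X k → Y k} {t : Tr X L} {l : L} (h : t.map f = leaf l) :
    t = leaf l := by
  cases t with
  | leaf l' =>
    cases h
    rfl
  | node k x ts => cases h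

theorem map_eq_node {f : ∀ k, X k → Y k} {t : Tr X L} {k : ℕ} {y : Y k} {ss : Fin k → Tr Y L}
    (h : t.map f = node k y ss) :
    ∃ x ts, t = node k x ts ∧ f k x = y ∧ ∀ i, (ts i).map f = ss i := by
  cases t with
  | leaf l' => cases h
  | node k' x ts =>
    simp only [map, node.injEq] at h
    obtain ⟨rfl, h1, h2⟩ := h
    exact ⟨x, ts, rfl, eq_of_heq h1, fun i => congrFun (eq_of_heq h2) i⟩

theorem bind_congr {t : Tr X L} {g g' : L → Tr X M} (h : ∀ l ∈ t.leaves, g l = g' l) :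
    t.bind g = t.bind g' := by
  induction t with
  | leaf l => exact h l (by simp [leaves])
  | node k x ts ih =>
    refine congrArg (node k x) (funext fun i => ih i fun l hl => h l ?_)
    simp only [leaves, List.mem_flatMap]
    exact ⟨i, List.mem_finRange i, hl⟩

theorem nodup_leaves_node {k : ℕ} {x : X k} {ts : Fin k → Tr X L}
    (h : (node k x ts).leaves.Nodup) : (∀ i, (ts i).leaves.Nodup) ∧
      ∀ i j l, l ∈ (ts i).leaves → l ∈ (ts j).leaves → i = j := by
  rw [leaves, List.nodup_flatMap] at h
  refine ⟨fun i => h.1 i (List.mem_finRange i), fun i j l hi hj => ?_⟩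
  by_contra hij
  rcases lt_or_gt_of_ne hij with h' | h'
  · exact (List.pairwise_iff_get.1 h.2) ⟨i, by simp⟩ ⟨j, by simp⟩ h' (by simpa using hi)
      (by simpa using hj)
  · exact (List.pairwise_iff_get.1 h.2) ⟨j, by simp⟩ ⟨i, by simp⟩ h' (by simpa using hj)
      (by simpa using hi)

/-- A decoration of `t.bind g` is obtained by grafting decorations of the trees `g l` on a
decoration of `t`. -/
theorem exists_bind_lift {f : ∀ k, X k → Y k} (g₀ : L → Tr X M) (t : Tr Y L)
    (ht : t.leaves.Nodup) (g : L → Tr Y M) (R : Tr X M) (h : R.map f = t.bind g) :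
    ∃ (s : Tr X L) (g' : L → Tr X M), s.map f = t ∧ s.bind g' = R ∧
      ∀ l ∈ t.leaves, (g' l).map f = g l := by
  classical
  induction t generalizing R with
  | leaf l => exact ⟨leaf l, fun _ => R, rfl, rfl, fun l' hl' => by
      obtain rfl : l' = l := by simpa [leaves] using hl'
      exact h⟩
  | node k y ts ih =>
    obtain ⟨x, Rs, rfl, rfl, hR⟩ := map_eq_node h
    obtain ⟨h1, h2⟩ := nodup_leaves_node ht
    choose s g' hs hg' hl using fun i => ih i (h1 i) (Rs i) (hR i)
    have hs' : ∀ i, (s i).leaves = (ts i).leaves := fun i => by rw [← hs i, leaves_map]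
    -- The leaves are distinct, so a label determines the branch in which it occurs; `g₀` is a
    -- default for labels that do not occur.
    let G : L → Tr X M := fun l => if hl : ∃ i, l ∈ (ts i).leaves then g' hl.choose l else g₀ l
    have hG : ∀ i, ∀ l ∈ (ts i).leaves, G l = g' i l := by
      intro i l hl
      have hl' : ∃ i, l ∈ (ts i).leaves := ⟨i, hl⟩
      have := h2 _ _ _ hl'.choose_spec hl
      simp only [G, dif_pos hl', this]
    refine ⟨node k x s, G, congrArg _ (funext hs), congrArg (node k x) (funext fun i => ?_), ?_⟩
    · rw [← hg' i]
      exact bind_congr fun l hl => hG i l (hs' i ▸ hl)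
    · intro l hl'
      simp only [leaves, List.mem_flatMap] at hl'
      obtain ⟨i, -, hi⟩ := hl'
      rw [hG i l hi, hl i l hi]

/-- A decoration of `Q.subst r` is obtained by substituting decorations of the trees `r k y`. -/
theorem exists_subst_lift {X Y Z : ℕ → Type} (f : ∀ k, X k → Z k) (r : ∀ k, Y k → OTree Z k)
    (Q : Tr Y L) (R : Tr X L) (h : R.map f = Q.subst r) :
    ∃ R' : Tr (fun k => Σ y : Y k, {t : OTree X k // t.map f = r k y}) L,
      R'.map (fun _ p => p.1) = Q ∧ R'.subst (fun _ p => p.2.1) = R := by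
  induction Q generalizing R with
  | leaf l =>
    obtain rfl := map_eq_leaf h
    exact ⟨leaf l, rfl, rfl⟩
  | node k y ts ih =>
    -- The default graft is immaterial, because every input of the vertex occurs as a leaf of `r k
    -- y`.
    obtain ⟨s, g, hs, hg, hl⟩ := exists_bind_lift (fun _ => R) (r k y).tree
      ((r k y).linear.nodup_iff.2 (List.nodup_finRange k)) _ R h
    have hl' : ∀ i, (g i).map f = (ts i).subst r := fun i =>
      hl i ((r k y).linear.mem_iff.2 (List.mem_finRange i))
    choose R' h1 h2 using fun i => ih i (g i) (hl' i)
    refine ⟨node k ⟨y, ⟨s, ?_⟩, OTree.ext hs⟩ R', congrArg _ (funext h1), ?_⟩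
    · rw [← leaves_map f, hs]
      exact (r k y).linear
    · simp only [subst, h2, hg]

end Tr

/-- Pairs of a tag `y` and a decoration of the tree `r k y`. -/
abbrev Deco {X Y Z : ℕ → Type} (f : ∀ k, X k → Z k) (r : ∀ k, Y k → OTree Z k) (k : ℕ) : Type :=
  Σ y : Y k, {t : OTree X k // t.map f = r k y}

/-- The existence half of the cartesianness of the multiplication. Uniqueness of the lift is never
needed, because coproducts are transported along surjections of index sets. -/
theorem OTree.exists_subst_lift {X Y Z : ℕ → Type} (f : ∀ k, X k → Z k)
    (r : ∀ k, Y k → OTree Z k) {n : ℕ} (Q : OTree Y n) (R : OTree X n)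
    (h : R.map f = Q.subst r) :
    ∃ R' : OTree (Deco f r) n,
      R'.map (fun _ p => p.1) = Q ∧ R'.subst (fun _ p => p.2.1) = R := by
  obtain ⟨R', h1, h2⟩ := Tr.exists_subst_lift f r Q.tree R.tree (congrArg OTree.tree h)
  refine ⟨⟨R', ?_⟩, OTree.ext h1, OTree.ext h2⟩
  rw [← Tr.leaves_map (fun k (p : Deco f r k) => p.1), h1]
  exact Q.linear

end FreeOp

/-! ### Coproducts, distributivity, and structure maps at tagged trees. -/

namespace FreeOp

/-- The morphisms `c i` exhibit `X` as a coproduct. -/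
def IsCoprod {D : Type u} [Category.{v} D] {ι : Type} {G : ι → D} {X : D}
    (c : ∀ i, G i ⟶ X) : Prop :=
  ∀ (Z : D) (g : ∀ i, G i ⟶ Z), ∃! h : X ⟶ Z, ∀ i, c i ≫ h = g i

theorem IsCoprod.hom_ext {D : Type u} [Category.{v} D] {ι : Type} {G : ι → D} {X : D}
    {c : ∀ i, G i ⟶ X} (hc : IsCoprod c) {Z : D} {f g : X ⟶ Z} (h : ∀ i, c i ≫ f = c i ≫ g) :
    f = g :=
  (hc Z fun i => c i ≫ g).unique h fun _ => rfl

theorem exists_isCoprod {D : Type u} [Category.{v} D] [HasColimits D] {ι : Type} (G : ι → D) :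
    ∃ (X : D) (c : ∀ i, G i ⟶ X), IsCoprod c := by
  -- The index sets lie in the lowest universe, whereas cocompleteness is assumed for diagrams of
  -- size `v`.
  have : HasColimitsOfSize.{0, 0} D := hasColimitsOfSizeShrink.{0, 0, v, v} D
  refine ⟨∐ G, Sigma.ι G, fun Z g => ⟨Sigma.desc g, fun i => Sigma.ι_desc g i, fun h hh => ?_⟩⟩
  exact Sigma.hom_ext _ _ fun i => by rw [hh, Sigma.ι_desc]

theorem TreeClass.mem_subst (K : TreeClass) {n : ℕ} {Y Z : ℕ → Type} {Q : OTree Y n}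
    {r : ∀ k, Y k → OTree Z k} (hQ : K.mem n Q.shape) (hr : ∀ k y, K.mem k (r k y).shape)
    {t : OTree Z n} (h : Q.subst r = t) : K.mem n t.shape := by
  rw [← h, OTree.shape, OTree.map_subst]
  exact K.subst_mem Q _ hQ hr

theorem TreeClass.mem_map (K : TreeClass) {n : ℕ} {Y Z : ℕ → Type} {Q : OTree Y n}
    (hQ : K.mem n Q.shape) {f : ∀ k, Y k → Z k} {t : OTree Z n} (h : Q.map f = t) :
    K.mem n t.shape := by
  rw [← h, OTree.shape, OTree.map_map]
  exact hQ

theorem TreeClass.mem_corolla (K : TreeClass) {n : ℕ} {Y : ℕ → Type} (y : Y n) :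
    K.mem n (OTree.corolla y).shape := K.corolla_mem n

theorem OTree.shape_eq {n : ℕ} (t : OTree Pt n) : t.shape = t := t.map_id

namespace UnitalCatOperad
variable {C : ℕ → Type u} [∀ n, Category.{v} (C n)] (O : UnitalCatOperad C)
  {X Y Z W : ℕ → Type} {n : ℕ}

/-- Composition along `Q` preserves coproducts of objects at its vertices. -/
def Distributive (Q : OTree Y n) : Prop :=
  ∀ (I : ℕ → Type) (f : ∀ k, I k → Y k) (G : ∀ k, I k → C k) (D : ∀ k, Y k → C k)
    (c : ∀ k i, G k i ⟶ D k (f k i)),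
    (∀ k y, IsCoprod fun i : {i // f k i = y} => c k i.1 ≫ eqToHom (congrArg (D k) i.2)) →
      IsCoprod fun R : {R : OTree I n // R.map f = Q} => O.evMap R.1 c ≫ O.retag f R.2 D

/-- The isomorphism between the composites of a collection along `Q` and along its shape. -/
def toPt (Q : OTree Y n) {t : OTree Pt n} (h : Q.shape = t) (A : IColl C) :
    O.ev Q (fun k _ => A k) ⟶ O.ev t (fun k _ => A k) :=
  O.retag (X := Y) (Y := Pt) (fun _ _ => PUnit.unit) h (fun k _ => A k)

theorem retag_toPt (f : ∀ k, Y k → Z k) {Q : OTree Y n} {Q' : OTree Z n} (h : Q.map f = Q')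
    {t : OTree Pt n} (hQ : Q.shape = t) (hQ' : Q'.shape = t) (A : IColl C) :
    O.retag f h (fun k _ => A k) ≫ O.toPt Q' hQ' A = O.toPt Q hQ A :=
  O.retag_retag f (fun _ _ => PUnit.unit) h hQ' hQ fun k _ => A k

theorem evMap_toPt {Q : OTree Y n} {t : OTree Pt n} (h : Q.shape = t) {A B : IColl C}
    (θ : A ⟶ B) :
    O.evMap Q (fun k _ => θ k) ≫ O.toPt Q h B = O.toPt Q h A ≫ O.evMap t fun k _ => θ k :=
  O.evMap_retag (X := Y) (Y := Pt) (fun _ _ => PUnit.unit) h fun k _ => θ k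

theorem cmp_toPt (Q : OTree Y n) {r : ∀ k, Y k → OTree Z k} {r' : ∀ k, Y k → OTree Pt k}
    (h : ∀ k y, (r k y).shape = r' k y) {t : OTree Z n} {t' : OTree Pt n}
    (ht : Q.subst r = t) (ht' : Q.subst r' = t') (htt' : t.shape = t') (A : IColl C) :
    O.evMap Q (fun k y => O.toPt (r k y) (h k y) A) ≫ O.cmp Q r' ht' (fun k _ => A k) =
      O.cmp Q r ht (fun k _ => A k) ≫ O.toPt t htt' A :=
  O.cmp_retag Q (fun _ _ => PUnit.unit) h ht ht' htt' fun k _ => A k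

theorem toPt_self {t : OTree Pt n} (h : t.shape = t) (A : IColl C) : O.toPt t h A = 𝟙 _ :=
  O.retag_id h fun k _ => A k

variable {O}

/-- For untagged vertices the fibre of decorations over the unique tag is the whole index set, so
the transports in `Distributive` disappear. -/
theorem Distributive.isCoprod {t : OTree Pt n} (ht : O.Distributive t) {I : ℕ → Type}
    {G : ∀ k, I k → C k} {D : IColl C} (c : ∀ k i, G k i ⟶ D k) (hc : ∀ k, IsCoprod (c k)) :
    IsCoprod fun R : {R : OTree I n // R.shape = t} => O.evMap R.1 c ≫ O.toPt R.1 R.2 D := by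
  refine ht I (fun _ _ => PUnit.unit) G (fun k _ => D k) c fun k y Z g => ?_
  obtain ⟨h, h1, h2⟩ := hc k Z fun i => g ⟨i, rfl⟩
  refine ⟨h, fun i => ?_, fun h' hh => h2 h' fun i => ?_⟩
  · simp only [eqToHom_refl, Category.comp_id, h1]
  · simpa only [eqToHom_refl, Category.comp_id] using hh ⟨i, rfl⟩

section Tagged
variable {K : TreeClass} {A : IColl C} {B : C n}

/-- Extend a family of morphisms, indexed by trees, to trees with arbitrary tags. -/
def tagged (φ : ∀ t : OTree Pt n, K.mem n t → (O.ev t (fun k _ => A k) ⟶ B)) (Q : OTree Y n)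
    (hQ : K.mem n Q.shape) : O.ev Q (fun k _ => A k) ⟶ B :=
  O.toPt Q rfl A ≫ φ Q.shape hQ

variable (φ : ∀ t : OTree Pt n, K.mem n t → (O.ev t (fun k _ => A k) ⟶ B))

theorem tagged_eq (Q : OTree Y n) (hQ : K.mem n Q.shape) {t : OTree Pt n} (h : Q.shape = t)
    (ht : K.mem n t) : tagged φ Q hQ = O.toPt Q h A ≫ φ t ht := by
  subst h
  rfl

theorem retag_tagged (f : ∀ k, Y k → Z k)
    {Q : OTree Y n} {Q' : OTree Z n} (h : Q.map f = Q') (hQ : K.mem n Q.shape)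
    (hQ' : K.mem n Q'.shape) :
    O.retag f h (fun k _ => A k) ≫ tagged φ Q' hQ' = tagged φ Q hQ := by
  have e : Q.shape = Q'.shape := by
    subst h
    exact (OTree.map_map f (fun _ _ => PUnit.unit) Q).symm
  rw [tagged_eq φ Q hQ e hQ', tagged, reassoc_of% O.retag_toPt]

theorem toPt_tagged (Q : OTree Y n) {t : OTree Pt n} (h : Q.shape = t) (hQ : K.mem n Q.shape)
    (ht : K.mem n t.shape) : O.toPt Q h A ≫ tagged φ t ht = tagged φ Q hQ :=
  retag_tagged φ (fun _ _ => PUnit.unit) h hQ ht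

theorem tagged_pt (t : OTree Pt n) (ht : K.mem n t.shape) (ht' : K.mem n t) :
    tagged φ t ht = φ t ht' := by
  rw [tagged_eq φ t ht t.shape_eq ht', toPt_self, Category.id_comp]

end Tagged
end UnitalCatOperad

namespace IOp
variable {C : ℕ → Type u} [∀ n, Category.{v} (C n)] {O : UnitalCatOperad C} {K : TreeClass}
  {X Y Z W : ℕ → Type} {n : ℕ} (A B : IOp K O)

/-- The structure map of `A` at a tree of the class `K`. -/
def strPt (t : OTree Pt n) (ht : K.mem n t) : O.ev t (fun k _ => A.obj k) ⟶ A.obj n :=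
  A.str ⟨t, ht⟩

/-- The composition of `A` along a tree with arbitrary tags. -/
def strT (Q : OTree Y n) (hQ : K.mem n Q.shape) : O.ev Q (fun k _ => A.obj k) ⟶ A.obj n :=
  tagged A.strPt Q hQ

theorem strT_pt (t : OTree Pt n) (ht : K.mem n t.shape) (ht' : K.mem n t) :
    A.strT t ht = A.strPt t ht' := tagged_pt A.strPt t ht ht'

theorem toPt_strT (Q : OTree Y n) {t : OTree Pt n} (h : Q.shape = t) (hQ : K.mem n Q.shape)
    (ht : K.mem n t.shape) : O.toPt Q h A.obj ≫ A.strT t ht = A.strT Q hQ :=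
  toPt_tagged A.strPt Q h hQ ht

theorem strT_corolla (y : Y n) :
    A.strT (OTree.corolla y) (K.mem_corolla y) = O.evCorolla y fun k _ => A.obj k := by
  rw [strT, tagged_eq A.strPt (OTree.corolla y) (K.mem_corolla y)
    (t := OTree.corolla PUnit.unit) rfl (K.corolla_mem n)]
  refine (congrArg (O.toPt (OTree.corolla y) _ A.obj ≫ ·) (A.str_corolla n)).trans ?_
  exact (congrArg (· ≫ _) ((O.act n).map_id _)).trans (Category.id_comp _)

/-- The axiom `str_subst` speaks of untagged inner trees; forgetting the tags of the `r k y`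
commutes with substitution, which yields the tagged form. -/
theorem strT_subst (Q : OTree Y n) (r : ∀ k, Y k → OTree Z k) {t : OTree Z n} (h : Q.subst r = t)
    (hQ : K.mem n Q.shape) (hr : ∀ k y, K.mem k (r k y).shape) (ht : K.mem n t.shape) :
    O.evMap Q (fun k y => A.strT (r k y) (hr k y)) ≫ A.strT Q hQ =
      O.cmp Q r h (fun k _ => A.obj k) ≫ A.strT t ht := by
  have H := A.str_subst Q (fun k y => ⟨(r k y).shape, hr k y⟩) hQ
  rw [Functor.map_comp, Category.assoc] at H
  have hs := K.subst_mem Q (fun k y => (r k y).shape) hQ hr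
  have e : t.shape = Q.subst fun k y => (r k y).shape := by
    rw [← h, OTree.shape, OTree.map_subst]
    rfl
  have H' : O.evMap Q (fun k y => A.strPt (r k y).shape (hr k y)) ≫ A.strT Q hQ =
      O.cmp Q (fun k y => (r k y).shape) rfl (fun k _ => A.obj k) ≫ A.strPt _ hs := H
  have e1 := O.cmp_toPt Q (r := r) (r' := fun k y => (r k y).shape) (fun _ _ => rfl) h
    rfl e A.obj
  have e2 : (fun k y => A.strT (r k y) (hr k y)) =
      fun k y => O.toPt (r k y) rfl A.obj ≫ A.strPt (r k y).shape (hr k y) := rfl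
  rw [e2, ← evMap_comp, Category.assoc, H', ← Category.assoc, e1, Category.assoc, strT,
    tagged_eq A.strPt t ht e hs]

variable {A B}

theorem strT_hom (f : A ⟶ B) (Q : OTree Y n) (hQ : K.mem n Q.shape) :
    A.strT Q hQ ≫ f.hom n = O.evMap Q (fun k _ => f.hom k) ≫ B.strT Q hQ := by
  have H : A.strPt Q.shape hQ ≫ f.hom n =
      O.evMap Q.shape (fun k _ => f.hom k) ≫ B.strPt Q.shape hQ := f.comm _
  rw [strT, strT, tagged, tagged, Category.assoc, H, reassoc_of% O.evMap_toPt]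

end IOp
end FreeOp

/-! ### The free operad for a larger class of trees, built from generators. -/

namespace FreeOp

/-- Trees of the class `K` with tags in `Z`. -/
abbrev TreeClass.TreesOn (K : TreeClass) (Z : ℕ → Type) (k : ℕ) : Type :=
  {t : OTree Z k // K.mem k t.shape}

/-- A family of trees in `K'` such that every tree in `K'` results in a unique way by substituting
trees in `K` into a member of the family. -/
structure Generators (K K' : TreeClass) where
  Idx : ℕ → Type
  tree : ∀ n, Idx n → OTree Pt n
  mem : ∀ n i, K'.mem n (tree n i)
  exists_fact : ∀ {n : ℕ} (t : OTree Pt n), K'.mem n t →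
    ∃ (i : Idx n) (Q : OTree (K.TreesOn Pt) n), Q.shape = tree n i ∧ Q.subst (fun _ y => y.1) = t
  unique : ∀ {n : ℕ} (Q Q' : OTree (K.TreesOn Pt) n) (i i' : Idx n), Q.shape = tree n i →
    Q'.shape = tree n i' → Q.subst (fun _ y => y.1) = Q'.subst (fun _ y => y.1) → Q = Q' ∧ i = i'

theorem OTree.map_eq_corolla {X Y : ℕ → Type} {n : ℕ} {f : ∀ k, X k → Y k} {t : OTree X n}
    {y : Y n} (h : t.map f = OTree.corolla y) : ∃ x, t = OTree.corolla x ∧ f n x = y := by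
  obtain ⟨x, ts, h1, h2, h3⟩ := Tr.map_eq_node (congrArg OTree.tree h)
  refine ⟨x, OTree.ext (h1.trans ?_), h2⟩
  exact congrArg _ (funext fun i => Tr.map_eq_leaf (h3 i))

/-- Composition along any tree preserves coproducts of objects at its vertices. -/
def UnitalCatOperad.AllDistributive {C : ℕ → Type u} [∀ n, Category.{v} (C n)]
    (O : UnitalCatOperad C) : Prop :=
  ∀ (n : ℕ) (t : OTree Pt n), O.Distributive t

namespace Generators
variable {K K' : TreeClass} (Γ : Generators K K')

/-- Factor the shape of `t` and lift the tags of `t` through this substitution. -/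
theorem exists_fact_tagged {Z : ℕ → Type} {n : ℕ} (t : OTree Z n) (ht : K'.mem n t.shape) :
    ∃ (i : Γ.Idx n) (Q : OTree (K.TreesOn Z) n), Q.shape = Γ.tree n i ∧
      Q.subst (fun _ y => y.1) = t := by
  obtain ⟨i, Q, h1, h2⟩ := Γ.exists_fact t.shape ht
  obtain ⟨R, h3, h4⟩ := OTree.exists_subst_lift (fun k (_ : Z k) => PUnit.unit)
    (fun k (y : K.TreesOn Pt k) => y.1) Q t h2.symm
  have hm : ∀ k (p : Deco (fun k (_ : Z k) => PUnit.unit)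
      (fun k (y : K.TreesOn Pt k) => y.1) k), K.mem k p.2.1.shape := by
    rintro k ⟨y, s, hs⟩
    have : s.shape = y.1 := hs
    rw [this, ← y.1.shape_eq]
    exact y.2
  refine ⟨i, R.map fun k p => ⟨p.2.1, hm k p⟩, ?_, ?_⟩
  · rw [← h1, ← h3]
    simp only [OTree.shape, OTree.map_map]
    exact OTree.map_map _ _ R
  · rw [OTree.subst_map]
    exact h4

variable {C : ℕ → Type u} [∀ n, Category.{v} (C n)] [∀ n, HasColimits (C n)]
  {O : UnitalCatOperad C} (A : IOp K O) {n : ℕ} {X Y Z W : ℕ → Type}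

/-- The coproduct of the composites of `A` along the generators. -/
noncomputable def freeObj (n : ℕ) : C n :=
  (exists_isCoprod fun i : Γ.Idx n => O.ev (Γ.tree n i) fun k _ => A.obj k).choose

noncomputable def incl (n : ℕ) (i : Γ.Idx n) :
    O.ev (Γ.tree n i) (fun k _ => A.obj k) ⟶ Γ.freeObj A n :=
  (exists_isCoprod fun i : Γ.Idx n => O.ev (Γ.tree n i) fun k _ => A.obj k).choose_spec.choose i

theorem isCoprod_incl (n : ℕ) : IsCoprod (Γ.incl A n) :=
  (exists_isCoprod fun i : Γ.Idx n =>
    O.ev (Γ.tree n i) fun k _ => A.obj k).choose_spec.choose_spec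

/-- The map goes backwards along the composition isomorphism of a chosen factorization of `t`;
`lamPt_fact` shows that the choice does not matter. -/
noncomputable def lamPt (t : OTree Pt n) (ht : K'.mem n t) :
    O.ev t (fun k _ => A.obj k) ⟶ Γ.freeObj A n :=
  have h := (Γ.exists_fact t ht).choose_spec
  inv (O.cmp h.choose (fun _ y => y.1) h.choose_spec.2 fun k _ => A.obj k) ≫
    O.evMap h.choose (fun _ y => A.strT y.1 y.2) ≫
    O.toPt h.choose h.choose_spec.1 A.obj ≫ Γ.incl A n _

/-- The universal map from the composite of `A` along a tree in `K'` to the free operad. -/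
noncomputable def lam (t : OTree Z n) (ht : K'.mem n t.shape) :
    O.ev t (fun k _ => A.obj k) ⟶ Γ.freeObj A n :=
  tagged (Γ.lamPt A) t ht

theorem toPt_lam (Q : OTree Y n) {t : OTree Pt n} (h : Q.shape = t) (hQ : K'.mem n Q.shape)
    (ht : K'.mem n t.shape) : O.toPt Q h A.obj ≫ Γ.lam A t ht = Γ.lam A Q hQ :=
  toPt_tagged (Γ.lamPt A) Q h hQ ht

/-- Independence of the chosen factorization, which is exactly the uniqueness clause of
`Generators`. -/
theorem lamPt_fact {t : OTree Pt n} (ht : K'.mem n t) (Q : OTree (K.TreesOn Pt) n)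
    (h : Q.subst (fun _ y => y.1) = t) (i : Γ.Idx n) (hi : Q.shape = Γ.tree n i) :
    O.cmp Q (fun _ y => y.1) h (fun k _ => A.obj k) ≫ Γ.lamPt A t ht =
      O.evMap Q (fun _ y => A.strT y.1 y.2) ≫ O.toPt Q hi A.obj ≫ Γ.incl A n i := by
  have hc := (Γ.exists_fact t ht).choose_spec
  obtain ⟨e1, e2⟩ := Γ.unique Q _ i _ hi hc.choose_spec.1 (h.trans hc.choose_spec.2.symm)
  -- The chosen factorization is replaced by variables, so that the two equalities can be
  -- substituted although proofs depend on its components.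
  have key : ∀ (Q' : OTree (K.TreesOn Pt) n) (h' : Q'.subst (fun _ y => y.1) = t) (i' : Γ.Idx n)
      (hi' : Q'.shape = Γ.tree n i') (_ : Q = Q') (_ : i = i'),
      O.cmp Q (fun _ y => y.1) h (fun k _ => A.obj k) ≫
        inv (O.cmp Q' (fun _ y => y.1) h' fun k _ => A.obj k) ≫
        O.evMap Q' (fun _ y => A.strT y.1 y.2) ≫ O.toPt Q' hi' A.obj ≫ Γ.incl A n i' =
      O.evMap Q (fun _ y => A.strT y.1 y.2) ≫ O.toPt Q hi A.obj ≫ Γ.incl A n i := by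
    rintro Q' h' i' hi' rfl rfl
    rw [IsIso.hom_inv_id_assoc]
  exact key _ _ _ _ e1 e2

/-- Tag every vertex of `Q` by the shape of the tree put into it; this reduces to `lamPt_fact`. -/
theorem lam_fact {t : OTree Z n} (ht : K'.mem n t.shape) (Q : OTree Y n)
    (r : ∀ k, Y k → OTree Z k) (hr : ∀ k y, K.mem k (r k y).shape)
    (h : Q.subst r = t) (i : Γ.Idx n) (hi : Q.shape = Γ.tree n i) :
    O.cmp Q r h (fun k _ => A.obj k) ≫ Γ.lam A t ht =
      O.evMap Q (fun k y => A.strT (r k y) (hr k y)) ≫ O.toPt Q hi A.obj ≫ Γ.incl A n i := by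
  let f : ∀ k, Y k → K.TreesOn Pt k := fun k y => ⟨(r k y).shape, by
    rw [OTree.shape_eq]; exact hr k y⟩
  have hf : ∀ k y, (r k y).shape = (f k y).1 := fun _ _ => rfl
  have e : Q.subst (fun k y => (f k y).1) = t.shape := by
    rw [← h, OTree.shape, OTree.map_subst]
    rfl
  have e' : (Q.map f).subst (fun _ y => y.1) = t.shape := by rw [OTree.subst_map, e]
  have hi' : (Q.map f).shape = Γ.tree n i := by
    rw [← hi]
    exact OTree.map_map _ _ Q
  have h1 := Γ.lamPt_fact A ht (Q.map f) e' i hi'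
  have h2 := O.cmp_toPt Q hf h e rfl A.obj
  have h3 := O.retag_cmp f (rfl : Q.map f = Q.map f) (fun _ y => y.1) e' e (fun k _ => A.obj k)
  have h4 := O.evMap_retag f (rfl : Q.map f = Q.map f) (fun _ y => A.strT y.1 y.2)
  have h5 := O.retag_toPt f (rfl : Q.map f = Q.map f) hi hi' A.obj
  rw [lam, tagged, ← Category.assoc, ← h2, ← h3]
  simp only [Category.assoc]
  rw [h1, ← h5, ← reassoc_of% h4, evMap_comp_assoc]
  have h6 : (fun k y => O.toPt (r k y) (hf k y) A.obj ≫ A.strT (f k y).1 (f k y).2) =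
      fun k y => A.strT (r k y) (hr k y) :=
    funext fun k => funext fun y => A.toPt_strT (r k y) (hf k y) (hr k y) (f k y).2
  rw [h6, Category.assoc]

/-- Substituting trees of `K` into the `K`-pieces of a factorization of `t` gives a factorization of
the result with the same generator. So the claim reduces to associativity of `A` on the pieces. -/
theorem lam_subst (t : OTree Z n) (r : ∀ k, Z k → OTree W k) {s : OTree W n} (h : t.subst r = s)
    (ht : K'.mem n t.shape) (hr : ∀ k z, K.mem k (r k z).shape) (hs : K'.mem n s.shape) :
    O.evMap t (fun k z => A.strT (r k z) (hr k z)) ≫ Γ.lam A t ht =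
      O.cmp t r h (fun k _ => A.obj k) ≫ Γ.lam A s hs := by
  obtain ⟨i, Q, hi, rfl⟩ := Γ.exists_fact_tagged t ht
  have hm : ∀ k (y : K.TreesOn Z k), K.mem k (y.1.subst r).shape := fun k y =>
    K.mem_subst y.2 hr rfl
  have e : Q.subst (fun k y => y.1.subst r) = s := by
    rw [← h, OTree.subst_subst]
  rw [← cancel_epi (O.cmp Q (fun _ y => y.1) rfl _), ← O.cmp_natural_assoc,
    Γ.lam_fact A ht Q (fun _ y => y.1) (fun _ y => y.2) rfl i hi,
    O.cmp_cmp_assoc Q (fun _ y => y.1) rfl r h _ (fun _ _ => rfl) e,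
    Γ.lam_fact A hs Q _ hm e i hi, evMap_comp_assoc, evMap_comp_assoc]
  simp only [A.strT_subst _ r rfl _ hr (hm _ _)]

theorem mem_subst_tree {R : OTree Γ.Idx n} (hR : K'.mem n R.shape) {s : OTree Pt n}
    (h : R.subst Γ.tree = s) : K'.mem n s.shape :=
  K'.mem_subst hR (fun k i => by rw [OTree.shape_eq]; exact Γ.mem k i) h

/-- By distributivity the source is a coproduct over the decorations of `t` by generators, so a map
may be prescribed on each summand. -/
theorem exists_freeStr (hD : O.AllDistributive)
    (t : OTree Pt n) (ht : K'.mem n t) :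
    ∃ s : O.ev t (fun k _ => Γ.freeObj A k) ⟶ Γ.freeObj A n,
      ∀ R : {R : OTree Γ.Idx n // R.shape = t},
        (O.evMap R.1 (Γ.incl A) ≫ O.toPt R.1 R.2 (Γ.freeObj A)) ≫ s =
          O.cmp R.1 Γ.tree rfl (fun k _ => A.obj k) ≫
            Γ.lam A (R.1.subst Γ.tree) (Γ.mem_subst_tree (R.2.symm ▸ ht) rfl) :=
  (Distributive.isCoprod (hD n t) (Γ.incl A) (Γ.isCoprod_incl A) _ _).exists

/-- The structure maps of the free operad. -/
noncomputable def freeStr (hD : O.AllDistributive)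
    (t : OTree Pt n) (ht : K'.mem n t) :
    O.ev t (fun k _ => Γ.freeObj A k) ⟶ Γ.freeObj A n :=
  (Γ.exists_freeStr A hD t ht).choose

noncomputable def freeStrT (hD : O.AllDistributive)
    (Q : OTree Y n) (hQ : K'.mem n Q.shape) :
    O.ev Q (fun k _ => Γ.freeObj A k) ⟶ Γ.freeObj A n :=
  tagged (Γ.freeStr A hD) Q hQ

theorem incl_freeStrT (hD : O.AllDistributive)
    (R : OTree Γ.Idx n) (hR : K'.mem n R.shape) {s : OTree Pt n}
    (h : R.subst Γ.tree = s) (hs : K'.mem n s.shape) :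
    O.evMap R (Γ.incl A) ≫ Γ.freeStrT A hD R hR =
      O.cmp R Γ.tree h (fun k _ => A.obj k) ≫ Γ.lam A s hs := by
  subst h
  have := (Γ.exists_freeStr A hD R.shape hR).choose_spec ⟨R, rfl⟩
  rw [Category.assoc] at this
  exact this

theorem free_hom_ext (hD : O.AllDistributive)
    (t : OTree Pt n) {B : C n} {f g : O.ev t (fun k _ => Γ.freeObj A k) ⟶ B}
    (h : ∀ (R : OTree Γ.Idx n) (hR : R.shape = t),
      O.evMap R (Γ.incl A) ≫ O.toPt R hR (Γ.freeObj A) ≫ f =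
        O.evMap R (Γ.incl A) ≫ O.toPt R hR (Γ.freeObj A) ≫ g) : f = g :=
  (Distributive.isCoprod (hD n t) (Γ.incl A) (Γ.isCoprod_incl A)).hom_ext fun R => by
    rw [Category.assoc, Category.assoc]
    exact h R.1 R.2

/-- Extends the defining property of the structure maps from generators at the vertices of `Q` to
arbitrary trees of `K'`. Factoring each of them leaves a decoration of `Q` by generators, where
`incl_freeStrT` applies; the `K`-pieces are absorbed by `lam_subst`. -/
theorem lam_freeStrT (hD : O.AllDistributive)
    (Q : OTree Y n) (s : ∀ k, Y k → OTree Z k) {t : OTree Z n}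
    (h : Q.subst s = t) (hQ : K'.mem n Q.shape) (hs : ∀ k y, K'.mem k (s k y).shape)
    (ht : K'.mem n t.shape) :
    O.evMap Q (fun k y => Γ.lam A (s k y) (hs k y)) ≫ Γ.freeStrT A hD Q hQ =
      O.cmp Q s h (fun k _ => A.obj k) ≫ Γ.lam A t ht := by
  choose i q hi hq using fun k y => Γ.exists_fact_tagged (s k y) (hs k y)
  have hqm : K'.mem n (Q.subst q).shape := K'.mem_subst hQ (fun k y => by
    rw [hi k y]; exact Γ.mem k _) rfl
  have e : (Q.subst q).subst (fun _ y => y.1) = t := by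
    rw [OTree.subst_subst, ← h]
    exact congrArg (fun r => OTree.subst r Q) (funext fun k => funext fun y => hq k y)
  have ei : (Q.map i).subst Γ.tree = (Q.subst q).shape := by
    rw [OTree.subst_map, OTree.shape, OTree.map_subst]
    exact congrArg (fun r => OTree.subst r Q) (funext fun k => funext fun y => (hi k y).symm)
  have ei' : Q.subst (fun k y => Γ.tree k (i k y)) = (Q.subst q).shape := by
    rw [← ei, OTree.subst_map]
  have hi' : K'.mem n (Q.map i).shape := K'.mem_map hQ rfl
  have hsh : K'.mem n (Q.subst q).shape.shape := by rw [OTree.shape_eq]; exact hqm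
  rw [← cancel_epi (O.evMap Q fun k y => O.cmp (q k y) (fun _ y => y.1) (hq k y) _),
    evMap_comp_assoc, ← O.cmp_cmp_assoc Q q rfl (fun _ y => y.1) e s hq h,
    ← Γ.lam_subst A _ (fun _ y => y.1) e hqm (fun _ y => y.2) ht]
  have h1 : ∀ k y, O.cmp (q k y) (fun _ y => y.1) (hq k y) (fun k _ => A.obj k) ≫
      Γ.lam A (s k y) (hs k y) =
      O.evMap (q k y) (fun _ y => A.strT y.1 y.2) ≫ O.toPt (q k y) (hi k y) A.obj ≫
        Γ.incl A k (i k y) := fun k y => Γ.lam_fact A (hs k y) _ _ (fun _ y => y.2) (hq k y) _ _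
  simp only [h1]
  have h2 := O.retag_cmp i (rfl : Q.map i = Q.map i) Γ.tree ei ei' (fun k _ => A.obj k)
  have h3 := O.evMap_retag i (rfl : Q.map i = Q.map i) (Γ.incl A)
  have h4 : O.retag i (rfl : Q.map i = Q.map i) (fun k _ => Γ.freeObj A k) ≫
      Γ.freeStrT A hD (Q.map i) hi' = Γ.freeStrT A hD Q hQ := retag_tagged _ _ _ _ _
  have h5 := O.cmp_toPt Q hi (rfl : _ = Q.subst q) ei' rfl A.obj
  rw [← h4, ← evMap_comp_assoc, ← evMap_comp_assoc, reassoc_of% h3,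
    Γ.incl_freeStrT A hD (Q.map i) hi' ei hsh, reassoc_of% h2, reassoc_of% h5,
    O.cmp_natural_assoc, Γ.toPt_lam A _ rfl hqm hsh]

theorem toPt_freeStrT (hD : O.AllDistributive) (Q : OTree Y n) {t : OTree Pt n}
    (h : Q.shape = t) (hQ : K'.mem n Q.shape) (ht : K'.mem n t) :
    O.toPt Q h (Γ.freeObj A) ≫ Γ.freeStr A hD t ht = Γ.freeStrT A hD Q hQ :=
  (tagged_eq _ Q hQ h ht).symm

/-- A generator factors through itself with a corolla at every vertex, and composition of `A` along
a corolla is the unit isomorphism. -/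
theorem lam_tree (i : Γ.Idx n) (hi : K'.mem n (Γ.tree n i).shape) :
    Γ.lam A (Γ.tree n i) hi = Γ.incl A n i := by
  have e : (Γ.tree n i).subst (fun _ y => OTree.corolla y) = Γ.tree n i := OTree.subst_corolla _
  have h := Γ.lam_fact A hi (Γ.tree n i) (fun _ y => OTree.corolla y)
    (fun k y => K.mem_corolla y) e i (OTree.shape_eq _)
  simp only [IOp.strT_corolla] at h
  rw [O.cmp_corolla_right _ (fun _ y => y) e (OTree.map_id _), retag_id, Category.comp_id,
    toPt_self, Category.id_comp] at h
  exact (cancel_epi _).1 h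

theorem freeStr_corolla (hD : O.AllDistributive) (n : ℕ) :
    Γ.freeStr A hD (OTree.corolla (PUnit.unit : Pt n)) (K'.corolla_mem n) =
      O.evCorolla (PUnit.unit : Pt n) fun k _ => Γ.freeObj A k := by
  refine Γ.free_hom_ext A hD _ fun R hR => ?_
  obtain ⟨i, rfl, -⟩ := OTree.map_eq_corolla hR
  have e : (OTree.corolla i).subst Γ.tree = Γ.tree n i := OTree.corolla_subst _ _
  have hi : K'.mem n (Γ.tree n i).shape := by rw [OTree.shape_eq]; exact Γ.mem n i
  rw [Γ.toPt_freeStrT A hD _ hR (K'.mem_corolla i), Γ.incl_freeStrT A hD _ _ e hi,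
    O.cmp_corolla_left, Γ.lam_tree]
  refine (O.evCorolla_natural i (Γ.incl A)).symm.trans (congrArg _ ?_)
  exact ((congrArg (· ≫ _) ((O.act n).map_id _)).trans (Category.id_comp _)).symm

/-- Checked on the summands of the composite along `t`. A decoration of `t` by generators lifts to a
decoration of `Q` by decorated trees `r k y`, and both sides then become composition along the total
tree followed by `lam`. -/
theorem freeStr_subst (hD : O.AllDistributive) (Q : OTree Y n) (r : ∀ k, Y k → OTree Pt k)
    {t : OTree Pt n} (h : Q.subst r = t) (hQ : K'.mem n Q.shape) (hr : ∀ k y, K'.mem k (r k y))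
    (ht : K'.mem n t) :
    O.evMap Q (fun k y => Γ.freeStr A hD (r k y) (hr k y)) ≫ Γ.freeStrT A hD Q hQ =
      O.cmp Q r h (fun k _ => Γ.freeObj A k) ≫ Γ.freeStr A hD t ht := by
  -- The composition isomorphism is moved to the other side so that the source is the composite
  -- along `t`, where maps are determined on summands.
  rw [← cancel_epi (inv (O.cmp Q r h fun k _ => Γ.freeObj A k)), IsIso.inv_hom_id_assoc]
  refine Γ.free_hom_ext A hD _ fun R hR => ?_
  obtain ⟨R', hR', hsub⟩ := OTree.exists_subst_lift (fun k (_ : Γ.Idx k) => PUnit.unit) r Q R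
    (hR.trans h.symm)
  let D := Deco (fun k (_ : Γ.Idx k) => PUnit.unit) r
  have hsh : ∀ k (p : D k), p.2.1.shape = r k p.1 := fun k p => p.2.2
  have hm : ∀ k (p : D k), K'.mem k p.2.1.shape := fun k p => by rw [hsh]; exact hr _ _
  have hRm : K'.mem n R.shape := hR ▸ ht
  have hR'm : K'.mem n R'.shape := by
    have : R'.shape = Q.shape := by
      rw [← hR']
      simp only [OTree.shape, OTree.map_map]
    rw [this]
    exact hQ
  have hs : ∀ k (p : D k), K'.mem k (p.2.1.subst Γ.tree).shape := fun k p =>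
    Γ.mem_subst_tree (hm k p) rfl
  have e : R'.subst (fun k (p : D k) => p.2.1.subst Γ.tree) = R.subst Γ.tree := by
    rw [← hsub, OTree.subst_subst]
  have hm' := Γ.mem_subst_tree hRm rfl
  have e1 : R'.subst (fun k (p : D k) => r k p.1) = t := by
    rw [← h, ← hR', OTree.subst_map]
  have h1 := O.cmp_toPt R' hsh hsub e1 hR (Γ.freeObj A)
  have h2 := O.retag_cmp (fun _ (p : D _) => p.1) hR' r h e1 (fun k _ => Γ.freeObj A k)
  have h3 := O.evMap_retag (fun _ (p : D _) => p.1) hR'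
    (fun k y => Γ.freeStr A hD (r k y) (hr k y))
  have h4 : O.retag (fun _ (p : D _) => p.1) hR' (fun k _ => Γ.freeObj A k) ≫
      Γ.freeStrT A hD Q hQ = Γ.freeStrT A hD R' hR'm := retag_tagged _ _ _ _ _
  rw [← cancel_epi (O.cmp R' (fun _ (p : D _) => p.2.1) hsub _),
    Γ.toPt_freeStrT A hD R hR hRm ht, Γ.incl_freeStrT A hD R hRm rfl hm',
    O.cmp_cmp_assoc R' _ hsub Γ.tree rfl _ (fun _ _ => rfl) e,
    ← Γ.lam_freeStrT A hD R' _ e hR'm hs, ← O.cmp_natural_assoc, ← reassoc_of% h1,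
    ← reassoc_of% h2, IsIso.hom_inv_id_assoc, ← reassoc_of% h3, h4]
  simp only [evMap_comp_assoc]
  refine congrArg (· ≫ _) (congrArg (O.evMap R') (funext fun k => funext fun p => ?_))
  rw [Γ.toPt_freeStrT A hD p.2.1 (hsh k p) (hm k p), Γ.incl_freeStrT A hD _ (hm k p) rfl (hs k p)]

/-- The free operad of the class `K'` on an operad of the class `K`. -/
noncomputable def free (hD : O.AllDistributive) : IOp K' O where
  obj := Γ.freeObj A
  str t := Γ.freeStr A hD t.1 t.2
  str_corolla n := Γ.freeStr_corolla A hD n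
  str_subst Q r hQ := by
    refine (congrArg (· ≫ _) ((O.act _).map_comp _ _)).trans ((Category.assoc _ _ _).trans ?_)
    exact Γ.freeStr_subst A hD Q (fun k y => (r k y).1) rfl hQ (fun k y => (r k y).2) _

variable (hK : K ≤ K') (hD : O.AllDistributive)

/-- The components of the unit. -/
noncomputable def unitHom (n : ℕ) : A.obj n ⟶ Γ.freeObj A n :=
  inv (O.evCorolla (PUnit.unit : Pt n) fun k _ => A.obj k) ≫
    Γ.lam A (OTree.corolla (X := Pt) PUnit.unit) (K'.mem_corolla (Y := Pt) PUnit.unit)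

theorem evCorolla_unitHom (y : Y n) :
    O.evCorolla y (fun k _ => A.obj k) ≫ Γ.unitHom A n =
      Γ.lam A (OTree.corolla y) (K'.mem_corolla y) := by
  have h : (OTree.corolla y).shape = OTree.corolla (X := Pt) PUnit.unit := rfl
  have e : O.evCorolla y (fun k _ => A.obj k) =
      O.toPt _ h A.obj ≫ O.evCorolla (PUnit.unit : Pt n) fun k _ => A.obj k :=
    ((congrArg (· ≫ _) ((O.act n).map_id _)).trans (Category.id_comp _)).symm
  rw [e, unitHom, Category.assoc, IsIso.hom_inv_id_assoc,
    Γ.toPt_lam A _ h (K'.mem_corolla y)]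

/-- A tree is itself with corollas substituted, so `lam` is the unit at all vertices followed by
composition in the free operad. This identifies the coprojections with the maps in the final
statement. -/
theorem evMap_unitHom (Q : OTree Y n) (hQ : K'.mem n Q.shape) :
    O.evMap Q (fun k _ => Γ.unitHom A k) ≫ Γ.freeStrT A hD Q hQ = Γ.lam A Q hQ := by
  have e : Q.subst (fun _ y => OTree.corolla y) = Q := OTree.subst_corolla Q
  rw [← cancel_epi (O.evMap Q fun _ y => O.evCorolla y fun k _ => A.obj k), evMap_comp_assoc]
  simp only [evCorolla_unitHom]
  rw [Γ.lam_freeStrT A hD Q _ e hQ (fun k y => K'.mem_corolla y) hQ,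
    O.cmp_corolla_right _ (fun _ y => y) e (OTree.map_id _), retag_id, Category.comp_id]

/-- View `Q` as a tree of `K` put into a corolla and apply `lam_subst`; this is what makes the unit
a morphism of `K`-operads. -/
theorem str_unitHom (Q : OTree Y n) (hQ : K.mem n Q.shape) :
    A.strT Q hQ ≫ Γ.unitHom A n = Γ.lam A Q (hK _ _ hQ) := by
  have e : (OTree.corolla (X := K.TreesOn Y) ⟨Q, hQ⟩).subst (fun _ y => y.1) = Q :=
    OTree.corolla_subst _ _
  have h := Γ.lam_subst A (OTree.corolla (X := K.TreesOn Y) ⟨Q, hQ⟩) (fun k (y : K.TreesOn Y k) => y.1) e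
    (K'.mem_corolla _) (fun _ y => y.2) (hK _ _ hQ)
  rw [← Γ.evCorolla_unitHom A, O.cmp_corolla_left, O.evCorolla_natural_assoc] at h
  exact (cancel_epi _).1 h

/-- The unit of the adjunction. -/
noncomputable def unit : A ⟶ (IOp.restrict hK O).obj (Γ.free A hD) where
  hom := Γ.unitHom A
  comm := fun {n} t => by
    obtain ⟨t, ht⟩ := t
    have h1 : K.mem n t.shape := t.shape_eq.symm ▸ ht
    have h2 := Γ.str_unitHom A hK t h1
    rw [A.strT_pt t h1 ht, ← Γ.evMap_unitHom A hD t] at h2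
    refine h2.trans (congrArg (_ ≫ ·) ?_)
    exact tagged_pt (Γ.freeStr A hD) t _ (hK _ _ ht)

variable {A} {B : IOp K' O} (θ : ∀ k, A.obj k ⟶ B.obj k)

/-- The map out of the free operad that is induced by a map of collections. -/
noncomputable def descHom (n : ℕ) : Γ.freeObj A n ⟶ B.obj n :=
  (Γ.isCoprod_incl A n (B.obj n) fun i =>
    O.evMap (Γ.tree n i) (fun k _ => θ k) ≫ B.strPt (Γ.tree n i) (Γ.mem n i)).choose

theorem incl_descHom (n : ℕ) (i : Γ.Idx n) : Γ.incl A n i ≫ Γ.descHom θ n =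
    O.evMap (Γ.tree n i) (fun k _ => θ k) ≫ B.strPt (Γ.tree n i) (Γ.mem n i) :=
  (Γ.isCoprod_incl A n (B.obj n) fun i => O.evMap (Γ.tree n i) (fun k _ => θ k) ≫
    B.strPt (Γ.tree n i) (Γ.mem n i)).choose_spec.1 i

variable (hθ : ∀ {Y : ℕ → Type} {n : ℕ} (Q : OTree Y n) (hQ : K.mem n Q.shape),
  A.strT Q hQ ≫ θ n = O.evMap Q (fun k _ => θ k) ≫ B.strT Q (hK _ _ hQ))

-- The hypothesis `hθ` says that `θ` is a morphism of `K`-operads; it moves `θ` past the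
-- compositions along the `K`-pieces of a factorization of `Q`, and the generator is handled by the
-- definition of `descHom`.
include hθ in
theorem lam_descHom (Q : OTree Y n) (hQ : K'.mem n Q.shape) :
    Γ.lam A Q hQ ≫ Γ.descHom θ n = O.evMap Q (fun k _ => θ k) ≫ B.strT Q hQ := by
  obtain ⟨i, q, hi, rfl⟩ := Γ.exists_fact_tagged Q hQ
  have hq : K'.mem n q.shape := hi ▸ Γ.mem n i
  have hi' : K'.mem n (Γ.tree n i).shape := by rw [OTree.shape_eq]; exact Γ.mem n i
  have h1 := Γ.lam_fact A hQ q (fun _ y => y.1) (fun _ y => y.2) rfl i hi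
  have h2 := B.strT_subst q (fun _ y => y.1) rfl hq (fun _ y => hK _ _ y.2) hQ
  have h3 := B.toPt_strT q hi hq hi'
  rw [B.strT_pt _ hi' (Γ.mem n i)] at h3
  have h5 := O.evMap_toPt hi θ
  rw [← cancel_epi (O.cmp q (fun _ y => y.1) rfl fun k _ => A.obj k), reassoc_of% h1,
    incl_descHom, ← O.cmp_natural_assoc, ← h2, ← reassoc_of% h5, h3, evMap_comp_assoc,
    evMap_comp_assoc]
  simp only [hθ]

-- On a summand the left side is `lam` of the total tree, so `lam_descHom` and associativity of `B`
-- apply.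
include hθ in
theorem descHom_comm (t : OTree Pt n) (ht : K'.mem n t) :
    Γ.freeStr A hD t ht ≫ Γ.descHom θ n =
      O.evMap t (fun k _ => Γ.descHom θ k) ≫ B.strPt t ht := by
  refine Γ.free_hom_ext A hD t fun R hR => ?_
  have hRm : K'.mem n R.shape := hR ▸ ht
  have hm := Γ.mem_subst_tree hRm rfl
  have h4 := O.evMap_toPt hR (A := Γ.freeObj A) (B := B.obj) (Γ.descHom θ)
  have ht' : K'.mem n t.shape := t.shape_eq.symm ▸ ht
  have h5 := B.toPt_strT R hR hRm ht'
  rw [B.strT_pt t ht' ht] at h5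
  have hm' : ∀ k i, K'.mem k (Γ.tree k i).shape := fun k i =>
    (Γ.tree k i).shape_eq.symm ▸ Γ.mem k i
  have h6 := B.strT_subst R Γ.tree rfl hRm hm' hm
  rw [← Category.assoc (O.toPt _ _ _), Γ.toPt_freeStrT A hD R hR hRm ht,
    reassoc_of% Γ.incl_freeStrT A hD R hRm rfl hm, Γ.lam_descHom hK θ hθ _ hm, ← reassoc_of% h4, h5,
    evMap_comp_assoc, ← O.cmp_natural_assoc, ← h6, evMap_comp_assoc]
  refine congrArg (· ≫ _) (congrArg (O.evMap R) (funext fun k => funext fun i => ?_))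
  rw [incl_descHom, B.strT_pt _ (hm' k i) (Γ.mem k i)]

include hK hθ in
theorem unitHom_descHom (n : ℕ) : Γ.unitHom A n ≫ Γ.descHom θ n = θ n := by
  rw [unitHom, Category.assoc, Γ.lam_descHom hK θ hθ, IOp.strT_corolla,
    O.evCorolla_natural (Y := Pt) PUnit.unit (fun k _ => θ k), IsIso.inv_hom_id_assoc]

/-- A coprojection is the unit at the vertices of a generator followed by composition, and morphisms
commute with composition; hence they are determined by their restriction along the unit. -/
theorem hom_ext {f g : Γ.free A hD ⟶ B} (h : ∀ n, Γ.unitHom A n ≫ f.hom n = Γ.unitHom A n ≫ g.hom n) :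
    f = g := by
  refine IOp.Hom.ext (funext fun n => (Γ.isCoprod_incl A n).hom_ext fun i => ?_)
  have hi : K'.mem n (Γ.tree n i).shape := (Γ.tree n i).shape_eq.symm ▸ Γ.mem n i
  have key : ∀ f : Γ.free A hD ⟶ B, Γ.incl A n i ≫ f.hom n =
      O.evMap (Γ.tree n i) (fun k _ => Γ.unitHom A k ≫ f.hom k) ≫ B.strT (Γ.tree n i) hi := by
    intro f
    have h1 : Γ.freeStrT A hD (Γ.tree n i) hi ≫ f.hom n = _ := IOp.strT_hom f (Γ.tree n i) hi
    rw [← Γ.lam_tree A i hi, ← Γ.evMap_unitHom A hD]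
    refine (Category.assoc _ _ _).trans ((congrArg (_ ≫ ·) h1).trans ?_)
    exact O.evMap_comp_assoc _ _ _ _
  rw [key f, key g]
  simp only [h]

/-- The universal property of the free operad. -/
noncomputable def homEquiv (A : IOp K O) (B : IOp K' O) :
    (Γ.free A hD ⟶ B) ≃ (A ⟶ (IOp.restrict hK O).obj B) where
  toFun f := Γ.unit A hK hD ≫ (IOp.restrict hK O).map f
  invFun f := ⟨Γ.descHom f.hom, fun t =>
    Γ.descHom_comm hK hD f.hom (fun Q hQ => IOp.strT_hom f Q hQ) t.1 t.2⟩
  left_inv f := Γ.hom_ext hD fun n => Γ.unitHom_descHom hK _ (fun Q hQ => IOp.strT_hom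
    (Γ.unit A hK hD ≫ (IOp.restrict hK O).map f) Q hQ) n
  right_inv f := IOp.Hom.ext (funext fun n => Γ.unitHom_descHom hK _
    (fun Q hQ => IOp.strT_hom f Q hQ) n)

theorem homEquiv_naturality (A : IOp K O) (B B' : IOp K' O) (g : B ⟶ B') (h : Γ.free A hD ⟶ B) :
    Γ.homEquiv hK hD A B' (h ≫ g) = Γ.homEquiv hK hD A B h ≫ (IOp.restrict hK O).map g :=
  (congrArg (Γ.unit A hK hD ≫ ·) ((IOp.restrict hK O).map_comp h g)).trans
    (Category.assoc _ _ _).symm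

noncomputable def leftAdjoint : IOp K O ⥤ IOp K' O :=
  Adjunction.leftAdjointOfEquiv (G := IOp.restrict hK O) (Γ.homEquiv hK hD)
    (Γ.homEquiv_naturality hK hD)

noncomputable def adjunction : Γ.leftAdjoint (O := O) hK hD ⊣ IOp.restrict hK O :=
  Adjunction.adjunctionOfEquivLeft (G := IOp.restrict hK O) (Γ.homEquiv hK hD)
    (Γ.homEquiv_naturality hK hD)

theorem adjunction_unit_app (A : IOp K O) :
    (Γ.adjunction hK hD).unit.app A = Γ.unit A hK hD :=
  (Category.comp_id _ : Γ.unit A hK hD ≫ 𝟙 _ = _)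

/-- The composites of the unit, applied at all vertices of a tree, with the composition along it
exhibit the free operad as a coproduct. -/
theorem isCoprod_unit (A : IOp K O) (n : ℕ) : IsCoprod fun i : Γ.Idx n =>
    O.evMap (Γ.tree n i) (fun k _ => Γ.unitHom A k) ≫ Γ.freeStr A hD (Γ.tree n i) (Γ.mem n i) := by
  have := Γ.isCoprod_incl A n
  convert this with i
  have hi : K'.mem n (Γ.tree n i).shape := (Γ.tree n i).shape_eq.symm ▸ Γ.mem n i
  rw [← Γ.lam_tree A i hi, ← Γ.evMap_unitHom A hD, freeStrT, tagged_pt _ _ hi (Γ.mem n i)]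

end Generators
end FreeOp

/-! ### Distributivity for the basic trees and under substitution. -/

namespace FreeOp

section IsCoprod
variable {D : Type u} [Category.{v} D] {ι κ : Type} {G : ι → D} {X : D} {c : ∀ i, G i ⟶ X}

/-- Injectivity of `s` is not required: a family on `κ` pulls back along `s`, and a condition on all
of `κ` may be tested along a surjection. -/
theorem IsCoprod.transport (hc : IsCoprod c) {H : κ → D} {Y : D} {d : ∀ j, H j ⟶ Y} (e : X ⟶ Y)
    (he : IsIso e) (s : ι → κ) (hs : Function.Surjective s) (a : ∀ i, G i ⟶ H (s i))
    (ha : ∀ i, IsIso (a i)) (h : ∀ i, a i ≫ d (s i) = c i ≫ e) : IsCoprod d := by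
  intro Z g
  obtain ⟨f, hf, hu⟩ := hc Z fun i => a i ≫ g (s i)
  have key : ∀ f' : Y ⟶ Z, (∀ j, d j ≫ f' = g j) ↔ ∀ i, c i ≫ e ≫ f' = a i ≫ g (s i) := by
    intro f'
    constructor
    · intro hf' i
      rw [← hf', ← Category.assoc, ← h, Category.assoc]
    · intro hf' j
      obtain ⟨i, rfl⟩ := hs j
      rw [← cancel_epi (a i), ← hf', reassoc_of% h]
  refine ⟨inv e ≫ f, (key _).2 fun i => ?_, fun f' hf' => ?_⟩
  · rw [IsIso.hom_inv_id_assoc, hf]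
  · rw [IsIso.eq_inv_comp]
    exact hu _ ((key f').1 hf')

theorem IsCoprod.isColimit (hc : IsCoprod c) : Nonempty (IsColimit (Cofan.mk X c)) := by
  choose d hd hu using hc
  exact ⟨Cofan.IsColimit.mk _ (fun s => d s.pt s.inj) (fun s i => hd s.pt s.inj i)
    fun s m hm => hu s.pt s.inj _ hm⟩

theorem isCoprod_of_isColimit (h : IsColimit (Cofan.mk X c)) : IsCoprod c := fun _ g =>
  ⟨Cofan.IsColimit.desc h g, fun i => Cofan.IsColimit.fac h g i,
    fun _ hf => Cofan.IsColimit.hom_ext h _ _ fun i =>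
      (hf i).trans (Cofan.IsColimit.fac h g i).symm⟩

theorem IsCoprod.map {E : Type w} [Category.{u₁} E] (hc : IsCoprod c) (F : D ⥤ E)
    [PreservesColimitsOfSize.{0, 0} F] : IsCoprod fun i => F.map (c i) := by
  obtain ⟨h⟩ := hc.isColimit
  exact isCoprod_of_isColimit (isColimitCofanMkObjOfIsColimit F _ _ h)

theorem IsCoprod.sigma (hc : IsCoprod c) {μ : ι → Type} {H : ∀ i, μ i → D}
    {d : ∀ i j, H i j ⟶ G i} (hd : ∀ i, IsCoprod (d i)) :
    IsCoprod fun p : Σ i, μ i => d p.1 p.2 ≫ c p.1 := by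
  intro Z g
  choose e he hu using fun i => hd i Z fun j => g ⟨i, j⟩
  obtain ⟨f, hf, hf'⟩ := hc Z e
  refine ⟨f, fun p => ?_, fun f' hf'' => hf' f' fun i => hu i _ fun j => ?_⟩
  · rw [Category.assoc, hf, he]
  · rw [← Category.assoc]
    exact hf'' ⟨i, j⟩

theorem isCoprod_of_isIso {H : κ → D} {Y : D} {d : ∀ j, H j ⟶ Y} (j₀ : κ) (hj : ∀ j, j = j₀)
    [IsIso (d j₀)] : IsCoprod d := by
  intro Z g
  refine ⟨inv (d j₀) ≫ g j₀, fun j => ?_, fun f hf => ?_⟩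
  · obtain rfl := hj j
    rw [IsIso.hom_inv_id_assoc]
  · rw [IsIso.eq_inv_comp, hf]

end IsCoprod

theorem Elem.branch_map {n m : ℕ} (φ : Elem n m) {X : ℕ → Type u} {Y : ℕ → Type v}
    (g : ∀ k, X k → Y k) (x : X φ.arity) (j : Fin m) :
    (φ.branch x j).map g = φ.branch (g _ x) j := by
  by_cases h : j = φ.idx
  · subst h
    rw [branch_idx, branch_idx]
    rfl
  · rw [branch_ne _ _ h, branch_ne _ _ h]
    rfl

/-- The tags distinguish the two vertices even when their arities coincide, so a decoration is just
a pair of an index over `bottom` and one over `top`. -/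
theorem Elem.map_eq_twoTree {n m : ℕ} (φ : Elem n m) {I : ℕ → Type} (f : ∀ k, I k → Two m φ.arity k)
    (R : OTree I n) (h : R.map f = φ.twoTree) :
    ∃ i j, f m i = .bottom ∧ f φ.arity j = .top ∧ R = φ.twoTree.map (Two.dec i j) := by
  obtain ⟨i, ts, h1, h2, h3⟩ := Tr.map_eq_node (congrArg OTree.tree h)
  have h4 := h3 φ.idx
  rw [branch_idx] at h4
  obtain ⟨j, us, h5, h6, h7⟩ := Tr.map_eq_node h4
  refine ⟨i, j, h2, h6, OTree.ext (h1.trans (congrArg (Tr.node m i) (funext fun l => ?_)))⟩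
  rw [branch_map]
  by_cases h : l = φ.idx
  · subst h
    rw [branch_idx, h5]
    exact congrArg _ (funext fun l => Tr.map_eq_leaf (h7 l))
  · rw [branch_ne _ _ h]
    have := h3 l
    rw [branch_ne _ _ h] at this
    exact Tr.map_eq_leaf this

/-- The comparison of a decoration of the tags of two vertices with its values. -/
def Two.decId {C : ℕ → Type u} [∀ n, Category.{v} (C n)] {m k : ℕ} (A : ∀ l, Two m k l → C l) :
    ∀ l (z : Two m k l), Two.dec (A m .bottom) (A k .top) l z ⟶ A l z
  | _, .bottom => 𝟙 _
  | _, .top => 𝟙 _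

namespace UnitalCatOperad
variable {C : ℕ → Type u} [∀ n, Category.{v} (C n)] (O : UnitalCatOperad C)
  {X Y Z W : ℕ → Type} {n : ℕ}

theorem retag_evCorolla (f : ∀ k, X k → Y k) (x : X n) (D : ∀ k, Y k → C k)
    (h : (OTree.corolla x).map f = OTree.corolla (f n x)) :
    O.retag f h D ≫ O.evCorolla (f n x) D = O.evCorolla x fun k x => D k (f k x) :=
  (congrArg (· ≫ _) ((O.act n).map_id _)).trans (Category.id_comp _)

theorem retag_eq_evMap (g : ∀ k, Y k → Y k) (hg : ∀ k y, g k y = y) {Q : OTree Y n}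
    (h : Q.map g = Q) (D : ∀ k, Y k → C k) :
    O.retag g h D = O.evMap Q fun k y => eqToHom (congrArg (D k) (hg k y)) := by
  obtain rfl : g = fun _ y => y := funext fun k => funext fun y => hg k y
  rw [retag_id]
  exact (O.evMap_id _ _).symm

theorem distributive_corolla (y : Y n) : O.Distributive (OTree.corolla y) := by
  intro I f G D c hc
  refine (hc n y).transport (inv (O.evCorolla y D)) inferInstance
    (fun i => ⟨OTree.corolla i.1, congrArg OTree.corolla i.2⟩) ?_
    (fun i => inv (O.evCorolla i.1 G)) (fun i => inferInstance) ?_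
  · rintro ⟨R, hR⟩
    obtain ⟨i, rfl, hi⟩ := OTree.map_eq_corolla hR
    exact ⟨⟨i, hi⟩, rfl⟩
  · rintro ⟨i, rfl⟩
    dsimp only
    rw [eqToHom_refl, Category.comp_id, IsIso.inv_comp_eq, ← Category.assoc, IsIso.eq_comp_inv,
      Category.assoc, retag_evCorolla]
    exact O.evCorolla_natural i c

variable {O}

/-- Decorations of `Q.subst r` come from decorations of `Q` by decorated trees `r k y`.
Distributivity of the `r k y` supplies the coproducts to which distributivity of `Q` applies, and
`cmp` transports the result. -/
theorem Distributive.subst {Q : OTree Y n} (hQ : O.Distributive Q) {r : ∀ k, Y k → OTree Z k}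
    (hr : ∀ k y, O.Distributive (r k y)) : O.Distributive (Q.subst r) := by
  intro I f G D c hc
  have h1 := hQ (Deco f r) (fun _ p => p.1) (fun _ p => O.ev p.2.1 G)
    (fun k y => O.ev (r k y) D) (fun _ p => O.evMap p.2.1 c ≫ O.retag f p.2.2 D) fun k y => by
      refine (hr k y I f G D c hc).transport (𝟙 _) (IsIso.id _) (fun R => ⟨⟨y, R⟩, rfl⟩) ?_
        (fun R => 𝟙 _) (fun _ => IsIso.id _) ?_
      · rintro ⟨⟨y, R⟩, rfl⟩
        exact ⟨R, rfl⟩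
      · intro R
        simp only [eqToHom_refl, Category.id_comp, Category.comp_id]
  have hmem : ∀ R : {R : OTree (Deco f r) n // R.map (fun _ p => p.1) = Q},
      (R.1.subst fun _ p => p.2.1).map f = Q.subst r := by
    intro R
    rw [OTree.map_subst]
    conv_rhs => rw [← R.2, OTree.subst_map]
    exact congrArg (fun q => OTree.subst q R.1) (funext fun k => funext fun p => p.2.2)
  refine h1.transport (O.cmp Q r rfl D) inferInstance (fun R => ⟨R.1.subst fun _ p => p.2.1, hmem R⟩) ?_
    (fun R => O.cmp R.1 (fun _ p => p.2.1) rfl G) (fun _ => inferInstance) ?_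
  · rintro ⟨R, hR⟩
    obtain ⟨R', h2, rfl⟩ := OTree.exists_subst_lift f r Q R hR
    exact ⟨⟨R', h2⟩, rfl⟩
  · intro R
    have e : R.1.subst (fun k (p : Deco f r k) => r k p.1) = Q.subst r := by
      conv_rhs => rw [← R.2, OTree.subst_map]
    have h3 := O.cmp_retag R.1 (r := fun _ p => p.2.1) f (fun k p => p.2.2) rfl e (hmem R) D
    have h4 := O.retag_cmp (fun _ (p : Deco f r _) => p.1) R.2 r rfl e D
    rw [← O.cmp_natural_assoc, ← h3, Category.assoc, h4, evMap_comp_assoc]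

variable (O)

/-- There are no vertices, hence exactly one summand, and its coprojection is an isomorphism. -/
theorem distributive_leaf (l : Fin n) (hl : (Tr.leaf l : Tr Y (Fin n)).leaves.Perm (List.finRange n)) :
    O.Distributive (⟨.leaf l, hl⟩ : OTree Y n) := by
  intro I f G D c _
  have : IsIso (O.evMap (⟨.leaf l, hl⟩ : OTree I n) c ≫
      O.retag f (Q' := (⟨.leaf l, hl⟩ : OTree Y n)) rfl D) := by
    have : IsIso (O.evMap (⟨.leaf l, hl⟩ : OTree I n) c) := by
      have e : O.evMap (⟨.leaf l, hl⟩ : OTree I n) c = 𝟙 _ := (O.act n).map_id _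
      rw [e]
      exact IsIso.id _
    exact IsIso.comp_isIso' this (O.isIso_retag f _ D)
  refine isCoprod_of_isIso ⟨⟨.leaf l, hl⟩, rfl⟩ ?_
  rintro ⟨R, hR⟩
  exact Subtype.ext (OTree.ext (Tr.map_eq_leaf (congrArg OTree.tree hR)))

/-- The composite of the actions of two permutations. -/
def symComp (π σ : Equiv.Perm (Fin n)) : O.sym π ⋙ O.sym σ ≅ O.sym (π.trans σ) :=
  Functor.isoWhiskerLeft (OTree.perm C π ⋙ OTree.perm (OTree C) σ) (O.assoc n) ≪≫
    Functor.isoWhiskerRight (NatIso.ofComponents (fun _ => Iso.refl _) (fun _ =>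
      (Category.comp_id _).trans (Category.id_comp _).symm) :
      (OTree.perm C π ⋙ OTree.perm (OTree C) σ) ⋙ OTree.mu C n ≅ OTree.perm C (π.trans σ)) (O.act n)

def symRefl : O.sym (Equiv.refl (Fin n)) ≅ 𝟭 (C n) := O.unit n

/-- The inverse permutation gives an inverse functor up to isomorphism, so the action of a
permutation preserves all colimits without any hypothesis. -/
def symEquiv (π : Equiv.Perm (Fin n)) : C n ≌ C n :=
  CategoryTheory.Equivalence.mk (O.sym π) (O.sym π.symm)
    (O.symRefl.symm ≪≫ eqToIso (by rw [Equiv.self_trans_symm]) ≪≫ (O.symComp π π.symm).symm)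
    (O.symComp π.symm π ≪≫ eqToIso (by rw [Equiv.symm_trans_self]) ≪≫ O.symRefl)

theorem distributive_corollaPerm (π : Equiv.Perm (Fin n)) (y : Y n) :
    O.Distributive (OTree.corollaPerm π y) := by
  intro I f G D c hc
  have : (O.sym π).IsEquivalence := (O.symEquiv π).isEquivalence_functor
  refine ((hc n y).map (O.sym π)).transport (Y := O.ev (OTree.corollaPerm π y) D) (𝟙 _)
    (IsIso.id _) (fun i => ⟨OTree.corollaPerm π i.1, congrArg (OTree.corollaPerm π) i.2⟩) ?_
    (fun i => 𝟙 _) (fun _ => IsIso.id _) ?_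
  · rintro ⟨R, hR⟩
    obtain ⟨x, ts, h1, h2, h3⟩ := Tr.map_eq_node (congrArg OTree.tree hR)
    refine ⟨⟨x, h2⟩, Subtype.ext (OTree.ext ?_)⟩
    exact (h1.trans (congrArg _ (funext fun i => Tr.map_eq_leaf (h3 i)))).symm
  · rintro ⟨i, rfl⟩
    dsimp only
    rw [eqToHom_refl, Category.comp_id]
    refine (Category.id_comp _).trans (Eq.trans ?_ (Category.comp_id _).symm)
    exact (congrArg (_ ≫ ·) ((O.act n).map_id _)).trans (Category.comp_id _)

section TwoTree
variable {m : ℕ} (φ : Elem n m)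

/-- The value of `odot` is the composite along the tree with two vertices. -/
def odotEv (A : ∀ k, Two m φ.arity k → C k) :
    ((O.odot φ).obj (A m .bottom)).obj (A φ.arity .top) ⟶ O.ev φ.twoTree A :=
  O.evMap φ.twoTree (A := Two.dec (A m .bottom) (A φ.arity .top)) (Two.decId A)

instance isIso_odotEv (A : ∀ k, Two m φ.arity k → C k) : IsIso (O.odotEv φ A) := by
  have : ∀ l z, IsIso (Two.decId A l z) := by
    intro l z
    cases z <;> exact IsIso.id _
  exact O.isIso_evMap _ _

/-- The top vertex is changed before the bottom one, to match the iterated coproduct in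
`distributive_twoTree`. -/
theorem odotEv_natural {A B : ∀ k, Two m φ.arity k → C k} (θ : ∀ k z, A k z ⟶ B k z) :
    ((O.odot φ).obj (A m .bottom)).map (θ φ.arity .top) ≫
      ((O.odot φ).map (θ m .bottom)).app (B φ.arity .top) ≫ O.odotEv φ B =
    O.odotEv φ A ≫ O.evMap φ.twoTree θ := by
  have h : O.evMap φ.twoTree (Two.decHom (𝟙 (A m .bottom)) (θ φ.arity .top)) ≫
      O.evMap φ.twoTree (Two.decHom (θ m .bottom) (𝟙 (B φ.arity .top))) ≫
        O.evMap φ.twoTree (Two.decId B) =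
      O.evMap φ.twoTree (Two.decId A) ≫ O.evMap φ.twoTree θ := by
    rw [evMap_comp, evMap_comp, evMap_comp]
    congr 1
    funext l z
    cases z
    · exact (Category.id_comp _).trans ((Category.comp_id _).trans (Category.id_comp _).symm)
    · exact (congrArg (_ ≫ ·) (Category.id_comp _)).trans
        ((Category.comp_id _).trans (Category.id_comp _).symm)
  exact h

/-- Apply preservation in the bottom variable with the top object fixed, then preservation in the
top variable over each bottom summand; the result is a coproduct over pairs. -/
theorem distributive_twoTree
    (hleft : ∀ y : C φ.arity, PreservesColimitsOfSize.{0, 0} ((O.odot φ).flip.obj y))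
    (hright : ∀ x : C m, PreservesColimitsOfSize.{0, 0} ((O.odot φ).obj x)) :
    O.Distributive φ.twoTree := by
  intro I f G D c hc
  have h1 := (hc m .bottom).map ((O.odot φ).flip.obj (D φ.arity .top))
  have h2 := h1.sigma fun i => (hc φ.arity .top).map ((O.odot φ).obj (G m i.1))
  have hdec : ∀ (i : {i // f m i = .bottom}) (j : {j // f φ.arity j = .top}) l
      (z : Two m φ.arity l), f l (Two.dec i.1 j.1 l z) = z := by
    intro i j l z
    cases z
    · exact i.2
    · exact j.2
  have htree : ∀ (i : {i // f m i = .bottom}) (j : {j // f φ.arity j = .top}),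
      (φ.twoTree.map (Two.dec i.1 j.1)).map f = φ.twoTree := by
    intro i j
    rw [OTree.map_map]
    refine Eq.trans ?_ φ.twoTree.map_id
    exact congrArg φ.twoTree.map (funext fun l => funext fun z => hdec i j l z)
  refine h2.transport (O.odotEv φ D) inferInstance
    (fun p => ⟨φ.twoTree.map (Two.dec p.1.1 p.2.1), htree p.1 p.2⟩) ?_
    (fun p => O.odotEv φ (fun l z => G l (Two.dec p.1.1 p.2.1 l z)) ≫
      O.retag (Two.dec p.1.1 p.2.1) rfl G) (fun p => IsIso.comp_isIso' (O.isIso_odotEv φ _) (O.isIso_retag _ _ G)) ?_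
  · rintro ⟨R, hR⟩
    obtain ⟨i, j, hi, hj, rfl⟩ := φ.map_eq_twoTree f R hR
    exact ⟨⟨⟨i, hi⟩, ⟨j, hj⟩⟩, rfl⟩
  · rintro ⟨i, j⟩
    have h3 := O.odotEv_natural φ (A := fun l z => G l (Two.dec i.1 j.1 l z)) (B := D)
      fun l z => c l (Two.dec i.1 j.1 l z) ≫ eqToHom (congrArg (D l) (hdec i j l z))
    have h4 := O.evMap_retag (Two.dec i.1 j.1) (Q := φ.twoTree) rfl c
    have h5 := O.retag_eq_evMap (fun l z => f l (Two.dec i.1 j.1 l z)) (hdec i j)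
      (Q := φ.twoTree) ((OTree.map_map _ _ _).symm.trans (htree i j)) D
    have h6 := O.retag_retag (Two.dec i.1 j.1) f (Q := φ.twoTree) rfl (htree i j)
      ((OTree.map_map _ _ _).symm.trans (htree i j)) D
    refine Eq.trans ?_ (Category.assoc _ _ _).symm
    refine (Category.assoc _ _ _).trans ((congrArg (O.odotEv φ _ ≫ ·) ?_).trans h3.symm)
    rw [← evMap_comp, ← h5, ← h6, reassoc_of% h4]

end TwoTree

end UnitalCatOperad
end FreeOp

/-! ### Leveled trees up to interchange of levels are planar trees. -/

namespace FreeOp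

section Fibres
variable {n m : ℕ}

theorem mem_iff_lt_card_of_isLowerSet {S : Finset (Fin n)} (hS : IsLowerSet (S : Set (Fin n)))
    (x : Fin n) : x ∈ S ↔ (x : ℕ) < S.card := by
  constructor
  · intro hx
    have : Finset.Iic x ⊆ S := fun y hy => hS (Finset.mem_Iic.1 hy) hx
    have := Finset.card_le_card this
    rw [Fin.card_Iic] at this
    omega
  · intro hx
    by_contra hxS
    have : S ⊆ Finset.Iio x := fun y hy => Finset.mem_Iio.2 (by
      by_contra hxy
      exact hxS (hS (not_lt.1 hxy) hy))
    have := Finset.card_le_card this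
    rw [Fin.card_Iio] at this
    omega

theorem sum_card_fibre (f : Fin n →o Fin m) : ∑ j, (fibre f j).card = n := by
  have := Finset.card_eq_sum_card_fiberwise (f := f) (s := Finset.univ) (t := Finset.univ)
    fun x _ => Finset.mem_coe.2 (Finset.mem_univ _)
  rw [Finset.card_univ, Fintype.card_fin] at this
  exact this.symm

/-- The points mapped below `j` form an initial segment whose length is the sum of the fibre sizes
below `j`; these lengths determine the map. -/
theorem orderHom_eq_of_card_fibre {f g : Fin n →o Fin m}
    (h : ∀ j, (fibre f j).card = (fibre g j).card) : f = g := by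
  have key : ∀ (f : Fin n →o Fin m) (x : Fin n) (j : Fin m),
      f x < j ↔ (x : ℕ) < ∑ i ∈ Finset.Iio j, (fibre f i).card := by
    intro f x j
    have h1 := mem_iff_lt_card_of_isLowerSet (S := Finset.univ.filter fun x => f x < j)
      (fun a b hab ha => by
        simp only [Finset.coe_filter, Finset.mem_univ, true_and, Set.mem_ofPred_eq] at ha ⊢
        exact (f.monotone hab).trans_lt ha) x
    rw [Finset.card_eq_sum_card_fiberwise (f := f) (t := Finset.Iio j) fun y hy => by
      simpa using hy] at h1
    have h2 : ∀ i ∈ Finset.Iio j,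
        {a ∈ Finset.univ.filter (fun x => f x < j) | f a = i} = fibre f i := by
      intro i hi
      ext a
      simp only [Finset.mem_filter, Finset.mem_univ, true_and, Elem.mem_fibre,
        and_iff_right_iff_imp]
      rintro rfl
      exact Finset.mem_Iio.1 hi
    rw [Finset.sum_congr rfl fun i hi => congrArg Finset.card (h2 i hi)] at h1
    simpa using h1
  ext1
  funext x
  refine eq_of_forall_gt_iff fun j => ?_
  rw [key, key, Finset.sum_congr rfl fun i _ => h i]

namespace Elem

theorem add_one_eq (φ : Elem n m) : n + 1 = m + φ.arity := by
  have h1 := sum_card_fibre φ.map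
  rw [← Finset.add_sum_erase _ _ (Finset.mem_univ φ.idx),
    Finset.sum_congr rfl fun j hj => φ.card_fibre j (Finset.ne_of_mem_erase hj)] at h1
  have h2 : 0 < m := φ.idx.pos
  simp only [Finset.sum_const, Finset.card_erase_of_mem (Finset.mem_univ _), Finset.card_univ,
    Fintype.card_fin, smul_eq_mul, mul_one] at h1
  simp only [arity]
  omega

theorem heq_of_idx_eq {n' : ℕ} {φ : Elem n m} {φ' : Elem n' m} (hi : φ.idx = φ'.idx)
    (ha : φ.arity = φ'.arity) : n = n' ∧ HEq φ φ' := by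
  have h1 := φ.add_one_eq
  have h2 := φ'.add_one_eq
  obtain rfl : n = n' := by omega
  refine ⟨rfl, heq_of_eq ?_⟩
  have : φ.map = φ'.map := orderHom_eq_of_card_fibre fun j => by
    by_cases hj : j = φ.idx
    · subst hj
      exact ha.trans (by rw [arity, hi])
    · rw [φ.card_fibre j hj, φ'.card_fibre j (hi ▸ hj)]
  cases φ
  cases φ'
  cases hi
  cases this
  rfl

theorem exists_of_arity (j : Fin m) (a : ℕ) : ∃ (n : ℕ) (φ : Elem n m), φ.idx = j ∧ φ.arity = a := by
  have hm : 0 < m := j.pos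
  -- The map is the identity below `j`, constant on the next `a` points, and a shift by `a - 1`
  -- afterwards; for `a = 0` it skips `j`.
  let f : Fin (m + a - 1) →o Fin m :=
    { toFun x := ⟨if (x : ℕ) < j then x else if (x : ℕ) < j + a then j else x + 1 - a, by
        have := x.2
        have := j.2
        split_ifs <;> omega⟩
      monotone' x y hxy := by
        have : (x : ℕ) ≤ y := hxy
        simp only [Fin.mk_le_mk]
        split_ifs <;> omega }
  have hv : ∀ x, (f x : ℕ) = if (x : ℕ) < j then (x : ℕ) else if (x : ℕ) < j + a then (j : ℕ)
    else x + 1 - a := fun _ => rfl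
  have hf : ∀ i, i ≠ j → (fibre f i).card = 1 := by
    intro i hi
    have hi' : (i : ℕ) ≠ j := fun h => hi (Fin.ext h)
    have := i.2
    have := j.2
    refine Finset.card_eq_one.2 ⟨⟨if (i : ℕ) < j then i else i + a - 1, by
      split_ifs <;> omega⟩, ?_⟩
    ext x
    have := x.2
    rw [mem_fibre, Finset.mem_singleton, Fin.ext_iff, Fin.ext_iff, hv]
    dsimp only
    split_ifs <;> omega
  refine ⟨_, ⟨f, j, hf⟩, rfl, ?_⟩
  have := add_one_eq ⟨f, j, hf⟩
  omega

end Elem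
end Fibres

namespace Tr
variable {X : ℕ → Type u} {L M : Type}

/-- The number of vertices. -/
def nodes : Tr X L → ℕ
  | leaf _ => 0
  | node _ _ ts => 1 + ∑ i, (ts i).nodes

theorem bind_inj {t : Tr X L} {g g' : L → Tr X M} (h : t.bind g = t.bind g') :
    ∀ l ∈ t.leaves, g l = g' l := by
  induction t with
  | leaf l =>
    intro l' hl'
    obtain rfl := List.mem_singleton.1 hl'
    exact h
  | node k x ts ih =>
    intro l hl
    obtain ⟨i, -, hi⟩ := List.mem_flatMap.1 hl
    simp only [bind, node.injEq, heq_eq_eq, true_and] at h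
    exact ih i (congrFun h i) l hi

theorem nodes_bind (t : Tr X L) (g : L → Tr X M) :
    (t.bind g).nodes = t.nodes + (t.leaves.map fun l => (g l).nodes).sum := by
  induction t with
  | leaf l => simp [bind, leaves, nodes]
  | node k x ts ih =>
    simp only [bind, nodes, ih, leaves, Finset.sum_add_distrib, add_assoc, List.map_flatMap]
    rw [List.flatMap_def, List.sum_flatten, List.map_map, ← List.ofFn_eq_map, List.sum_ofFn]
    rfl

end Tr

namespace Elem
variable {n m : ℕ} (φ : Elem n m) {L : Type}

theorem mem_leaves_branch (x : Fin n) : x ∈ (φ.branch (X := Pt) ⟨⟩ (φ.map x)).leaves := by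
  rw [leaves_branch, Finset.mem_sort, mem_fibre]

theorem bind_branch_inj {s s' : Fin n → Tr Pt L}
    (h : ∀ i, (φ.branch ⟨⟩ i).bind s = (φ.branch ⟨⟩ i).bind s') : s = s' :=
  funext fun x => Tr.bind_inj (h _) x (φ.mem_leaves_branch x)

theorem bind_branch_idx (s : Fin n → Tr Pt L) : (φ.branch (X := Pt) ⟨⟩ φ.idx).bind s =
    .node φ.arity ⟨⟩ fun l => s ((fibre φ.map φ.idx).orderEmbOfFin rfl l) := by
  rw [branch_idx]
  rfl

/-- Splitting off the marked vertex removes a vertex from the forest; this count is the induction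
measure for the growth of leveled trees. -/
theorem sum_nodes_lt (s : Fin n → Tr Pt L) :
    ∑ x, (s x).nodes < ∑ i, ((φ.branch ⟨⟩ i).bind s).nodes := by
  simp only [Tr.nodes_bind, Finset.sum_add_distrib, leaves_branch]
  have h1 : ∑ i, (((fibre φ.map i).sort (· ≤ ·)).map fun x => (s x).nodes).sum =
      ∑ x, (s x).nodes := by
    rw [← Finset.sum_fiberwise Finset.univ φ.map]
    refine Finset.sum_congr rfl fun i _ => ?_
    rw [← Multiset.sum_coe, ← Multiset.map_coe, Finset.sort_eq]
    rfl
  have h2 : 1 ≤ ∑ i, (φ.branch (X := Pt) ⟨⟩ i).nodes := by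
    refine le_trans ?_ (Finset.single_le_sum (fun _ _ => Nat.zero_le _) (Finset.mem_univ φ.idx))
    rw [branch_idx]
    exact Nat.le_add_right _ _
  omega

/-- The bottom vertex of the `j`-th tree of a forest can be split off. -/
theorem exists_bind_branch (s : Fin m → Tr Pt L) (j : Fin m) {k : ℕ} {x : Pt k}
    {ts : Fin k → Tr Pt L} (h : s j = .node k x ts) :
    ∃ (n : ℕ) (φ : Elem n m) (s' : Fin n → Tr Pt L), φ.idx = j ∧
      ∀ i, s i = (φ.branch ⟨⟩ i).bind s' := by
  obtain ⟨n, φ, rfl, rfl⟩ := exists_of_arity j k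
  refine ⟨n, φ, fun y => if hy : φ.map y = φ.idx then
    ts (((fibre φ.map φ.idx).orderIsoOfFin rfl).symm ⟨y, mem_fibre.2 hy⟩) else s (φ.map y),
    rfl, fun i => ?_⟩
  by_cases hi : i = φ.idx
  · subst hi
    rw [bind_branch_idx, h]
    refine congrArg (Tr.node _ _) (funext fun l => ?_)
    have hl : (fibre φ.map φ.idx).orderEmbOfFin rfl l ∈ fibre φ.map φ.idx :=
      Finset.orderEmbOfFin_mem _ _ _
    rw [dif_pos (mem_fibre.1 hl)]
    exact congrArg ts ((OrderIso.symm_apply_apply ((fibre φ.map φ.idx).orderIsoOfFin rfl) l).symm)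
  · rw [branch_ne _ _ hi]
    have := φ.map_point i hi
    simp only [Tr.bind]
    rw [dif_neg (by rwa [this]), this]

theorem idx_arity_eq {n' : ℕ} {φ : Elem n m} {φ' : Elem n' m} {s : Fin n → Tr Pt L}
    {s' : Fin n' → Tr Pt L}
    (h : (φ.branch ⟨⟩ φ.idx).bind s = (φ'.branch ⟨⟩ φ'.idx).bind s') : φ.arity = φ'.arity := by
  rw [bind_branch_idx, bind_branch_idx] at h
  exact (Tr.node.inj h).1

/-- Together with `orderHom_eq_of_card_fibre` this shows that the two orders of splitting off two
vertices have the same composite, so that an interchange square commutes. -/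
theorem card_fibre_comp {k : ℕ} (ψ : Elem n m) (φ : Elem m k) (hne : φ.map ψ.idx ≠ φ.idx)
    (j : Fin k) : (fibre (φ.map.comp ψ.map) j).card =
      if j = φ.idx then φ.arity else if j = φ.map ψ.idx then ψ.arity else 1 := by
  have h1 : (fibre (φ.map.comp ψ.map) j).card = ∑ y ∈ fibre φ.map j, (fibre ψ.map y).card := by
    rw [Finset.card_eq_sum_card_fiberwise (f := ψ.map) (t := fibre φ.map j) fun x hx => by
      rw [Finset.mem_coe, mem_fibre] at hx ⊢
      exact hx]
    refine Finset.sum_congr rfl fun y hy => congrArg Finset.card ?_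
    ext x
    rw [mem_fibre] at hy
    simp only [Finset.mem_filter, mem_fibre, and_iff_right_iff_imp]
    rintro rfl
    exact hy
  rw [h1]
  have h2 : ∀ y ∈ fibre φ.map j, j ≠ φ.map ψ.idx → (fibre ψ.map y).card = 1 := by
    intro y hy hj
    refine ψ.card_fibre y fun h => hj ?_
    rw [← h, mem_fibre.1 hy]
  split_ifs with hj hj'
  · subst hj
    rw [Finset.sum_congr rfl fun y hy => h2 y hy hne.symm]
    simp [arity]
  · have hp : fibre φ.map j = {ψ.idx} := by
      obtain ⟨y, hy⟩ := Finset.card_eq_one.1 (φ.card_fibre j hj)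
      have : ψ.idx ∈ fibre φ.map j := mem_fibre.2 hj'.symm
      rw [hy, Finset.mem_singleton] at this
      rw [hy, this]
    rw [hp, Finset.sum_singleton]
  · rw [Finset.sum_congr rfl fun y hy => h2 y hy hj', Finset.sum_const, φ.card_fibre j hj]
    rfl

end Elem

namespace LTree

theorem eqvGen_cons {n m : ℕ} (φ : Elem n m) {T T' : LTree m}
    (h : Relation.EqvGen Interchange T T') :
    Relation.EqvGen Interchange (cons φ T) (cons φ T') := by
  induction h with
  | rel _ _ h => exact .rel _ _ (.cons φ h)
  | refl _ => exact .refl _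
  | symm _ _ _ ih => exact .symm _ _ ih
  | trans _ _ _ _ _ ih ih' => exact .trans _ _ _ ih ih'

/-- The leveled tree `T` can be extended to `A` by splitting off one by one the vertices of the
forest `s` on top of it. -/
inductive Grows {n : ℕ} (A : LTree n) : ∀ {m : ℕ}, LTree m → (Fin m → Tr Pt (Fin n)) → Prop
  | done : Grows A A Tr.leaf
  | step {m k : ℕ} (φ : Elem m k) {T : LTree k} {s : Fin k → Tr Pt (Fin n)}
      {s' : Fin m → Tr Pt (Fin n)} (hs : ∀ i, s i = (φ.branch ⟨⟩ i).bind s')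
      (h : Grows A (cons φ T) s') : Grows A T s

variable {n : ℕ}

theorem Grows.tree_eq {A : LTree n} {m : ℕ} {T : LTree m} {s : Fin m → Tr Pt (Fin n)}
    (h : Grows A T s) : T.tree.tree.bind s = A.tree.tree := by
  induction h with
  | done => exact Tr.bind_leaf _
  | step φ hs h ih => rw [← ih, tree_cons, Tr.bind_bind, ← funext hs]

/-- Split off any available vertex and induct on the number of vertices. When only leaves remain,
planarity forces their labels to be in the standard order, so nothing is left to do. -/
theorem exists_grows {m : ℕ} (T : LTree m) (s : Fin m → Tr Pt (Fin n))
    (hs : (T.tree.tree.bind s).leaves = List.finRange n) : ∃ A : LTree n, Grows A T s := by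
  induction hN : ∑ i, (s i).nodes using Nat.strong_induction_on generalizing m with
  | _ N ih =>
    by_cases hl : ∃ j k x ts, s j = .node k x ts
    · obtain ⟨j, k, x, ts, hj⟩ := hl
      obtain ⟨p, φ, s', -, h'⟩ := Elem.exists_bind_branch s j hj
      obtain ⟨A, hA⟩ := ih _ (by
        rw [← hN]
        simp only [h']
        exact φ.sum_nodes_lt s') (cons φ T) s' (by rw [tree_cons, Tr.bind_bind, ← funext h', hs]) rfl
      exact ⟨A, .step φ h' hA⟩
    · have hg : ∀ j, ∃ l, s j = .leaf l := by
        intro j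
        cases h : s j with
        | leaf l => exact ⟨l, rfl⟩
        | node k x ts => exact absurd ⟨j, k, x, ts, h⟩ hl
      choose g hg using hg
      obtain rfl : s = fun j => .leaf (g j) := funext hg
      simp only [Tr.leaves_bind, Tr.leaves] at hs
      rw [T.tree_planar.2, ← List.map_eq_flatMap] at hs
      obtain rfl : m = n := by simpa using congrArg List.length hs
      obtain rfl : g = _root_.id := funext fun i =>
        List.map_inj_left.1 (hs.trans (List.map_id _).symm) i (List.mem_finRange i)
      exact ⟨T, .done⟩

/-- Confluence, by induction on the number of remaining vertices. If the two growths first split off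
the same vertex, the elementary maps agree; otherwise each vertex can still be split off after the
other, and the two orders differ by an interchange. -/
theorem eqvGen_of_grows {A B : LTree n} {m : ℕ} {T T' : LTree m} {s : Fin m → Tr Pt (Fin n)}
    (hT : Relation.EqvGen Interchange T T') (hA : Grows A T s) (hB : Grows B T' s) :
    Relation.EqvGen Interchange A B := by
  induction hN : ∑ i, (s i).nodes using Nat.strong_induction_on generalizing m A B with
  | _ N ih =>
    have hleaf : ∀ {p : ℕ} (φ : Elem p n) (s' : Fin p → Tr Pt (Fin n)),
        ¬ ∀ i, Tr.leaf i = (φ.branch ⟨⟩ i).bind s' := by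
      intro p φ s' h
      have := h φ.idx
      rw [Elem.bind_branch_idx] at this
      cases this
    have hlt : ∀ {p : ℕ} (φ : Elem p m) (s' : Fin p → Tr Pt (Fin n)),
        (∀ i, s i = (φ.branch ⟨⟩ i).bind s') → ∑ i, (s' i).nodes < N := by
      intro p φ s' h
      rw [← hN]
      simp only [h]
      exact φ.sum_nodes_lt s'
    cases hA with
    | done =>
      cases hB with
      | done => exact hT
      | step φ hs h => exact (hleaf φ _ hs).elim
    | @step p _ φ _ _ s₁ hs₁ hA =>
      cases hB with
      | done => exact (hleaf φ _ hs₁).elim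
      | @step p' _ φ' _ _ s₂ hs₂ hB =>
        by_cases hi : φ.idx = φ'.idx
        · obtain ⟨rfl, h⟩ := Elem.heq_of_idx_eq hi
            (Elem.idx_arity_eq (by rw [← hs₁, ← hs₂, hi]))
          obtain rfl := eq_of_heq h
          obtain rfl := φ.bind_branch_inj fun i => (hs₁ i).symm.trans (hs₂ i)
          exact ih _ (hlt φ _ hs₁) (eqvGen_cons φ hT) hA hB rfl
        -- The vertex split off by `φ'` is still present in the forest left by `φ`, and conversely.
        · have h1 : s₁ (φ.point φ'.idx (Ne.symm hi)) = s φ'.idx := by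
            rw [hs₁ φ'.idx, Elem.branch_ne _ _ (Ne.symm hi)]
            rfl
          have h2 : s₂ (φ'.point φ.idx hi) = s φ.idx := by
            rw [hs₂ φ.idx, Elem.branch_ne _ _ hi]
            rfl
          obtain ⟨q, ψ, s₃, hψ, hs₃⟩ := Elem.exists_bind_branch s₁ _
            (h1.trans ((hs₂ _).trans (φ'.bind_branch_idx s₂)))
          obtain ⟨q', ψ', s₄, hψ', hs₄⟩ := Elem.exists_bind_branch s₂ _
            (h2.trans ((hs₁ _).trans (φ.bind_branch_idx s₁)))
          have h3 : ψ.arity = φ'.arity := by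
            have := (hs₃ _).symm.trans ((congrArg s₁ hψ).trans (h1.trans (hs₂ _)))
            rw [Elem.bind_branch_idx, Elem.bind_branch_idx] at this
            exact (Tr.node.inj this).1
          have h4 : ψ'.arity = φ.arity := by
            have := (hs₄ _).symm.trans ((congrArg s₂ hψ').trans (h2.trans (hs₁ _)))
            rw [Elem.bind_branch_idx, Elem.bind_branch_idx] at this
            exact (Tr.node.inj this).1
          have h5 : φ.map ψ.idx = φ'.idx := by rw [hψ, Elem.map_point]
          have h6 : φ'.map ψ'.idx = φ.idx := by rw [hψ', Elem.map_point]
          obtain rfl : q = q' := by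
            have := φ.add_one_eq
            have := φ'.add_one_eq
            have := ψ.add_one_eq
            have := ψ'.add_one_eq
            omega
          have h7 : φ.map.comp ψ.map = φ'.map.comp ψ'.map := orderHom_eq_of_card_fibre fun j => by
            rw [Elem.card_fibre_comp ψ φ (h5.trans_ne (Ne.symm hi)),
              Elem.card_fibre_comp ψ' φ' (h6.trans_ne hi), h3, h4, h5, h6]
            split_ifs with a b
            · exact (hi (a.symm.trans b)).elim
            all_goals rfl
          have h8 : ∀ x, φ.map (ψ.map x) = φ'.map (ψ'.map x) := fun x => congrArg (fun f => f x) h7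
          -- Both remaining forests graft to `s` along the same pair of levels (`branch_bind`), and
          -- grafting is injective in the forest.
          obtain rfl : s₃ = s₄ := by
            refine ψ'.bind_branch_inj fun i => ?_
            refine congrFun (φ'.bind_branch_inj (s := fun i => (ψ'.branch ⟨⟩ i).bind s₃)
              (s' := fun i => (ψ'.branch ⟨⟩ i).bind s₄) fun i => ?_) i
            rw [← funext hs₄, ← hs₂, ← Tr.bind_bind,
              ← Elem.branch_bind ψ φ ψ' φ' h8 h5 h6 hi, Tr.bind_bind, ← funext hs₃, ← hs₁]
          have hsq : ∀ T : LTree m, Interchange (cons ψ (cons φ T)) (cons ψ' (cons φ' T)) :=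
            fun T => .square ψ φ ψ' φ' T h8 h5 h6 hi
          -- Complete both corners of the interchange square to full leveled trees; then `A` is
          -- connected to `D`, `D` to `D'` by the interchange, and `D'` to `B`.
          obtain ⟨D, hD⟩ := exists_grows (cons ψ (cons φ T)) s₃ (by
            rw [tree_cons, Tr.bind_bind, ← funext hs₃, hA.tree_eq, A.tree_planar.2])
          obtain ⟨D', hD'⟩ := exists_grows (cons ψ' (cons φ' T')) s₃ (by
            rw [tree_cons, Tr.bind_bind, ← funext hs₄, hB.tree_eq, B.tree_planar.2])
          have i1 := ih _ (hlt φ _ hs₁) (.refl _) hA (.step ψ hs₃ hD) rfl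
          have i2 := ih _ (hlt φ' _ hs₂) (.refl _) hB (.step ψ' hs₄ hD') rfl
          have i3 := ih _ ((by simpa only [hs₃] using ψ.sum_nodes_lt s₃ :
              ∑ x, (s₃ x).nodes < ∑ i, (s₁ i).nodes).trans (hlt φ _ hs₁))
            (.trans _ _ _ (.rel _ _ (hsq T)) (eqvGen_cons ψ' (eqvGen_cons φ' hT))) hD hD' rfl
          exact .trans _ _ _ i1 (.trans _ _ _ i3 (.symm _ _ i2))

/-- Every leveled tree grows from its bottom corolla: undo its levels one by one. -/
theorem Grows.exists_single {A : LTree n} : ∀ {m : ℕ} {T : LTree m} {s : Fin m → Tr Pt (Fin n)},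
    Grows A T s → ∃ k ts, Grows A (single k) ts
  | _, single k, s, h => ⟨k, s, h⟩
  | _, cons φ _, _, h => exists_single (Grows.step φ (fun _ => rfl) h)

/-- Leveled trees with the same underlying planar tree are connected by interchanges of levels. -/
theorem eqvGen_of_tree_eq {A B : LTree n} (h : A.tree = B.tree) :
    Relation.EqvGen Interchange A B := by
  obtain ⟨k, ts, hA⟩ := (Grows.done (A := A)).exists_single
  obtain ⟨k', ts', hB⟩ := (Grows.done (A := B)).exists_single
  have h1 := hA.tree_eq
  rw [h, ← hB.tree_eq] at h1
  obtain ⟨rfl, -, h2⟩ := Tr.node.inj h1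
  obtain rfl : ts = ts' := eq_of_heq h2
  exact eqvGen_of_grows (.refl _) hA hB

theorem exists_tree_eq {t : OTree Pt n} (ht : TreeClass.planar.mem n t) :
    ∃ T : LTree n, T.tree = t := by
  obtain ⟨t, hl⟩ := t
  cases t with
  | leaf l => exact ht.1.elim
  | node k x ts =>
    obtain ⟨A, hA⟩ := exists_grows (single k) ts ht.2
    exact ⟨A, OTree.ext hA.tree_eq.symm⟩

end LTree
end FreeOp

/-! ### The three families of generators, distributivity for all trees, and the free collection
functor. -/

namespace FreeOp

/-- The permutation reads off the labels of the leaves in planar order; relabelling by its inverse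
makes the tree planar. -/
theorem Tr.exists_planar {X : ℕ → Type u} {n : ℕ} (t : Tr X (Fin n))
    (ht : t.leaves.Perm (List.finRange n)) : ∃ (π : Equiv.Perm (Fin n)) (s : Tr X (Fin n)),
      s.leaves = List.finRange n ∧ s.bind (fun i => .leaf (π i)) = t := by
  have hlen : t.leaves.length = n := by rw [ht.length_eq, List.length_finRange]
  have hnd : t.leaves.Nodup := ht.nodup_iff.2 (List.nodup_finRange n)
  let f : Fin n → Fin n := fun i => t.leaves.get (i.cast hlen.symm)
  have hf : Function.Injective f := fun i j hij =>
    Fin.cast_injective _ (List.nodup_iff_injective_get.1 hnd hij)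
  let π : Equiv.Perm (Fin n) := Equiv.ofBijective f (Finite.injective_iff_bijective.1 hf)
  have hπ : t.leaves = (List.finRange n).map π := by
    refine List.ext_get (by simp [hlen]) fun i h1 h2 => ?_
    simp [π, f]
  refine ⟨π, t.bind fun i => .leaf (π.symm i), ?_, ?_⟩
  · simp only [leaves_bind, leaves]
    rw [← List.map_eq_flatMap, hπ, List.map_map]
    simp
  · simp only [bind_bind, bind, Equiv.apply_symm_apply]
    exact bind_leaf t

/-- The list of leaf labels recovers the permutation, and undoing it recovers the planar tree. -/
theorem Tr.planar_unique {X : ℕ → Type u} {n : ℕ} {s s' : Tr X (Fin n)}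
    (hs : s.leaves = List.finRange n) (hs' : s'.leaves = List.finRange n)
    {π π' : Equiv.Perm (Fin n)}
    (h : s.bind (fun i => .leaf (π i)) = s'.bind fun i => .leaf (π' i)) : s = s' ∧ π = π' := by
  have h1 := congrArg leaves h
  simp only [leaves_bind, leaves, hs, hs'] at h1
  rw [← List.map_eq_flatMap, ← List.map_eq_flatMap] at h1
  obtain rfl : π = π' :=
    Equiv.ext fun i => List.map_inj_left.1 h1 i (List.mem_finRange i)
  refine ⟨?_, rfl⟩
  have h2 := congrArg (fun t => t.bind fun i => leaf (π.symm i)) h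
  simp only [bind_bind, bind, Equiv.symm_apply_apply] at h2
  rwa [bind_leaf, bind_leaf] at h2

theorem OTree.map_eq_corollaPerm {X Y : ℕ → Type} {n : ℕ} {f : ∀ k, X k → Y k} {t : OTree X n}
    {π : Equiv.Perm (Fin n)} {y : Y n} (h : t.map f = OTree.corollaPerm π y) :
    ∃ x, t = OTree.corollaPerm π x := by
  obtain ⟨x, ts, h1, h2, h3⟩ := Tr.map_eq_node (congrArg OTree.tree h)
  exact ⟨x, OTree.ext (h1.trans (congrArg _ (funext fun i => Tr.map_eq_leaf (h3 i))))⟩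

/-- Every tree is in a unique way a planar tree with its leaves permuted. -/
def symGenerators : Generators TreeClass.planar TreeClass.nonUnital where
  Idx n := Equiv.Perm (Fin n)
  tree _ π := OTree.corollaPerm π ⟨⟩
  mem _ _ := trivial
  exists_fact {n} t ht := by
    obtain ⟨π, s, h1, h2⟩ := t.tree.exists_planar t.linear
    let s' : OTree Pt n := ⟨s, by rw [h1]⟩
    have hs' : TreeClass.planar.mem n s' := by
      refine ⟨?_, h1⟩
      cases s with
      | leaf l =>
        have ht' : TreeClass.IsNode t.tree := ht
        rw [← h2] at ht'
        exact ht'.elim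
      | node k x ts => trivial
    exact ⟨π, OTree.corollaPerm π ⟨s', s'.shape_eq.symm ▸ hs'⟩, rfl, OTree.ext h2⟩
  unique {n} Q Q' π π' h h' e := by
    obtain ⟨y, rfl⟩ := OTree.map_eq_corollaPerm h
    obtain ⟨y', rfl⟩ := OTree.map_eq_corollaPerm h'
    have hy : ∀ y : TreeClass.planar.TreesOn Pt n, y.1.tree.leaves = List.finRange n := by
      intro y
      have := y.2.2
      rwa [OTree.shape_eq] at this
    obtain ⟨h1, rfl⟩ := Tr.planar_unique (hy y) (hy y') (congrArg OTree.tree e)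
    exact ⟨congrArg _ (Subtype.ext (OTree.ext h1)), rfl⟩

/-- The class of corollas. -/
def TreeClass.corollas : TreeClass where
  mem _ t := t = OTree.corolla ⟨⟩
  corolla_mem _ := rfl
  subst_mem Q r hQ hr := by
    obtain ⟨y, rfl, -⟩ := OTree.map_eq_corolla hQ
    rw [OTree.corolla_subst, hr]

theorem TreeClass.corollas_le (K : TreeClass) : TreeClass.corollas ≤ K := by
  rintro n t rfl
  exact K.corolla_mem n

/-- Every tree of a class is in a unique way a tree of corollas. -/
def corollaGenerators (K : TreeClass) : Generators TreeClass.corollas K where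
  Idx n := {t // K.mem n t}
  tree _ t := t.1
  mem _ t := t.2
  exists_fact t ht := by
    refine ⟨⟨t, ht⟩, t.map fun k _ => ⟨OTree.corolla ⟨⟩, rfl⟩, ?_, ?_⟩
    · exact (OTree.map_map _ _ t).trans t.map_id
    · rw [OTree.subst_map]
      exact t.subst_corolla
  unique {n} Q Q' i i' h h' e := by
    have hy : ∀ {k} (y : TreeClass.corollas.TreesOn Pt k), y.1 = OTree.corolla ⟨⟩ := fun y =>
      y.1.shape_eq.symm.trans y.2
    -- A tree of corollas results in its own shape, so the resulting tree determines both the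
    -- generator and the factorization.
    have hQ : ∀ Q : OTree (TreeClass.corollas.TreesOn Pt) n, Q.subst (fun _ y => y.1) = Q.shape := by
      intro Q
      simp only [hy]
      exact (OTree.subst_map _ (fun _ _ => OTree.corolla PUnit.unit) Q).symm.trans
        Q.shape.subst_corolla
    have hQ' : ∀ Q : OTree (TreeClass.corollas.TreesOn Pt) n,
        Q.shape.map (fun k _ => ⟨OTree.corolla ⟨⟩, rfl⟩) = Q := by
      intro Q
      refine (OTree.map_map _ _ Q).trans (Eq.trans ?_ Q.map_id)
      exact congrArg Q.map (funext fun k => funext fun y => Subtype.ext (hy y).symm)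
    rw [hQ, hQ] at e
    refine ⟨?_, Subtype.ext (h.symm.trans (e.trans h'))⟩
    rw [← hQ' Q, e, hQ' Q']

/-- Every tree is either `|` or it is not. -/
def unitGenerators : Generators TreeClass.nonUnital TreeClass.all where
  Idx n := Option (PLift (n = 1))
  tree
    | _, none => OTree.corolla ⟨⟩
    | _, some ⟨h⟩ => ⟨.leaf ((0 : Fin 1).cast h.symm), by
      subst h
      exact List.Perm.refl _⟩
  mem _ _ := trivial
  exists_fact {n} t _ := by
    obtain ⟨t, ht⟩ := t
    cases t with
    | leaf l =>
      obtain rfl : n = 1 := by simpa [Tr.leaves] using ht.length_eq.symm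
      obtain rfl : l = 0 := Subsingleton.elim _ _
      exact ⟨some ⟨rfl⟩, ⟨.leaf 0, ht⟩, rfl, rfl⟩
    | node k x ts =>
      refine ⟨none, OTree.corolla ⟨⟨.node k x ts, ht⟩, trivial⟩, rfl, OTree.corolla_subst _ _⟩
  unique {n} Q Q' i i' h h' e := by
    have hn : ∀ y : TreeClass.nonUnital.TreesOn Pt n, TreeClass.IsNode y.1.tree := by
      intro y
      have := y.2
      rwa [OTree.shape_eq] at this
    rcases i with _ | ⟨⟨hi⟩⟩ <;> rcases i' with _ | ⟨⟨hi'⟩⟩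
    · obtain ⟨y, rfl, -⟩ := OTree.map_eq_corolla h
      obtain ⟨y', rfl, -⟩ := OTree.map_eq_corolla h'
      rw [OTree.corolla_subst, OTree.corolla_subst] at e
      exact ⟨congrArg OTree.corolla (Subtype.ext e), rfl⟩
    -- A corolla filled with a tree other than | cannot result in the same tree as the generator |;
    -- the next case is symmetric.
    · obtain ⟨y, rfl, -⟩ := OTree.map_eq_corolla h
      have h2 := Tr.map_eq_leaf (congrArg OTree.tree h')
      have h3 := hn y
      rw [OTree.corolla_subst] at e
      rw [e] at h3
      change TreeClass.IsNode (Q'.tree.subst _) at h3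
      rw [h2] at h3
      exact h3.elim
    · obtain ⟨y, rfl, -⟩ := OTree.map_eq_corolla h'
      have h2 := Tr.map_eq_leaf (congrArg OTree.tree h)
      have h3 := hn y
      rw [OTree.corolla_subst] at e
      rw [← e] at h3
      change TreeClass.IsNode (Q.tree.subst _) at h3
      rw [h2] at h3
      exact h3.elim
    · refine ⟨OTree.ext ?_, rfl⟩
      rw [Tr.map_eq_leaf (congrArg OTree.tree h), Tr.map_eq_leaf (congrArg OTree.tree h')]

namespace UnitalCatOperad
variable {C : ℕ → Type u} [∀ n, Category.{v} (C n)] (O : UnitalCatOperad C)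

theorem distributive_tree (h : ∀ {n m : ℕ} (φ : Elem n m), O.Distributive φ.twoTree) :
    ∀ {n : ℕ} (T : LTree n), O.Distributive T.tree
  | _, .single _ => O.distributive_corolla _
  | _, .cons φ T => (h φ).subst fun k y => by
      cases y with
      | bottom => exact distributive_tree h T
      | top => exact O.distributive_corolla _

/-- A tree other than | is a permuted corolla with a planar tree substituted, and planar trees
underlie leveled trees, which are iterated substitutions of two-vertex trees and corollas. -/
theorem allDistributive (h : ∀ {n m : ℕ} (φ : Elem n m), O.Distributive φ.twoTree) :
    O.AllDistributive := by
  intro n t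
  by_cases ht : TreeClass.IsNode t.tree
  · obtain ⟨π, Q, hQ, rfl⟩ := symGenerators.exists_fact t ht
    obtain ⟨y, rfl⟩ := OTree.map_eq_corollaPerm hQ
    refine (O.distributive_corollaPerm π y).subst fun k y => ?_
    obtain ⟨T, hT⟩ := LTree.exists_tree_eq y.2
    rw [OTree.shape_eq] at hT
    rw [← hT]
    exact O.distributive_tree h T
  · obtain ⟨t, hl⟩ := t
    cases t with
    | leaf l => exact O.distributive_leaf l hl
    | node k x ts => exact (ht trivial).elim

/-- The composition of a collection along corollas. -/
def corollaStr (A : IColl C) {n : ℕ} (t : OTree Pt n) (ht : t = OTree.corolla ⟨⟩) :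
    O.ev t (fun k _ => A k) ⟶ A n :=
  O.toPt t (t.shape_eq.trans ht) A ≫ O.evCorolla (Y := Pt) ⟨⟩ fun k _ => A k

theorem corollaStr_corolla (A : IColl C) (n : ℕ) :
    O.corollaStr A (OTree.corolla ⟨⟩) rfl = O.evCorolla (n := n) (Y := Pt) ⟨⟩ fun k _ => A k := by
  rw [corollaStr, toPt_self, Category.id_comp]

theorem cmp_corollaStr (A : IColl C) {Y : ℕ → Type} {n : ℕ} (Q : OTree Y n)
    (r : ∀ k, Y k → OTree Pt k) {t t' : OTree Pt n} (h : Q.subst r = t) (h' : Q.subst r = t')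
    (ht : t = OTree.corolla ⟨⟩) (ht' : t' = OTree.corolla ⟨⟩) :
    O.cmp Q r h (fun k _ => A k) ≫ O.corollaStr A t ht =
      O.cmp Q r h' (fun k _ => A k) ≫ O.corollaStr A t' ht' := by
  subst h h'
  rfl

theorem corollaStr_natural {A B : IColl C} (f : A ⟶ B) {n : ℕ} (t : OTree Pt n)
    (ht : t = OTree.corolla ⟨⟩) :
    O.corollaStr A t ht ≫ f n = O.evMap t (fun k _ => f k) ≫ O.corollaStr B t ht := by
  subst ht
  rw [corollaStr_corolla, corollaStr_corolla]
  exact (O.evCorolla_natural (Y := Pt) (n := n) ⟨⟩ fun k _ => f k).symm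

/-- A collection is the same thing as an operad for the class of corollas. -/
def corollaOp : IColl C ⥤ IOp TreeClass.corollas O where
  obj A :=
    { obj := A
      str t := O.corollaStr A t.1 t.2
      str_corolla n := O.corollaStr_corolla A n
      str_subst := by
        intro n Y Q r hQ
        obtain ⟨y, rfl, -⟩ := OTree.map_eq_corolla hQ
        refine (congrArg (· ≫ _) ((O.act _).map_comp _ _)).trans ((Category.assoc _ _ _).trans ?_)
        have h1 := O.cmp_corollaStr A (OTree.corolla y) (fun k y => (r k y).1) rfl
          (OTree.corolla_subst _ _) (TreeClass.corollas.subst_mem _ _ hQ fun k y => (r k y).2)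
          (r n y).2
        rw [cmp_corolla_left] at h1
        refine Eq.trans ?_ (h1.trans (O.evCorolla_natural y
          fun k y => O.corollaStr A (r k y).1 (r k y).2).symm).symm
        refine congrArg (_ ≫ ·) ?_
        refine (congrArg (· ≫ _) ((O.act n).map_id _)).trans ((Category.id_comp _).trans ?_)
        exact O.corollaStr_corolla A n }
  map f := ⟨f, fun t => O.corollaStr_natural f t.1 t.2⟩

theorem strPt_corollas (A : IOp TreeClass.corollas O) {n : ℕ} (t : OTree Pt n)
    (ht : t = OTree.corolla ⟨⟩) : A.strPt t ht = O.corollaStr A.obj t ht := by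
  subst ht
  exact (A.str_corolla n).trans (O.corollaStr_corolla A.obj n).symm

/-- The unit axiom determines the structure at corollas, so a map of collections is automatically a
morphism and the bijection is the identity on underlying maps. -/
def corollaOpAdjunction : O.corollaOp ⊣ IOp.forgetToIColl TreeClass.corollas O :=
  Adjunction.mkOfHomEquiv
    { homEquiv _ B :=
        { toFun f := f.hom
          invFun g := ⟨g, fun t => (O.corollaStr_natural g t.1 t.2).trans
            (congrArg (_ ≫ ·) (O.strPt_corollas B t.1 t.2).symm)⟩
          left_inv _ := rfl
          right_inv _ := rfl }
      homEquiv_naturality_left_symm _ _ := rfl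
      homEquiv_naturality_right _ _ := rfl }

variable {O} [∀ n, HasColimits (C n)] (hD : O.AllDistributive)

noncomputable def free₁ : IColl C ⥤ IOpNs O :=
  O.corollaOp ⋙ (corollaGenerators TreeClass.planar).leftAdjoint
    (TreeClass.planar.corollas_le) hD

/-- Forgetting all compositions is, by definition, restricting to corollas and then taking the
underlying collection, so the two adjunctions compose. -/
noncomputable def adjunction₁ : free₁ hD ⊣ U₁ O :=
  O.corollaOpAdjunction.comp ((corollaGenerators TreeClass.planar).adjunction
    (TreeClass.planar.corollas_le) hD)

theorem adjunction₁_unit_app (X : IColl C) : (adjunction₁ hD).unit.app X =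
    (corollaGenerators TreeClass.planar).unitHom (O.corollaOp.obj X) :=
  ((Adjunction.comp_unit_app _ _ _).trans (Category.id_comp _)).trans (congrArg IOp.Hom.hom
    ((corollaGenerators TreeClass.planar).adjunction_unit_app TreeClass.planar.corollas_le hD _))

end UnitalCatOperad
end FreeOp

/-! ### From coproducts over generators to the stated colimits. -/

namespace FreeOp
namespace UnitalCatOperad
variable {C : ℕ → Type u} [∀ n, Category.{v} (C n)] {O : UnitalCatOperad C}

/-- Leveled trees with the same planar tree are uniquely isomorphic, so a cocone on `O.xhat X n` is
the same as a family of maps out of the composites of `X` along planar trees. -/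
theorem isColimit_treeCocone {X : IColl C} {A : IOpNs O} (y : X ⟶ A.obj) (n : ℕ)
    (h : IsCoprod fun t : {t : OTree Pt n // TreeClass.planar.mem n t} =>
      O.evMap t.1 (fun k _ => y k) ≫ A.strPt t.1 t.2) :
    Nonempty (IsColimit (treeCocone y n)) := by
  choose T hT using fun t : {t : OTree Pt n // TreeClass.planar.mem n t} =>
    LTree.exists_tree_eq t.2
  let g (s : Cocone (O.xhat X n)) (t : {t : OTree Pt n // TreeClass.planar.mem n t}) :
      O.ev t.1 (fun k _ => X k) ⟶ s.pt :=
    (O.act n).map (eqToHom (congrArg (fun t => OTree.const t X) (hT t).symm)) ≫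
      (O.xhatIso X (T t)).inv ≫ s.ι.app (T t)
  -- The family `g` is defined by chosen representatives; naturality of the cocone along the unique
  -- isomorphism to the representative removes the choice.
  have key : ∀ (s : Cocone (O.xhat X n)) (T' : LTree n),
      (O.xhatIso X T').hom ≫ g s ⟨T'.tree, T'.tree_planar⟩ = s.ι.app T' := by
    intro s T'
    let f : T' ⟶ T ⟨T'.tree, T'.tree_planar⟩ :=
      ⟨LTree.eqvGen_of_tree_eq (hT ⟨T'.tree, T'.tree_planar⟩).symm⟩
    refine Eq.trans ?_ (s.w f)
    exact (Category.assoc _ _ _).symm.trans ((Category.assoc _ _ _).symm.trans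
      (congrArg (· ≫ _) (Category.assoc _ _ _)))
  refine ⟨{
    desc := fun s => (h s.pt (g s)).choose
    fac := fun s T' => ?_
    uniq := fun s m hm => (h s.pt (g s)).choose_spec.2 m fun t => ?_ }⟩
  · refine Eq.trans ?_ (key s T')
    refine (Category.assoc _ _ _).trans (congrArg (_ ≫ ·) ?_)
    exact (h s.pt (g s)).choose_spec.1 ⟨T'.tree, T'.tree_planar⟩
  · obtain ⟨t, ht⟩ := t
    obtain ⟨T', rfl⟩ := LTree.exists_tree_eq ht
    refine (cancel_epi (O.xhatIso X T').hom).1 (Eq.trans ?_ ((hm T').trans (key s T').symm))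
    exact (Category.assoc _ _ _).symm

variable [∀ n, HasColimits (C n)]

/-- The summand of the corolla is `A n`, up to the unit isomorphism, and that of | is the unit of
`O`. Outside arity one there is no generator |, which matches an initial second summand. -/
theorem isColimit_unitCofan {A : IOpNu O} {B : IOpU O} (y : A ⟶ (U₃ O).obj B) (n : ℕ)
    (h : IsCoprod fun i : Option (PLift (n = 1)) =>
      O.evMap (unitGenerators.tree n i) (fun k _ => y.hom k) ≫
        B.strPt (unitGenerators.tree n i) trivial) :
    Nonempty (IsColimit (unitCofan y n)) := by
  have hc : O.evMap (unitGenerators.tree n none) (fun k _ => y.hom k) ≫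
      B.strPt (unitGenerators.tree n none) trivial =
        O.evCorolla (PUnit.unit : Pt n) (fun k _ => A.obj k) ≫ y.hom n :=
    (congrArg (_ ≫ ·) (B.str_corolla n)).trans
      (O.evCorolla_natural (PUnit.unit : Pt n) fun k _ => y.hom k)
  have hc' : ∀ {Z : C n} (f : A.obj n ⟶ Z) (m : B.obj n ⟶ Z),
      (O.evMap (unitGenerators.tree n none) (fun k _ => y.hom k) ≫
        B.strPt (unitGenerators.tree n none) trivial) ≫ m =
          O.evCorolla (PUnit.unit : Pt n) (fun k _ => A.obj k) ≫ f ↔ y.hom n ≫ m = f := by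
    intro Z f m
    rw [hc]
    have e := Category.assoc (O.evCorolla (n := n) (Y := Pt) ⟨⟩ fun k _ => A.obj k) (y.hom n) m
    exact ⟨fun h => (cancel_epi _).1 (e.symm.trans h), fun h => e.trans (congrArg (_ ≫ ·) h)⟩
  suffices H : ∀ (Z : C n) (f : A.obj n ⟶ Z) (g : unitColl O n ⟶ Z),
      ∃! m : B.obj n ⟶ Z, y.hom n ≫ m = f ∧ unitCollMap B n ≫ m = g by
    choose m hm hu using H
    exact ⟨BinaryCofan.IsColimit.mk _ (fun f g => m _ f g) (fun f g => (hm _ f g).1)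
      (fun f g => (hm _ f g).2) fun f g m' h1 h2 => hu _ f g m' ⟨h1, h2⟩⟩
  have hne : n ≠ 1 → ∀ (Z : C n) (f : A.obj n ⟶ Z),
      ∃! m : B.obj n ⟶ Z, y.hom n ≫ m = f := by
    intro hn Z f
    obtain ⟨m, hm, hu⟩ := h Z fun
      | none => O.evCorolla (PUnit.unit : Pt n) (fun k _ => A.obj k) ≫ f
      | some h => (hn h.down).elim
    refine ⟨m, (hc' f m).1 (hm none), fun m' hm' => hu m' ?_⟩
    rintro (_ | h)
    · exact (hc' f m').2 hm'
    · exact (hn h.down).elim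
  intro Z f g
  match n with
  | 0 =>
    obtain ⟨m, hm, hu⟩ := hne (by omega) Z f
    exact ⟨m, ⟨hm, initialIsInitial.hom_ext _ _⟩, fun m' hm' => hu m' hm'.1⟩
  | n + 2 =>
    obtain ⟨m, hm, hu⟩ := hne (by omega) Z f
    exact ⟨m, ⟨hm, initialIsInitial.hom_ext _ _⟩, fun m' hm' => hu m' hm'.1⟩
  | 1 =>
    have hl : O.evMap (unitGenerators.tree 1 (some ⟨rfl⟩)) (fun k _ => y.hom k) ≫
        B.strPt (unitGenerators.tree 1 (some ⟨rfl⟩)) trivial = unitMap B :=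
      (congrArg (· ≫ _) ((O.act 1).map_id _)).trans (Category.id_comp _)
    obtain ⟨m, hm, hu⟩ := h Z fun
      | none => O.evCorolla (PUnit.unit : Pt 1) (fun k _ => A.obj k) ≫ f
      | some _ => g
    refine ⟨m, ⟨(hc' f m).1 (hm none), (congrArg (· ≫ m) hl).symm.trans (hm (some ⟨rfl⟩))⟩,
      fun m' hm' => hu m' ?_⟩
    rintro (_ | h)
    · exact (hc' f m').2 hm'.1
    · exact (congrArg (· ≫ m') hl).trans hm'.2

end UnitalCatOperad
end FreeOp

theorem mainTheorem7 {C : ℕ → Type u} [∀ n, Category.{v} (C n)] [∀ n, HasColimits (C n)]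
    (O : UnitalCatOperad C)
    (hleft : ∀ {n m : ℕ} (φ : Elem n m) (y : C φ.arity),
      PreservesColimits ((O.odot φ).flip.obj y))
    (hright : ∀ {n m : ℕ} (φ : Elem n m) (x : C m), PreservesColimits ((O.odot φ).obj x)) :
    ∃ (F₁ : IColl C ⥤ IOpNs O) (F₂ : IOpNs O ⥤ IOpNu O) (F₃ : IOpNu O ⥤ IOpU O)
      (adj₁ : F₁ ⊣ U₁ O) (adj₂ : F₂ ⊣ U₂ O) (adj₃ : F₃ ⊣ U₃ O),
      (∀ (X : IColl C) (n : ℕ),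
        Nonempty (IsColimit (treeCocone (adj₁.unit.app X) n))) ∧
      (∀ (A : IOpNs O) (n : ℕ),
        Nonempty (IsColimit (symCofan (adj₂.unit.app A) n))) ∧
      (∀ (A : IOpNu O) (n : ℕ),
        Nonempty (IsColimit (unitCofan (adj₃.unit.app A) n))) ∧
      Nonempty (F₁ ⋙ F₂ ⋙ F₃ ⊣ U O) := by
  -- The hypotheses on the partial compositions enter only here, and only through small coproducts.
  have hD : O.AllDistributive := O.allDistributive fun φ => O.distributive_twoTree φ
    (fun y => by
      have := hleft φ y
      exact preservesColimitsOfSize_shrink.{0, v, 0, v} _)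
    (fun x => by
      have := hright φ x
      exact preservesColimitsOfSize_shrink.{0, v, 0, v} _)
  refine ⟨free₁ hD, symGenerators.leftAdjoint TreeClass.planar_le hD,
    unitGenerators.leftAdjoint TreeClass.nonUnital_le hD, adjunction₁ hD,
    symGenerators.adjunction TreeClass.planar_le hD,
    unitGenerators.adjunction TreeClass.nonUnital_le hD, fun X n => ?_, fun A n => ?_,
    fun A n => ?_, ⟨(adjunction₁ hD).comp ((symGenerators.adjunction TreeClass.planar_le hD).comp
      (unitGenerators.adjunction TreeClass.nonUnital_le hD))⟩⟩
  · rw [adjunction₁_unit_app]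
    exact isColimit_treeCocone _ n
      ((corollaGenerators TreeClass.planar).isCoprod_unit hD (O.corollaOp.obj X) n)
  · rw [symGenerators.adjunction_unit_app]
    -- Composition along a permuted corolla is by definition the action of the permutation, so the
    -- coproduct cofan is already the required one.
    exact (symGenerators.isCoprod_unit hD A n).isColimit
  · rw [unitGenerators.adjunction_unit_app]
    exact isColimit_unitCofan _ n (unitGenerators.isCoprod_unit hD A n)
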